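/- **Setting.** Let $c\ge 1$ and let $A_1,\dots,A_c$ be simple graphs ("atoms") on the vertex set $[n]$. Let $\underline A_j$ be $A_j$ with its isolated vertices removed. Assume that the union graph $A_1+\cdots+A_c$ is connected and that each $\underline A_j$ is nonempty and connected. Fix $v_1\in[n]$. The additive product graph $X=A_1\oplus\cdots\oplus A_c$ has as vertices the strings $v_1C_1v_2C_2\cdots v_kC_kv_{k+1}$ ($k\ge 0$, $v_i\in[n]$, $C_i\in[c]$) with $C_i\ne C_{i+1}$, $v_i\ne v_{i+1}$ and $v_i,v_{i+1}\in\underline A_{C_i}$. The label of a string is its last vertex. The edges of type $C$ are the pairs $\{sCu,sCv\}$ with $\{u,v\}\in E(A_C)$, and the pairs $\{s,sCv\}$ where $s$ has label $u$ and $\{u,v\}\in E(A_C)$. The graph $X$ is usually infinite. **Algorithm.** Let $p\ge 0$, $\gamma_{i,C}\in\mathbb R$, $\beta_i\in\mathbb R$ ($1\le i\le p$, $C\in[c]$). On a finite graph $H$ with edge set $E$ whose edges are divided into types $C\in[c]$, the ma-QAOA state is $$|\gamma,\beta\rangle=U_B(\beta_p)U_C(\gamma_p)\cdots U_B(\beta_1)U_C(\gamma_1)|+\rangle^{\otimes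 V},\quad U_B(\beta_i)=e^{-i\beta_i\sum_v X_v},\quad U_C(\gamma_i)=e^{\,i\sum_{C}\gamma_{i,C}\sum_{\{u,v\}\text{ of type }C}Z_uZ_v}.$$ Let $C_{MC}=\sum_{\{u,v\}\in E}\frac12(1-Z_uZ_v)$; the expected cut fraction of $H$ is $\langle\gamma,\beta|C_{MC}|\gamma,\beta\rangle/|E|$. For an edge $\{x,y\}$ of $X$, $\langle Z_xZ_y\rangle$ denotes $\langle\gamma,\beta|Z_xZ_y|\gamma,\beta\rangle$ for the ma-QAOA on the finite subgraph of $X$ induced on the vertices at distance at most $p$ from $x$ or $y$. **Formula.** Index $a\in\{\pm1\}^{2p+1}$ as $a=(a_1,\dots,a_p,a_0,a_{-p},\dots,a_{-1})$, and write $a^{[0]}$ for the entry $a_0$. Put $\Gamma_C=(\gamma_{1,C},\dots,\gamma_{p,C},0,-\gamma_{p,C},\dots,-\gamma_{1,C})$ and $$f(a)=\tfrac12\langle a_1|e^{i\beta_1X}|a_2\rangle\cdots\langle a_p|e^{i\beta_pX}|a_0\rangle\langle a_0|e^{-i\beta_pX}|a_{-p}\rangle\cdots\langle a_{-2}|e^{-i\beta_1X}|a_{-1}\rangle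 .$$ Let $\mathrm{dis}$ be the distance in $\underline A_C$ and let $zz'$ be the entrywise product. Set $G^{[0]}_{C,a}=1$ and, for $m\ge1$ and $a\in\underline A_C$, with $S=\{k\in\underline A_C:\mathrm{dis}(k,a)\le m\}$, $$G^{[m]}_{C,a}(z_a)=\sum_{(z_k)_{k\in S\setminus\{a\}}}\ \prod_{k\in S\setminus\{a\}}\Big[f(z_k)\prod_{C'\ne C,\ k\in\underline A_{C'}}G^{[m-\mathrm{dis}(k,a)]}_{C',k}(z_k)\Big]\exp\Big[-i\,\Gamma_C\cdot\sum_{\{k_1,k_2\}\in E(A_C),\ k_1,k_2\in S}z_{k_1}z_{k_2}\Big],$$ each $z_k$ running over $\{\pm1\}^{2p+1}$. For an edge $\{a,b\}$ of $A_C$, with $d(k)=\min(\mathrm{dis}(k,a),\mathrm{dis}(k,b))$ and $S=\{k\in\underline A_C:d(k)\le p\}$, set $$\mathbb E[\underline A_C(a,b)]=-\sum_{(z_k)_{k\in S}}z_a^{[0]}z_b^{[0]}\prod_{k\in S}\Big[f(z_k)\prod_{C'\ne C,\ k\in\underline A_{C'}}G^{[p-d(k)]}_{C',k}(z_k)\Big]\exp\Big[-i\,\Gamma_C\cdot\sum_{\{k_1,k_2\}\in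 E(A_C),\ k_1,k_2\in S}z_{k_1}z_{k_2}\Big].$$ **Theorem.** 1. For every $C$ and every edge $\{a,b\}$ of $A_C$ there is an edge $\{x,y\}$ of $X$ of type $C$ such that $x$ has label $a$ and $y$ has label $b$, and for every such edge $-\langle Z_xZ_y\rangle=\mathbb E[\underline A_C(a,b)]$. The same value results if the ma-QAOA is run on the subgraph of $X$ induced on any finite vertex set that contains all the vertices at distance at most $p$ from $x$ or $y$. 2. Let $$\Phi=\frac12+\frac1{2(|E(\underline A_1)|+\cdots+|E(\underline A_c)|)}\sum_{C\in[c]}\ \sum_{\{a,b\}\in E(\underline A_C)}\mathbb E[\underline A_C(a,b)].$$ The expected cut fraction of the ma-QAOA on $X$ is $\Phi$, in the following two senses. (a) There is a finite set $F$ of edges of $X$ that contains exactly one edge of each orbit of edges under the automorphisms of $X$ that preserve the labels and the edge types. Every such $F$ has $|E(\underline A_1)|+\cdots+|E(\underline A_c)|$ elements, and $\frac1{|F|}\sum_{\{x,y\}\in F}\frac12(1-\langle Z_xZ_y\rangle)=\Phi$. (b) Let $H$ be a finite graph with typed edges and $\pi:X\to H$ a surjective map on vertices that, at each vertex $x$,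 maps the neighbours of $x$ bijectively to those of $\pi(x)$, also for the edges of each single type, and that identifies only vertices with equal labels. Suppose that, for each edge $\{x,y\}$ of $X$, $\pi$ is injective on the set of vertices at distance at most $p$ from $x$ or $y$. Then $\langle\gamma,\beta|C_{MC}|\gamma,\beta\rangle/|E(H)|=\Phi$ for the ma-QAOA on $H$. (If $X$ is finite, $H=X$ is allowed.) 3. If $\gamma_{i,C}=\gamma_i$ does not depend on $C$, then the ma-QAOA states on the finite induced subgraphs of $X$, and on every finite graph $H$ covered by $X$ as in 2(b) (with or without the injectivity assumption), are the states of the standard QAOA with angles $(\gamma_i,\beta_i)$. So the formulas hold for the standard QAOA. -/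

import Mathlib

noncomputable section

namespace MaQAOA

open scoped Matrix

/-! ## The (multi-angle) QAOA for MaxCut on a finite graph

Spins are elements of `ℤˣ = {1, -1}`; the computational basis of the qubits sitting on the vertices
of `W` is `W → ℤˣ`, states are vectors `(W → ℤˣ) → ℂ` and operators are matrices. -/

section Circuit

variable {W : Type*} [Fintype W] [DecidableEq W] {ι : Type*} [Fintype ι] {p : ℕ}

/-- Pauli `Z` on the qubit `v`. -/
def pauliZ (v : W) : Matrix (W → ℤˣ) (W → ℤˣ) ℂ :=
  Matrix.diagonal fun z => (((z v : ℤˣ) : ℤ) : ℂ)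

/-- Pauli `X` on the qubit `v`: it flips the spin at `v`. -/
def pauliX (v : W) : Matrix (W → ℤˣ) (W → ℤˣ) ℂ :=
  fun z z' => if z' = Function.update z v (-(z v)) then 1 else 0

theorem pauliZ_mul_comm (u v : W) : pauliZ u * pauliZ v = pauliZ v * pauliZ u := by
  simp only [pauliZ, Matrix.diagonal_mul_diagonal, mul_comm]

/-- The operator `Z_u Z_v` of an unordered pair `{u, v}`. -/
def pauliZZ (e : Sym2 W) : Matrix (W → ℤˣ) (W → ℤˣ) ℂ :=
  Sym2.lift ⟨fun u v => pauliZ u * pauliZ v, pauliZ_mul_comm⟩ e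

/-- Sum of an operator-valued function over the edges of a finite graph. -/
def edgeSum (H : SimpleGraph W) (T : Sym2 W → Matrix (W → ℤˣ) (W → ℤˣ) ℂ) :
    Matrix (W → ℤˣ) (W → ℤˣ) ℂ :=
  open Classical in ∑ e ∈ H.edgeFinset, T e

/-- The unscaled cost operator `C = - ∑_{(u,v) ∈ E} Z_u Z_v`. -/
def costOp (H : SimpleGraph W) : Matrix (W → ℤˣ) (W → ℤˣ) ℂ :=
  edgeSum H fun e => -pauliZZ e

/-- The MaxCut operator `C_MC = ∑_{(u,v) ∈ E} (1 - Z_u Z_v) / 2`. -/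
def maxCutOp (H : SimpleGraph W) : Matrix (W → ℤˣ) (W → ℤˣ) ℂ :=
  edgeSum H fun e => (1 / 2 : ℂ) • (-pauliZZ e + 1)

/-- The mixing operator `B = ∑_v X_v`. -/
def mixOp (W : Type*) [Fintype W] [DecidableEq W] : Matrix (W → ℤˣ) (W → ℤˣ) ℂ := ∑ v : W, pauliX v

/-- `U(B, β) = exp(-i β B)`. -/
def mixU (W : Type*) [Fintype W] [DecidableEq W] (β : ℝ) : Matrix (W → ℤˣ) (W → ℤˣ) ℂ :=
  NormedSpace.exp ((-Complex.I * (β : ℂ)) • mixOp W)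

/-- `U(C, γ) = exp(-i ∑_j γ_j C_j)`, where `C_j` is the cost operator of the edges of type `j`. -/
def costU (H : ι → SimpleGraph W) (γ : ι → ℝ) : Matrix (W → ℤˣ) (W → ℤˣ) ℂ :=
  NormedSpace.exp ((-Complex.I) • ∑ j, (γ j : ℂ) • costOp (H j))

/-- The uniform superposition `|+⟩ ⊗ ⋯ ⊗ |+⟩`. -/
def plusState (W : Type*) [Fintype W] : (W → ℤˣ) → ℂ :=
  fun _ => ∏ _v : W, ((1 / Real.sqrt 2 : ℝ) : ℂ)

/-- The state `U(B, β_p) U(C, γ_p) ⋯ U(B, β_1) U(C, γ_1) |s⟩` of the ma-QAOA with `p` layers on the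
graph whose edges of type `j` are those of `H j`. The angle of layer `i` and edge type `j` is
`γ i j`, and all the vertices share the angle `β i`. -/
def maState (H : ι → SimpleGraph W) (γ : Fin p → ι → ℝ) (β : Fin p → ℝ) : (W → ℤˣ) → ℂ :=
  Fin.foldl p (fun ψ i => mixU W (β i) *ᵥ (costU H (γ i) *ᵥ ψ)) (plusState W)

/-- The state of the standard QAOA: all the edges share one angle `γ i` in layer `i`. -/
def qaoaState (H : SimpleGraph W) (γ : Fin p → ℝ) (β : Fin p → ℝ) : (W → ℤˣ) → ℂ :=
  maState (fun _ : Unit => H) (fun i _ => γ i) β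

/-- `⟨ψ| M |ψ⟩`. -/
def expect (ψ : (W → ℤˣ) → ℂ) (M : Matrix (W → ℤˣ) (W → ℤˣ) ℂ) : ℂ :=
  star ψ ⬝ᵥ (M *ᵥ ψ)

/-- The expected cut fraction `⟨ψ| C_MC |ψ⟩ / |E|` of a state on a finite graph. -/
def cutFraction (H : SimpleGraph W) (ψ : (W → ℤˣ) → ℂ) : ℂ :=
  expect ψ (maxCutOp H) / (H.edgeSet.ncard : ℂ)

end Circuit

/-! ## Additive product graphs -/

section Product

variable {n c : ℕ}

/-- The last vertex of the string `v₁ C₁ v₂ ⋯ C_k v_{k+1}`. A string is stored as the list of the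
pairs `(C_i, v_{i+1})`, the last pair of the string being the head of the list. -/
def lastVertex (v₁ : Fin n) : List (Fin c × Fin n) → Fin n
  | [] => v₁
  | (_, u) :: _ => u

/-- The admissible strings: `C_i ≠ C_{i+1}`, the vertices `v_i ≠ v_{i+1}` are distinct and neither
is isolated in the atom `C_i`. -/
def Admissible (A : Fin c → SimpleGraph (Fin n)) (v₁ : Fin n) : List (Fin c × Fin n) → Prop
  | [] => True
  | (C, u) :: s =>
      Admissible A v₁ s ∧ (∀ q ∈ s.head?, q.1 ≠ C) ∧
        lastVertex v₁ s ∈ (A C).support ∧ u ∈ (A C).support ∧ lastVertex v₁ s ≠ u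

/-- The vertex set of the additive product graph of the atoms `A` with starting vertex `v₁`. -/
def PVertex (A : Fin c → SimpleGraph (Fin n)) (v₁ : Fin n) : Type :=
  {s : List (Fin c × Fin n) // Admissible A v₁ s}

variable (A : Fin c → SimpleGraph (Fin n)) (v₁ : Fin n)

instance : DecidableEq (PVertex A v₁) :=
  inferInstanceAs (DecidableEq {s : List (Fin c × Fin n) // Admissible A v₁ s})

/-- The vertex of `[n]` in which a string ends. -/
def label (x : PVertex A v₁) : Fin n := lastVertex v₁ x.1

/-- The edges of type `C` of the additive product graph: `{sCu, sCv}` for an edge `{u, v}` of the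
atom `C`, and `{s, sCv}` for an edge `{u, v}` of the atom `C`, where `u` is the last vertex of `s`
(the case `s = v₁` included). -/
def typeGraph (C : Fin c) : SimpleGraph (PVertex A v₁) :=
  SimpleGraph.fromRel fun x y =>
    (∃ s u v, x.1 = (C, u) :: s ∧ y.1 = (C, v) :: s ∧ (A C).Adj u v) ∨
    (∃ v, y.1 = (C, v) :: x.1 ∧ (A C).Adj (lastVertex v₁ x.1) v)

/-- The additive product graph `A_1 ⊕ ⋯ ⊕ A_c`. -/
def productGraph : SimpleGraph (PVertex A v₁) := ⨆ C, typeGraph A v₁ C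

/-- The vertices at distance at most `p` from `x` or from `y`. -/
def nbhd {V : Type*} (X : SimpleGraph V) (p : ℕ) (x y : V) : Set V :=
  {w | X.edist w x ≤ p ∨ X.edist w y ≤ p}

theorem finite_neighborSet (x : PVertex A v₁) :
    ((productGraph A v₁).neighborSet x).Finite := by
  refine Set.Finite.of_finite_image (f := Subtype.val) ?_ Subtype.val_injective.injOn
  refine Set.Finite.subset (s := (Set.range fun q : Fin c × Fin n => q :: x.1) ∪
    (Set.range fun q : Fin c × Fin n => q :: x.1.tail) ∪ {x.1.tail}) ?_ ?_
  · exact ((Set.finite_range _).union (Set.finite_range _)).union (Set.finite_singleton _)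
  · rintro _ ⟨y, hy, rfl⟩
    simp only [SimpleGraph.mem_neighborSet, productGraph, SimpleGraph.iSup_adj, typeGraph,
      SimpleGraph.fromRel_adj] at hy
    obtain ⟨C, hne, (⟨s, u, v, h1, h2, -⟩ | ⟨v, h1, -⟩) | (⟨s, u, v, h1, h2, -⟩ | ⟨v, h1, -⟩)⟩ := hy
    · left; right; exact ⟨(C, v), by simp [h1, h2]⟩
    · left; left; exact ⟨(C, v), h1.symm⟩
    · left; right; exact ⟨(C, u), by simp [h1, h2]⟩
    · right; simp [h1]

theorem finite_ball {V : Type*} (X : SimpleGraph V) (hX : ∀ x, (X.neighborSet x).Finite) (x : V)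
    (r : ℕ) : {w | X.edist w x ≤ r}.Finite := by
  have key : ∀ r : ℕ, {w | ∃ q : X.Walk w x, q.length ≤ r}.Finite := by
    intro r
    induction r with
    | zero =>
      refine (Set.finite_singleton x).subset ?_
      rintro w ⟨q, hq⟩
      exact SimpleGraph.Walk.eq_of_length_eq_zero (Nat.le_zero.mp hq)
    | succ r ih =>
      refine ((Set.finite_singleton x).union (ih.biUnion fun w _ => hX w)).subset ?_
      rintro w ⟨q, hq⟩
      cases q with
      | nil => left; rfl
      | cons h q' =>
        right
        simp only [SimpleGraph.Walk.length_cons] at hq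
        exact Set.mem_biUnion (⟨q', by omega⟩ : _ ∈ {w | ∃ q : X.Walk w x, q.length ≤ r}) h.symm
  refine (key r).subset ?_
  intro w hw
  have hne : X.edist w x ≠ ⊤ := ne_top_of_le_ne_top (by simp) (show X.edist w x ≤ r from hw)
  obtain ⟨q, hq⟩ := SimpleGraph.exists_walk_of_edist_ne_top hne
  refine ⟨q, ?_⟩
  have : (q.length : ℕ∞) ≤ r := hq ▸ hw
  exact_mod_cast this

theorem finite_nbhd (p : ℕ) (x y : PVertex A v₁) : (nbhd (productGraph A v₁) p x y).Finite :=
  (finite_ball _ (finite_neighborSet A v₁) x p).union (finite_ball _ (finite_neighborSet A v₁) y p)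

/-- The subgraph induced on a finite vertex set. -/
def inducedOn {V : Type*} (X : SimpleGraph V) (S : Finset V) : SimpleGraph S :=
  X.comap fun u : S => (u : V)

variable {p : ℕ}

/-- `⟨γ, β| Z_x Z_y |γ, β⟩` in the ma-QAOA that is run on the finite subgraph of the additive
product graph induced on `S`. -/
def finiteZZ (γ : Fin p → Fin c → ℝ) (β : Fin p → ℝ) (S : Finset (PVertex A v₁))
    (x y : PVertex A v₁) (hx : x ∈ S) (hy : y ∈ S) : ℂ :=
  expect (maState (fun C => inducedOn (typeGraph A v₁ C) S) γ β)
    (pauliZ ⟨x, hx⟩ * pauliZ ⟨y, hy⟩)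

/-- `⟨γ, β| Z_x Z_y |γ, β⟩` in the ma-QAOA with `p` layers on the (in general infinite) additive
product graph: the state is restricted to the `p`-neighbourhood of `{x, y}`. -/
def localZZ (γ : Fin p → Fin c → ℝ) (β : Fin p → ℝ) (x y : PVertex A v₁) : ℂ :=
  finiteZZ A v₁ γ β (finite_nbhd A v₁ p x y).toFinset x y (by simp [nbhd]) (by simp [nbhd])

/-- An automorphism of the additive product graph that keeps the labels of the vertices and the
types of the edges. -/
structure IsTypeAut (φ : PVertex A v₁ ≃ PVertex A v₁) : Prop where
  label_eq : ∀ x, label A v₁ (φ x) = label A v₁ x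
  adj_iff : ∀ C x y, (typeGraph A v₁ C).Adj (φ x) (φ y) ↔ (typeGraph A v₁ C).Adj x y

/-- `F` is a fundamental domain for the edges: it holds (with one of its two orientations) exactly
one edge of each orbit of edges under the automorphisms that keep labels and types. -/
structure IsEdgeDomain (F : Finset (PVertex A v₁ × PVertex A v₁)) : Prop where
  adj : ∀ q ∈ F, (productGraph A v₁).Adj q.1 q.2
  existsUnique : ∀ x y, (productGraph A v₁).Adj x y →
    ∃! q, q ∈ F ∧ ∃ φ, IsTypeAut A v₁ φ ∧ s(φ x, φ y) = s(q.1, q.2)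

/-- The expected cut fraction of the ma-QAOA over the edges of a fundamental domain: the average
over these edges of the probability `(1 - ⟨Z_x Z_y⟩) / 2` that the edge is cut. -/
def domainCutFraction (γ : Fin p → Fin c → ℝ) (β : Fin p → ℝ)
    (F : Finset (PVertex A v₁ × PVertex A v₁)) : ℂ :=
  (∑ q ∈ F, (1 - localZZ A v₁ γ β q.1 q.2) / 2) / (F.card : ℂ)

/-- The graph with edge types `H` on `W` is covered by the additive product graph through `π`:
`π` is onto, maps the edges of each type at `x` bijectively to those at `π x`, and identifies only
vertices with the same label. -/
structure IsTypeCovering {W : Type*} (H : Fin c → SimpleGraph W) (π : PVertex A v₁ → W) :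
    Prop where
  surjective : Function.Surjective π
  bijOn : ∀ x, Set.BijOn π ((productGraph A v₁).neighborSet x) ((⨆ C, H C).neighborSet (π x))
  bijOn_type : ∀ C x, Set.BijOn π ((typeGraph A v₁ C).neighborSet x) ((H C).neighborSet (π x))
  label_eq : ∀ x y, π x = π y → label A v₁ x = label A v₁ y

end Product

/-! ## The iterative formula -/

section Formula

variable {n c p : ℕ}

/-- Configurations `(a_1, …, a_p, a_0, a_{-p}, …, a_{-1})` of one vertex, in this order. -/
abbrev Config (p : ℕ) : Type := Fin (2 * p + 1) → ℤˣ

/-- The entry `a_0`, as a number. -/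
def mid (a : Config p) : ℂ := (((a ⟨p, by omega⟩ : ℤˣ) : ℤ) : ℂ)

/-- `Γ_C = (γ_{1,C}, …, γ_{p,C}, 0, -γ_{p,C}, …, -γ_{1,C})`. -/
def Gam (γ : Fin p → Fin c → ℝ) (C : Fin c) (j : Fin (2 * p + 1)) : ℝ :=
  if h : j.1 < p then γ ⟨j.1, h⟩ C
  else if h' : j.1 = p then 0
  else -γ ⟨2 * p - j.1, by omega⟩ C

/-- `Γ_C · (a b)`, with the entrywise product `a b`. -/
def gamDot (γ : Fin p → Fin c → ℝ) (C : Fin c) (a b : Config p) : ℂ :=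
  ∑ j, (Gam γ C j : ℂ) * (((a j : ℤˣ) : ℤ) : ℂ) * (((b j : ℤˣ) : ℤ) : ℂ)

/-- Pauli `X` on a single qubit. -/
def sigmaX : Matrix ℤˣ ℤˣ ℂ := fun a b => if b = -a then 1 else 0

/-- The angles `(β_1, …, β_p, -β_p, …, -β_1)` of the factors of `f`. -/
def betaSeq (β : Fin p → ℝ) (j : Fin (2 * p)) : ℝ :=
  if h : j.1 < p then β ⟨j.1, h⟩ else -β ⟨2 * p - 1 - j.1, by omega⟩

/-- `f(a) = 1/2 ⟨a_1|e^{iβ_1 X}|a_2⟩ ⋯ ⟨a_p|e^{iβ_p X}|a_0⟩ ⟨a_0|e^{-iβ_p X}|a_{-p}⟩ ⋯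
⟨a_{-2}|e^{-iβ_1 X}|a_{-1}⟩`. -/
def fWeight (β : Fin p → ℝ) (a : Config p) : ℂ :=
  (1 / 2 : ℂ) * ∏ j : Fin (2 * p),
    NormedSpace.exp ((Complex.I * (betaSeq β j : ℂ)) • sigmaX) (a j.castSucc) (a j.succ)

/-- `exp(-i Γ_C · ∑ z_{k₁} z_{k₂})`, the sum running over the edges of the atom `C` with both ends
in `S`; each such edge appears once, as the pair with `k₁ < k₂`. -/
def phase (A : Fin c → SimpleGraph (Fin n)) (γ : Fin p → Fin c → ℝ) (C : Fin c)
    (S : Finset (Fin n)) (z : Fin n → Config p) : ℂ :=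
  open Classical in
  Complex.exp (-Complex.I * ∑ q ∈ (S ×ˢ S).filter (fun q => q.1 < q.2 ∧ (A C).Adj q.1 q.2),
    gamDot γ C (z q.1) (z q.2))

/-- Extend a family of configurations on `S` to all the vertices, with the value `x` off `S`. -/
def extend (S : Finset (Fin n)) (x : Config p) (z : S → Config p) (k : Fin n) : Config p :=
  if h : k ∈ S then z ⟨k, h⟩ else x

/-- The vertices `k ≠ a` of the atom `C` (without its isolated vertices) at distance at most `m`
from `a`. Such an atom is connected in an additive product graph, so that `k ≠ a` means that the
distance is positive. -/
def puncturedBall (A : Fin c → SimpleGraph (Fin n)) (C : Fin c) (a : Fin n) (m : ℕ) :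
    Finset (Fin n) :=
  open Classical in
  Finset.univ.filter fun k => k ∈ (A C).support ∧ 0 < (A C).dist k a ∧ (A C).dist k a ≤ m

theorem puncturedBall_lt {A : Fin c → SimpleGraph (Fin n)} {C : Fin c} {a k : Fin n} {m : ℕ}
    (h : k ∈ puncturedBall A C a m) : m - (A C).dist k a < m := by
  simp only [puncturedBall, Finset.mem_filter] at h
  omega

/-- The other atoms `C' ≠ C` that contain the vertex `k`. -/
def otherAtoms (A : Fin c → SimpleGraph (Fin n)) (C : Fin c) (k : Fin n) : Finset (Fin c) :=
  open Classical in Finset.univ.filter fun C' => C' ≠ C ∧ k ∈ (A C').support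

/-- `G^{[m]}_{C,a}(z_a)` at `z_a = x`: the constant `1` for `m = 0`, and otherwise the sum over the
configurations `z_k` of the vertices `k ≠ a` of the atom `C` at distance at most `m` from `a`. -/
def iterG (A : Fin c → SimpleGraph (Fin n)) (γ : Fin p → Fin c → ℝ) (β : Fin p → ℝ)
    (m : ℕ) (C : Fin c) (a : Fin n) (x : Config p) : ℂ :=
  if m = 0 then 1
  else
    ∑ z : puncturedBall A C a m → Config p,
      (∏ k : puncturedBall A C a m,
        (fWeight β (z k) *
          ∏ C' ∈ otherAtoms A C k, iterG A γ β (m - (A C).dist k a) C' k (z k))) *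
      phase A γ C (insert a (puncturedBall A C a m)) (extend (puncturedBall A C a m) x z)
termination_by m
decreasing_by exact puncturedBall_lt k.2

/-- The vertices of the atom `C` (without its isolated vertices) at distance at most `m` from `a`
or from `b`. -/
def pairBall (A : Fin c → SimpleGraph (Fin n)) (C : Fin c) (a b : Fin n) (m : ℕ) :
    Finset (Fin n) :=
  open Classical in
  Finset.univ.filter fun k => k ∈ (A C).support ∧ min ((A C).dist k a) ((A C).dist k b) ≤ m

/-- The right-hand side of the formula for `𝔼[A_C(a, b)]`. -/
def edgeValue (A : Fin c → SimpleGraph (Fin n)) (γ : Fin p → Fin c → ℝ) (β : Fin p → ℝ)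
    (C : Fin c) (a b : Fin n) : ℂ :=
  -∑ z : pairBall A C a b p → Config p,
    mid (extend (pairBall A C a b p) 1 z a) * mid (extend (pairBall A C a b p) 1 z b) *
    (∏ k : pairBall A C a b p,
      (fWeight β (z k) *
        ∏ C' ∈ otherAtoms A C k,
          iterG A γ β (p - min ((A C).dist k a) ((A C).dist k b)) C' k (z k))) *
    phase A γ C (pairBall A C a b p) (extend (pairBall A C a b p) 1 z)

/-- `|E(A_1)| + ⋯ + |E(A_c)|`. -/
def totalEdges (A : Fin c → SimpleGraph (Fin n)) : ℕ := ∑ C, (A C).edgeSet.ncard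

/-- `1/2 + (∑_{C, (a,b) ∈ A_C} 𝔼[A_C(a, b)]) / (2 (|E(A_1)| + ⋯ + |E(A_c)|))`, each edge `{a, b}`
of an atom being taken once, as the pair with `a < b`. -/
def cutFormula (A : Fin c → SimpleGraph (Fin n)) (γ : Fin p → Fin c → ℝ) (β : Fin p → ℝ) : ℂ :=
  open Classical in
  1 / 2 + 1 / (2 * (totalEdges A : ℂ)) *
    ∑ C, ∑ q ∈ (Finset.univ : Finset (Fin n × Fin n)).filter
      (fun q => q.1 < q.2 ∧ (A C).Adj q.1 q.2), edgeValue A γ β C q.1 q.2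

end Formula

end MaQAOA

end

/-!
# Expectations of the ma-QAOA on additive product graphs

*Path sum.* Insert a complete set of computational basis states between any two of the unitaries in
`⟨γ, β| Z_x Z_y |γ, β⟩`. The cost unitaries are diagonal and the mixing unitaries are tensor
products of one-qubit operators, so the result is a sum over configurations, which assign to each
vertex a string of `2p + 1` spins; the summand is a product of one weight `f` per vertex and one
phase per edge (`expect_maState_eq_pathSum`).

*Light cone.* In the Heisenberg picture each layer enlarges the support of `Z_x Z_y` at most by the
neighbours of the support, and edges that do not touch the support cancel. Therefore the expectation
only depends on the `p`-neighbourhood of the edge (`expect_maState_congr`,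
`expect_eq_of_local_iso`).

*Structure of the product graph.* The product graph is a tree of copies of the atoms. The copy of
the atom `C` through a vertex `x` is named by its vertex nearest to the root, `base C x`, and its
vertices are the `step x C u`; two vertices are joined by an edge of type `C` exactly if they lie in
the same copy of `C` and their labels are adjacent there (`typeGraph_adj_iff`). Up to an isomorphism
preserving labels and types, every vertex with label `a` is the root of the product graph started at
`a` (`reroot`). So the orbit of an edge is determined by its type and labels, and its expectation
may be computed for an edge at the root.

*Iteration.* For such an edge `{root, b}` of type `C₀`, the path sum is taken over the vertices of
depth at most `p`, where `depth` is the distance to the edge. A copy attached at a vertex `s` meets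
the rest only in `s`. Summing over the vertices of the outermost copies therefore replaces each copy
by a function of the configuration of `s`, which is the function `iterG`; repeating this, one copy
level at a time (`levelSum_succ`), leaves a sum over the copy through the root, which is
`edgeValue` (`marg_openWeight_eq`, `neg_localZZ_eq_edgeValue`).

*Cut fractions.* A fundamental domain contains one edge for each edge of the atoms
(`IsEdgeDomain.sum_eq`). In a finite graph covered by the product graph the labels descend, each
vertex with label `k` has exactly one neighbour along an edge of type `C` for each neighbour of `k`
in the atom, and since the union of the atoms is connected all the labels occur equally often
(`card_label_eq`); hence each edge of an atom lies under the same number of edges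
(`sum_cover_edges`). In both cases the cut fraction is the average over the edges of the atoms.

*Equal angles.* An edge of the product graph, or of a graph covered by it, has only one type, so
with equal angles the typed cost operators add up to the cost operator of the union
(`maState_eq_qaoaState`).
-/

noncomputable section

namespace MaQAOA

open scoped Matrix

/-! ### Exponentials of involutions -/

section Exponentials

/-- The exponential of a multiple of an involution `P`: `exp (θ P) = cosh θ + (sinh θ) P`. -/
theorem exp_smul_of_mul_self_eq_one {m : Type*} [Fintype m] [DecidableEq m]
    (P : Matrix m m ℂ) (hP : P * P = 1) (θ : ℂ) :
    NormedSpace.exp (θ • P) = Complex.cosh θ • (1 : Matrix m m ℂ) + Complex.sinh θ • P := by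
  let _ : NormedRing (Matrix m m ℂ) := Matrix.linftyOpNormedRing
  let _ : NormedAlgebra ℂ (Matrix m m ℂ) := Matrix.linftyOpNormedAlgebra
  -- the algebra homomorphism from `ℂ × ℂ` given by the spectral projections of `P`
  let F : (ℂ × ℂ) →ₗ[ℂ] Matrix m m ℂ :=
    { toFun := fun s => ((s.1 + s.2) / 2) • (1 : Matrix m m ℂ) + ((s.1 - s.2) / 2) • P
      map_add' := by
        intro s t
        simp only [Prod.fst_add, Prod.snd_add]
        module
      map_smul' := by
        intro a s
        simp only [Prod.smul_fst, Prod.smul_snd, smul_eq_mul, RingHom.id_apply]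
        module }
  let G : (ℂ × ℂ) →ₐ[ℂ] Matrix m m ℂ := AlgHom.ofLinearMap F
    (by simp [F]) (by
      intro s t
      simp only [F, LinearMap.coe_mk, AddHom.coe_mk, Prod.fst_mul, Prod.snd_mul, add_mul, mul_add,
        smul_mul_smul_comm, hP, one_mul, mul_one]
      module)
  have hG : Continuous G := F.continuous_of_finiteDimensional
  have h := NormedSpace.map_exp G hG ((θ, -θ) : ℂ × ℂ)
  have h1 : G (θ, -θ) = θ • P := by
    change ((θ + -θ) / 2) • (1 : Matrix m m ℂ) + ((θ - -θ) / 2) • P = _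
    module
  rw [h1] at h
  refine Eq.trans h.symm ?_
  change (((NormedSpace.exp ((θ, -θ) : ℂ × ℂ)).1 + (NormedSpace.exp ((θ, -θ) : ℂ × ℂ)).2) / 2) •
    (1 : Matrix m m ℂ) + (((NormedSpace.exp ((θ, -θ) : ℂ × ℂ)).1 -
      (NormedSpace.exp ((θ, -θ) : ℂ × ℂ)).2) / 2) • P = _
  rw [Prod.fst_exp, Prod.snd_exp, Complex.cosh, Complex.sinh]
  simp [Complex.exp_eq_exp_ℂ]

theorem sigmaX_mul_self : sigmaX * sigmaX = 1 := by
  ext a b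
  rcases Int.units_eq_one_or a with rfl | rfl <;> rcases Int.units_eq_one_or b with rfl | rfl <;>
    simp [sigmaX, Matrix.mul_apply]

/-- The entries of `exp (iθX)`. -/
theorem exp_sigmaX_apply (θ : ℝ) (a b : ℤˣ) :
    NormedSpace.exp ((Complex.I * (θ : ℂ)) • sigmaX) a b =
      if a = b then (Real.cos θ : ℂ) else Complex.I * (Real.sin θ : ℂ) := by
  rw [exp_smul_of_mul_self_eq_one _ sigmaX_mul_self, mul_comm, Complex.cosh_mul_I,
    Complex.sinh_mul_I]
  rcases Int.units_eq_one_or a with rfl | rfl <;> rcases Int.units_eq_one_or b with rfl | rfl <;>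
    simp [sigmaX, mul_comm]

end Exponentials

/-! ### Tensor products and the mixing unitary -/

section Tensor

variable {W : Type*} [Fintype W] [DecidableEq W]

/-- The tensor product of one-qubit operators `M w`, one for each qubit `w`. -/
def tensor (M : W → Matrix ℤˣ ℤˣ ℂ) : Matrix (W → ℤˣ) (W → ℤˣ) ℂ :=
  fun z z' => ∏ w, M w (z w) (z' w)

theorem tensor_mul (M N : W → Matrix ℤˣ ℤˣ ℂ) :
    tensor M * tensor N = tensor fun w => M w * N w := by
  ext z z'
  simp only [tensor, Matrix.mul_apply, ← Finset.prod_mul_distrib]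
  rw [Fintype.prod_sum]

omit [DecidableEq W] in
theorem tensor_one : tensor (fun _ : W => (1 : Matrix ℤˣ ℤˣ ℂ)) = 1 := by
  ext z z'
  simp only [tensor, Matrix.one_apply]
  by_cases h : z = z'
  · simp [h]
  · obtain ⟨w, hw⟩ := Function.ne_iff.mp h
    rw [if_neg h]
    exact Finset.prod_eq_zero (Finset.mem_univ w) (if_neg hw)

theorem pauliX_eq_tensor (v : W) :
    pauliX v = tensor (Function.update (fun _ => 1) v sigmaX) := by
  ext z z'
  simp only [tensor, pauliX]
  by_cases h : z' = Function.update z v (-(z v))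
  · rw [if_pos h]
    symm
    refine Finset.prod_eq_one fun w _ => ?_
    by_cases hw : w = v
    · subst hw; simp [sigmaX, h]
    · simp [hw, h]
  · rw [if_neg h]
    obtain ⟨w, hw⟩ := Function.ne_iff.mp h
    symm
    refine Finset.prod_eq_zero (Finset.mem_univ w) ?_
    by_cases hv : w = v
    · subst hv; simpa [sigmaX] using hw
    · simp only [Function.update_of_ne hv] at hw ⊢
      exact Matrix.one_apply_ne (Ne.symm hw)

theorem pauliX_mul_self (v : W) : pauliX v * pauliX v = 1 := by
  rw [pauliX_eq_tensor, tensor_mul, ← tensor_one]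
  congr 1
  funext w
  by_cases hw : w = v
  · subst hw; simp [sigmaX_mul_self]
  · simp [hw]

theorem pauliX_commute (u v : W) : Commute (pauliX u) (pauliX v) := by
  by_cases huv : u = v
  · rw [huv]
  · simp only [Commute, SemiconjBy, pauliX_eq_tensor, tensor_mul]
    congr 1
    funext w
    by_cases hu : w = u
    · subst hu; simp [huv]
    · simp [hu]

theorem exp_smul_pauliX (θ : ℂ) (v : W) :
    NormedSpace.exp (θ • pauliX v) =
      tensor (Function.update (fun _ => 1) v (NormedSpace.exp (θ • sigmaX))) := by
  rw [exp_smul_of_mul_self_eq_one _ (pauliX_mul_self v),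
    exp_smul_of_mul_self_eq_one _ sigmaX_mul_self, pauliX_eq_tensor, ← tensor_one]
  ext z z'
  simp only [tensor, Matrix.add_apply, Matrix.smul_apply, smul_eq_mul]
  rw [← Finset.mul_prod_erase _ _ (Finset.mem_univ v),
    ← Finset.mul_prod_erase _ _ (Finset.mem_univ v),
    ← Finset.mul_prod_erase _ _ (Finset.mem_univ v)]
  have h (S : Matrix ℤˣ ℤˣ ℂ) : ∏ w ∈ Finset.univ.erase v,
      Function.update (fun _ : W => (1 : Matrix ℤˣ ℤˣ ℂ)) v S w (z w) (z' w) =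
      ∏ w ∈ Finset.univ.erase v, (1 : Matrix ℤˣ ℤˣ ℂ) (z w) (z' w) :=
    Finset.prod_congr rfl fun w hw => by rw [Function.update_of_ne (Finset.ne_of_mem_erase hw)]
  rw [h, h]
  simp only [Function.update_self, Matrix.add_apply, Matrix.smul_apply, smul_eq_mul]
  ring

theorem exp_smul_sum_pauliX (θ : ℂ) (s : Finset W) :
    NormedSpace.exp (θ • ∑ v ∈ s, pauliX v) =
      tensor fun v => if v ∈ s then NormedSpace.exp (θ • sigmaX) else 1 := by
  induction s using Finset.induction_on with
  | empty => simp [tensor_one]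
  | insert a s ha ih =>
    rw [Finset.sum_insert ha, smul_add, Matrix.exp_add_of_commute, ih, exp_smul_pauliX, tensor_mul]
    · congr 1
      funext w
      by_cases hw : w = a
      · subst hw; simp [ha]
      · simp [hw]
    · exact ((Commute.sum_right _ _ _ fun v _ => pauliX_commute a v).smul_right _).smul_left _

/-- The mixing unitary acts on each qubit separately. -/
theorem mixU_eq_tensor (β : ℝ) :
    mixU W β = tensor fun _ => NormedSpace.exp ((-Complex.I * (β : ℂ)) • sigmaX) := by
  rw [mixU, mixOp, exp_smul_sum_pauliX]
  simp

end Tensor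

/-! ### The cost unitary is diagonal -/

section Diagonal

variable {W : Type*} [Fintype W] [DecidableEq W] {ι : Type*} [Fintype ι]

/-- The product of the spins at the two ends of an edge. -/
def spinProd (z : W → ℤˣ) (e : Sym2 W) : ℤˣ :=
  Sym2.lift ⟨fun u v => z u * z v, fun u v => mul_comm (z u) (z v)⟩ e

omit [Fintype W] [DecidableEq W] in
@[simp] theorem spinProd_mk (z : W → ℤˣ) (u v : W) : spinProd z s(u, v) = z u * z v := rfl

theorem pauliZZ_eq_diagonal (e : Sym2 W) :
    pauliZZ e = Matrix.diagonal fun z => ((spinProd z e : ℤˣ) : ℂ) := by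
  induction e with
  | _ u v => simp [pauliZZ, pauliZ, Matrix.diagonal_mul_diagonal]

open Classical in
theorem costOp_eq_diagonal (H : SimpleGraph W) :
    costOp H = Matrix.diagonal fun z => -∑ e ∈ H.edgeFinset, ((spinProd z e : ℤˣ) : ℂ) := by
  simp only [costOp, edgeSum, pauliZZ_eq_diagonal]
  ext z z'
  by_cases h : z = z'
  · subst h; simp [Matrix.sum_apply]
  · simp [Matrix.sum_apply, h]

open Classical in
/-- The value of `∑_j γ_j ∑_{u v of type j} z_u z_v` at a spin configuration. -/
def costAngle (H : ι → SimpleGraph W) (γ : ι → ℝ) (z : W → ℤˣ) : ℝ :=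
  ∑ j, γ j * ∑ e ∈ (H j).edgeFinset, ((spinProd z e : ℤˣ) : ℝ)

theorem costU_eq_diagonal (H : ι → SimpleGraph W) (γ : ι → ℝ) :
    costU H γ = Matrix.diagonal fun z => Complex.exp (Complex.I * (costAngle H γ z : ℂ)) := by
  have h : ((-Complex.I) • ∑ j, (γ j : ℂ) • costOp (H j)) =
      Matrix.diagonal fun z => Complex.I * (costAngle H γ z : ℂ) := by
    ext z z'
    by_cases h : z = z'
    · subst h
      simp [costOp_eq_diagonal, Matrix.sum_apply, costAngle]
    · simp [costOp_eq_diagonal, Matrix.sum_apply, h]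
  rw [costU, h, Matrix.exp_diagonal]
  congr 1
  funext z
  rw [Pi.coe_exp, Complex.exp_eq_exp_ℂ]

end Diagonal

/-! ### Feynman path sums -/

section Path

variable {S : Type*} [Fintype S]

/-- The diagonal factors met by a Feynman path `h_0, …, h_{2p}` in `⟨ψ_p| o |ψ_p⟩`: the conjugate
phases of the bra, the observable `o` in the middle, and the phases of the ket in reverse order. -/
def pathDiag {p : ℕ} (d : Fin p → S → ℂ) (o : S → ℂ) (j : Fin (2 * p + 1)) (a : S) : ℂ :=
  if h : j.1 < p then star (d ⟨j.1, h⟩ a)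
  else if h' : j.1 = p then o a
  else d ⟨2 * p - j.1, by omega⟩ a

/-- The transition amplitudes along a Feynman path in `⟨ψ_p| o |ψ_p⟩`. -/
def pathStep {p : ℕ} (M : Fin p → Matrix S S ℂ) (j : Fin (2 * p)) (a b : S) : ℂ :=
  if h : j.1 < p then star (M ⟨j.1, h⟩ b a) else M ⟨2 * p - 1 - j.1, by omega⟩ a b

omit [Fintype S] in
theorem pathDiag_zero {p : ℕ} (d : Fin (p + 1) → S → ℂ) (o : S → ℂ) (a : S) :
    pathDiag d o 0 a = star (d 0 a) := by
  simp [pathDiag]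

omit [Fintype S] in
theorem pathDiag_last {p : ℕ} (d : Fin (p + 1) → S → ℂ) (o : S → ℂ) (a : S) :
    pathDiag d o (Fin.last _) a = d 0 a := by
  simp only [pathDiag, Fin.val_last]
  rw [dif_neg (by omega), dif_neg (by omega)]
  congr 1
  ext
  simp

omit [Fintype S] in
theorem pathDiag_succ_castSucc {p : ℕ} (d : Fin (p + 1) → S → ℂ) (o : S → ℂ)
    (j : Fin (2 * p + 1)) (a : S) :
    pathDiag d o (Fin.castSucc j).succ a = pathDiag (fun i => d i.succ) o j a := by
  simp only [pathDiag, Fin.val_succ, Fin.val_castSucc]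
  split_ifs <;> first | omega | rfl | skip
  congr 1
  ext
  simp only [Fin.val_succ]
  omega

omit [Fintype S] in
theorem pathStep_zero {p : ℕ} (M : Fin (p + 1) → Matrix S S ℂ) (a b : S) :
    pathStep M (⟨0, by omega⟩ : Fin (2 * (p + 1))) a b = star (M 0 b a) := by
  simp [pathStep]

omit [Fintype S] in
theorem pathStep_last {p : ℕ} (M : Fin (p + 1) → Matrix S S ℂ) (a b : S) :
    pathStep M (⟨2 * p + 1, by omega⟩ : Fin (2 * (p + 1))) a b = M 0 a b := by
  simp only [pathStep]
  rw [dif_neg (by omega)]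
  congr 1
  ext
  simp only [Fin.val_zero]
  omega

omit [Fintype S] in
theorem pathStep_succ_castSucc {p : ℕ} (M : Fin (p + 1) → Matrix S S ℂ) (j : Fin (2 * p))
    (a b : S) :
    pathStep M (⟨j.1 + 1, by omega⟩ : Fin (2 * (p + 1))) a b =
      pathStep (fun i => M i.succ) j a b := by
  simp only [pathStep]
  split_ifs <;> first | omega | rfl | skip
  congr 1
  ext
  simp only [Fin.val_succ]
  omega

/-- A sum over paths, with the first and the last point summed separately. -/
theorem sum_fin_cons_snoc {N : ℕ} (F : (Fin (N + 1 + 1) → S) → ℂ) :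
    ∑ h, F h = ∑ h : Fin N → S, ∑ s, ∑ t, F (Fin.cons s (Fin.snoc h t : Fin (N + 1) → S)) := by
  rw [← (Fin.consEquiv fun _ => S).sum_comp, Fintype.sum_prod_type, Finset.sum_comm]
  rw [← (Fin.snocEquiv fun _ => S).sum_comp, Fintype.sum_prod_type, Finset.sum_comm]
  refine Finset.sum_congr rfl fun h _ => ?_
  rw [Finset.sum_comm]
  rfl

variable [DecidableEq S]

/-- The Feynman path sum of `⟨ψ_p| o |ψ_p⟩` for a state prepared by alternating diagonal operators
`d i` and operators `M i`. -/
theorem foldl_path_sum {p : ℕ} (M : Fin p → Matrix S S ℂ) (d : Fin p → S → ℂ) (o : S → ℂ)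
    (ψ : S → ℂ) :
    star (Fin.foldl p (fun φ i => M i *ᵥ (Matrix.diagonal (d i) *ᵥ φ)) ψ) ⬝ᵥ
        (Matrix.diagonal o *ᵥ Fin.foldl p (fun φ i => M i *ᵥ (Matrix.diagonal (d i) *ᵥ φ)) ψ) =
      ∑ h : Fin (2 * p + 1) → S, star (ψ (h 0)) * ψ (h (Fin.last _)) *
        (∏ j, pathDiag d o j (h j)) *
          ∏ j : Fin (2 * p), pathStep M j (h j.castSucc) (h j.succ) := by
  induction p generalizing ψ with
  | zero =>
    rw [← (Equiv.funUnique (Fin 1) S).symm.sum_comp]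
    simp only [Fin.foldl_zero, dotProduct, Matrix.mulVec_diagonal, Pi.star_apply]
    refine Finset.sum_congr rfl fun a _ => ?_
    simp [pathDiag]
    ring
  | succ p ih =>
    rw [Fin.foldl_succ, ih (fun i => M i.succ) (fun i => d i.succ)]
    have hS := sum_fin_cons_snoc (S := S) (N := 2 * p + 1) fun h =>
      star (ψ (h 0)) * ψ (h (Fin.last _)) * (∏ j, pathDiag d o j (h j)) *
        ∏ j : Fin (2 * p + 1 + 1), pathStep M j (h j.castSucc) (h j.succ)
    refine Eq.trans ?_ hS.symm
    refine Finset.sum_congr rfl fun h _ => ?_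
    have hD (s t : S) : ∏ j : Fin (2 * p + 1 + 1 + 1), pathDiag d o j
        ((Fin.cons s (Fin.snoc h t : Fin (2 * p + 1 + 1) → S) : Fin (2 * p + 1 + 1 + 1) → S) j) =
        star (d 0 s) * (∏ j, pathDiag (fun i => d i.succ) o j (h j)) * d 0 t := by
      rw [Fin.prod_univ_succ, Fin.prod_univ_castSucc, mul_assoc]
      refine congrArg₂ _ (pathDiag_zero d o s)
        (congrArg₂ _ (Finset.prod_congr rfl fun j _ => ?_) ?_)
      · rw [Fin.cons_succ, Fin.snoc_castSucc]
        exact pathDiag_succ_castSucc d o j _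
      · rw [Fin.cons_succ, Fin.snoc_last]
        exact pathDiag_last d o t
    have hM (s t : S) : ∏ j : Fin (2 * p + 1 + 1), pathStep M j
        ((Fin.cons s (Fin.snoc h t : Fin (2 * p + 1 + 1) → S) : Fin (2 * p + 1 + 1 + 1) → S)
          j.castSucc)
        ((Fin.cons s (Fin.snoc h t : Fin (2 * p + 1 + 1) → S) : Fin (2 * p + 1 + 1 + 1) → S)
          j.succ) =
        star (M 0 (h 0) s) * (∏ j : Fin (2 * p),
          pathStep (fun i => M i.succ) j (h j.castSucc) (h j.succ)) * M 0 (h (Fin.last _)) t := by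
      rw [Fin.prod_univ_succ, Fin.prod_univ_castSucc, mul_assoc]
      refine congrArg₂ _ ?_ (congrArg₂ _ (Finset.prod_congr rfl fun j _ => ?_) ?_)
      · rw [Fin.castSucc_zero, Fin.cons_zero, Fin.cons_succ, ← Fin.castSucc_zero,
          Fin.snoc_castSucc]
        exact pathStep_zero M s (h 0)
      · rw [Fin.cons_succ, ← Fin.succ_castSucc, Fin.cons_succ, Fin.snoc_castSucc,
          Fin.succ_castSucc, Fin.snoc_castSucc]
        exact pathStep_succ_castSucc M j _ _
      · rw [Fin.cons_succ, ← Fin.succ_castSucc, Fin.cons_succ, Fin.snoc_castSucc, Fin.succ_last,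
          Fin.snoc_last]
        exact pathStep_last M _ t
    have hl (s t : S) : (Fin.cons s (Fin.snoc h t : Fin (2 * p + 1 + 1) → S) :
        Fin (2 * p + 1 + 1 + 1) → S) (Fin.last _) = t := by
      rw [← Fin.succ_last, Fin.cons_succ, Fin.snoc_last]
    have hψ (y : S) : (M 0 *ᵥ (Matrix.diagonal (d 0) *ᵥ ψ)) y =
        ∑ t, M 0 y t * (d 0 t * ψ t) :=
      Finset.sum_congr rfl fun t _ => by rw [Matrix.mulVec_diagonal]
    refine Eq.trans ?_ (Finset.sum_congr rfl fun s _ => Finset.sum_congr rfl fun t _ =>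
      congrArg₂ (· * ·) (congrArg₂ (· * ·) (congrArg₂ (· * ·) rfl (congrArg ψ (hl s t))) (hD s t))
        (hM s t)).symm
    simp only [Fin.cons_zero, hψ, star_sum, star_mul', Finset.sum_mul, Finset.mul_sum]
    rw [Finset.sum_comm]
    refine Finset.sum_congr rfl fun s _ => Finset.sum_congr rfl fun t _ => ?_
    ring
end Path

/-! ### The path sum of an edge -/

section PathSum

variable {W : Type*} [Fintype W] [DecidableEq W] {c p : ℕ}

theorem gamDot_comm (γ : Fin p → Fin c → ℝ) (C : Fin c) (a b : Config p) :
    gamDot γ C a b = gamDot γ C b a :=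
  Finset.sum_congr rfl fun _ _ => by ring

/-- `Γ_C · (z_u z_v)` for the edge `{u, v}`. -/
def edgeDot {V : Type*} (γ : Fin p → Fin c → ℝ) (C : Fin c) (z : V → Config p) (e : Sym2 V) : ℂ :=
  Sym2.lift ⟨fun u v => gamDot γ C (z u) (z v), fun u v => gamDot_comm γ C (z u) (z v)⟩ e

@[simp] theorem edgeDot_mk {V : Type*} (γ : Fin p → Fin c → ℝ) (C : Fin c) (z : V → Config p)
    (u v : V) : edgeDot γ C z s(u, v) = gamDot γ C (z u) (z v) := rfl

open Classical in
/-- The Feynman path sum of `⟨Z_x Z_y⟩`: every vertex carries a configuration of `2p+1` spins,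
weighted by `f`, and every edge of type `C` couples its two ends through `Γ_C`. -/
def pathSum (H : Fin c → SimpleGraph W) (γ : Fin p → Fin c → ℝ) (β : Fin p → ℝ) (x y : W) : ℂ :=
  ∑ z : W → Config p, mid (z x) * mid (z y) * (∏ w, fWeight β (z w)) *
    Complex.exp (-Complex.I * ∑ C, ∑ e ∈ (H C).edgeFinset, edgeDot γ C z e)

theorem pathStep_mixU (β : Fin p → ℝ) (j : Fin (2 * p)) (a b : W → ℤˣ) :
    pathStep (fun i => mixU W (β i)) j a b =
      ∏ w, NormedSpace.exp ((Complex.I * (betaSeq β j : ℂ)) • sigmaX) (a w) (b w) := by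
  have h (θ : ℝ) : -Complex.I * (θ : ℂ) = Complex.I * ((-θ : ℝ) : ℂ) := by push_cast; ring
  simp only [pathStep, betaSeq, mixU_eq_tensor, tensor]
  split_ifs
  · rw [star_prod]
    refine Finset.prod_congr rfl fun w _ => ?_
    rw [h, exp_sigmaX_apply, exp_sigmaX_apply]
    by_cases hab : a w = b w
    · rw [if_pos hab, if_pos hab.symm]; simp [-Complex.ofReal_cos]
    · rw [if_neg hab, if_neg (Ne.symm hab)]; simp [-Complex.ofReal_sin]
  · simp only [h]

omit [DecidableEq W] in
open Classical in
theorem pathDiag_cost (H : Fin c → SimpleGraph W) (γ : Fin p → Fin c → ℝ) (o : (W → ℤˣ) → ℂ)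
    (j : Fin (2 * p + 1)) (a : W → ℤˣ) :
    pathDiag (fun i z => Complex.exp (Complex.I * (costAngle H (γ i) z : ℂ))) o j a =
      (if j.1 = p then o a else 1) * Complex.exp (-Complex.I *
        ∑ C, (Gam γ C j : ℂ) * ∑ e ∈ (H C).edgeFinset, ((spinProd a e : ℤˣ) : ℂ)) := by
  simp only [pathDiag, Gam]
  split_ifs with h1 h2 h2
  · omega
  · rw [one_mul, Complex.star_def, ← Complex.exp_conj]
    simp [costAngle]
  · simp
  · simp [costAngle]

theorem pauliZ_mul_pauliZ (x y : W) :
    pauliZ x * pauliZ y = Matrix.diagonal fun z => ((z x : ℤˣ) : ℂ) * ((z y : ℤˣ) : ℂ) := by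
  simp [pauliZ, Matrix.diagonal_mul_diagonal]

/-- Since the mixing unitary is a tensor product, the Feynman paths of the whole system are
configurations `W → Config p`, and their amplitudes factor into one weight `f` per vertex and one
phase per edge. -/
theorem expect_maState_eq_pathSum (H : Fin c → SimpleGraph W) (γ : Fin p → Fin c → ℝ)
    (β : Fin p → ℝ) (x y : W) :
    expect (maState H γ β) (pauliZ x * pauliZ y) = pathSum H γ β x y := by
  classical
  simp only [expect, maState, costU_eq_diagonal, pauliZ_mul_pauliZ]
  rw [foldl_path_sum (fun i => mixU W (β i)), pathSum]
  refine Fintype.sum_equiv (Equiv.piComm fun _ _ => ℤˣ) _ _ fun h => ?_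
  simp only [pathStep_mixU, pathDiag_cost, Finset.prod_mul_distrib]
  change _ = mid (fun j => h j x) * mid (fun j => h j y) *
    (∏ w, fWeight β (fun j => h j w)) * Complex.exp (-Complex.I * ∑ C, ∑ e ∈ (H C).edgeFinset,
      edgeDot γ C (fun w j => h j w) e)
  have h1 : star (plusState W (h 0)) * plusState W (h (Fin.last (2 * p))) =
      ∏ _w : W, (1 / 2 : ℂ) := by
    simp only [plusState, star_prod, ← Finset.prod_mul_distrib]
    refine Finset.prod_congr rfl fun w _ => ?_
    rw [Complex.star_def, Complex.conj_ofReal, ← Complex.ofReal_mul]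
    rw [div_mul_div_comm, Real.mul_self_sqrt (by norm_num)]
    norm_num
  have h2 : ∏ j : Fin (2 * p + 1), (if j.1 = p then
      ((h j x : ℤˣ) : ℂ) * ((h j y : ℤˣ) : ℂ) else 1) =
      mid (fun j => h j x) * mid (fun j => h j y) := by
    rw [Finset.prod_eq_single (⟨p, by omega⟩ : Fin (2 * p + 1))]
    · simp [mid]
    · intro j _ hj
      exact if_neg fun hp => hj (Fin.ext hp)
    · simp
  have h3 : ∏ j : Fin (2 * p + 1), Complex.exp (-Complex.I *
        ∑ C, (Gam γ C j : ℂ) * ∑ e ∈ (H C).edgeFinset, ((spinProd (h j) e : ℤˣ) : ℂ)) =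
      Complex.exp (-Complex.I * ∑ C, ∑ e ∈ (H C).edgeFinset,
        edgeDot γ C (fun w j => h j w) e) := by
    rw [← Complex.exp_sum, ← Finset.mul_sum, Finset.sum_comm]
    congr 2
    refine Finset.sum_congr rfl fun C _ => ?_
    simp only [Finset.mul_sum]
    rw [Finset.sum_comm]
    refine Finset.sum_congr rfl fun e _ => ?_
    induction e with
    | _ u v => simp [gamDot, mul_assoc]
  have h4 : ∏ w, fWeight β (fun j => h j w) = (∏ _w : W, (1 / 2 : ℂ)) *
      ∏ j : Fin (2 * p), ∏ w, NormedSpace.exp ((Complex.I * (betaSeq β j : ℂ)) • sigmaX)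
        (h j.castSucc w) (h j.succ w) := by
    rw [Finset.prod_comm, ← Finset.prod_mul_distrib]
    rfl
  rw [h1, h2, h3, h4]
  ring

end PathSum

/-! ### Unitarity -/

section Unitary

variable {W : Type*} [Fintype W] [DecidableEq W] {ι : Type*} [Fintype ι] {p : ℕ}

theorem pauliX_conjTranspose (v : W) : (pauliX v)ᴴ = pauliX v := by
  ext z z'
  simp only [pauliX, Matrix.conjTranspose_apply]
  have : z = Function.update z' v (-(z' v)) ↔ z' = Function.update z v (-(z v)) := by
    constructor <;> (intro h; rw [h]; simp)
  simp [this]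

/-- `exp (-iθ ∑_{v ∈ s} X_v)` is unitary. -/
theorem exp_sum_pauliX_unitary (θ : ℝ) (s : Finset W) :
    (NormedSpace.exp ((-Complex.I * (θ : ℂ)) • ∑ v ∈ s, pauliX v))ᴴ *
      NormedSpace.exp ((-Complex.I * (θ : ℂ)) • ∑ v ∈ s, pauliX v) = 1 := by
  rw [← Matrix.exp_conjTranspose, ← Matrix.exp_add_of_commute]
  · rw [Matrix.conjTranspose_smul, Matrix.conjTranspose_sum]
    simp [pauliX_conjTranspose]
  · rw [Matrix.conjTranspose_smul, Matrix.conjTranspose_sum]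
    simp only [pauliX_conjTranspose]
    exact ((Commute.refl _).smul_left _).smul_right _

theorem costU_unitary (H : ι → SimpleGraph W) (γ : ι → ℝ) : (costU H γ)ᴴ * costU H γ = 1 := by
  rw [costU_eq_diagonal, Matrix.diagonal_conjTranspose, Matrix.diagonal_mul_diagonal,
    ← Matrix.diagonal_one]
  congr 1
  funext z
  rw [Pi.star_apply, Complex.star_def, ← Complex.exp_conj, ← Complex.exp_add]
  simp

/-- The passage to the Heisenberg picture. -/
theorem expect_mulVec (M O : Matrix (W → ℤˣ) (W → ℤˣ) ℂ) (ψ : (W → ℤˣ) → ℂ) :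
    expect (M *ᵥ ψ) O = expect ψ (Mᴴ * O * M) := by
  simp only [expect, Matrix.star_mulVec, ← Matrix.mulVec_mulVec, ← Matrix.dotProduct_mulVec]

theorem expect_plusState_one : expect (plusState W) 1 = 1 := by
  simp only [expect, Matrix.one_mulVec, dotProduct, Pi.star_apply, plusState, star_prod,
    ← Finset.prod_mul_distrib]
  have h : star (((1 / Real.sqrt 2 : ℝ) : ℂ)) * ((1 / Real.sqrt 2 : ℝ) : ℂ) = 1 / 2 := by
    rw [Complex.star_def, Complex.conj_ofReal, ← Complex.ofReal_mul, div_mul_div_comm,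
      Real.mul_self_sqrt (by norm_num)]
    norm_num
  simp only [h, Finset.prod_const, Finset.sum_const, Finset.card_univ, Fintype.card_fun]
  simp

/-- The ma-QAOA state has norm one. -/
theorem expect_maState_one (H : ι → SimpleGraph W) (γ : Fin p → ι → ℝ) (β : Fin p → ℝ) :
    expect (maState H γ β) 1 = 1 := by
  induction p with
  | zero => exact expect_plusState_one
  | succ p ih =>
    have h := ih (fun i => γ i.castSucc) (fun i => β i.castSucc)
    rw [maState, Fin.foldl_succ_last, expect_mulVec, expect_mulVec, mul_one]
    have hm : (mixU W (β (Fin.last p)))ᴴ * mixU W (β (Fin.last p)) = 1 :=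
      exp_sum_pauliX_unitary _ _
    rw [hm, mul_one, costU_unitary]
    exact h

end Unitary

/-! ### The light cone -/

section LightCone

variable {W : Type*} [Fintype W] [DecidableEq W] {ι : Type*} [Fintype ι] {p : ℕ}

/-- The operator `O` acts only on the qubits of `T`: it commutes with the Pauli operators of all
the other qubits. -/
structure SupportedOn (T : Set W) (O : Matrix (W → ℤˣ) (W → ℤˣ) ℂ) : Prop where
  commute_pauliX : ∀ w ∉ T, Commute (pauliX w) O
  commute_pauliZ : ∀ w ∉ T, Commute (pauliZ w) O

/-- Flip the spin at `w`. -/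
def flip (w : W) (z : W → ℤˣ) : W → ℤˣ := Function.update z w (-(z w))

omit [Fintype W] in
@[simp] theorem flip_flip (w : W) (z : W → ℤˣ) : flip w (flip w z) = z := by
  simp [flip]

theorem pauliX_mul_apply (w : W) (O : Matrix (W → ℤˣ) (W → ℤˣ) ℂ) (z z' : W → ℤˣ) :
    (pauliX w * O) z z' = O (flip w z) z' := by
  simp [Matrix.mul_apply, pauliX, flip]

theorem mul_pauliX_apply (w : W) (O : Matrix (W → ℤˣ) (W → ℤˣ) ℂ) (z z' : W → ℤˣ) :
    (O * pauliX w) z z' = O z (flip w z') := by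
  have h (y : W → ℤˣ) : z' = Function.update y w (-(y w)) ↔ y = flip w z' := by
    constructor
    · rintro rfl; exact (flip_flip w y).symm
    · rintro rfl; exact (flip_flip w z').symm
  simp [Matrix.mul_apply, pauliX, h]

theorem commute_pauliX_iff (w : W) (O : Matrix (W → ℤˣ) (W → ℤˣ) ℂ) :
    Commute (pauliX w) O ↔ ∀ z z', O (flip w z) (flip w z') = O z z' := by
  constructor
  · intro h z z'
    have := congrFun (congrFun h.eq z) (flip w z')
    rw [pauliX_mul_apply, mul_pauliX_apply, flip_flip] at this
    exact this
  · intro h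
    ext z z'
    rw [pauliX_mul_apply, mul_pauliX_apply, ← h z, flip_flip]

theorem commute_pauliZ_iff (w : W) (O : Matrix (W → ℤˣ) (W → ℤˣ) ℂ) :
    Commute (pauliZ w) O ↔ ∀ z z', O z z' ≠ 0 → z w = z' w := by
  have key (z z' : W → ℤˣ) : (pauliZ w * O) z z' = (O * pauliZ w) z z' ↔
      (O z z' ≠ 0 → z w = z' w) := by
    rw [pauliZ, Matrix.diagonal_mul, Matrix.mul_diagonal, mul_comm, mul_eq_mul_left_iff]
    have : (((z w : ℤˣ) : ℤ) : ℂ) = (((z' w : ℤˣ) : ℤ) : ℂ) ↔ z w = z' w := by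
      rw [Int.cast_inj, Units.val_inj]
    rw [this]
    tauto
  constructor
  · intro h z z'
    exact (key z z').1 (congrFun (congrFun h.eq z) z')
  · intro h
    ext z z'
    exact (key z z').2 (h z z')

theorem pauliZ_commute_pauliX {w v : W} (h : w ≠ v) : Commute (pauliZ w) (pauliX v) := by
  rw [commute_pauliZ_iff]
  intro z z' hz
  have : z' = Function.update z v (-(z v)) := by
    by_contra hn
    exact hz (if_neg hn)
  rw [this, Function.update_of_ne h]

theorem pauliZ_commute (w v : W) : Commute (pauliZ w) (pauliZ v) := pauliZ_mul_comm w v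

omit [DecidableEq W] in
theorem pauliZ_conjTranspose (v : W) : (pauliZ v)ᴴ = pauliZ v := by
  rw [pauliZ, Matrix.diagonal_conjTranspose]
  congr 1
  funext z
  simp

theorem SupportedOn.pauliZ_mul_pauliZ {T : Set W} {x y : W} (hx : x ∈ T) (hy : y ∈ T) :
    SupportedOn T (pauliZ x * pauliZ y) where
  commute_pauliX _ hw :=
    ((pauliZ_commute_pauliX (ne_of_mem_of_not_mem hx hw)).symm).mul_right
      ((pauliZ_commute_pauliX (ne_of_mem_of_not_mem hy hw)).symm)
  commute_pauliZ w _ := (pauliZ_commute w x).mul_right (pauliZ_commute w y)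

/-- Conjugation with the mixing unitary does not enlarge the support of an operator. -/
theorem SupportedOn.mixU_conj {T : Set W} {O : Matrix (W → ℤˣ) (W → ℤˣ) ℂ}
    (hO : SupportedOn T O) (β : ℝ) : SupportedOn T ((mixU W β)ᴴ * O * mixU W β) where
  commute_pauliX w hw := by
    have h : Commute (pauliX w) (mixU W β) :=
      ((Commute.sum_right _ _ _ fun v _ => pauliX_commute w v).smul_right _).exp_right
    have h' : Commute (pauliX w) (mixU W β)ᴴ := by
      have := congrArg Matrix.conjTranspose h.eq
      rw [Matrix.conjTranspose_mul, Matrix.conjTranspose_mul, pauliX_conjTranspose] at this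
      exact this.symm
    exact (h'.mul_right (hO.commute_pauliX w hw)).mul_right h
  commute_pauliZ w hw := by
    -- the factor of the qubit `w` cancels, since `O` commutes with it
    set E := NormedSpace.exp ((-Complex.I * (β : ℂ)) • ∑ v ∈ {w}, pauliX v) with hE
    set R := NormedSpace.exp ((-Complex.I * (β : ℂ)) • ∑ v ∈ Finset.univ.erase w, pauliX v) with hR
    have hU : mixU W β = E * R := by
      rw [mixU, mixOp, ← Finset.add_sum_erase _ _ (Finset.mem_univ w), smul_add,
        Matrix.exp_add_of_commute, hE, Finset.sum_singleton]
      exact ((Commute.sum_right _ _ _ fun v _ => pauliX_commute w v).smul_right _).smul_left _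
    have hEO : E * O = O * E := by
      rw [hE, Finset.sum_singleton]
      exact (((hO.commute_pauliX w hw).symm.smul_right (-Complex.I * (β : ℂ))).exp_right).eq.symm
    have hEE : Eᴴ * E = 1 := exp_sum_pauliX_unitary β {w}
    have h : (mixU W β)ᴴ * O * mixU W β = Rᴴ * O * R := by
      rw [hU, Matrix.conjTranspose_mul]
      calc Rᴴ * Eᴴ * O * (E * R) = Rᴴ * Eᴴ * (O * E) * R := by simp only [mul_assoc]
        _ = Rᴴ * (Eᴴ * E) * O * R := by rw [← hEO]; simp only [mul_assoc]
        _ = Rᴴ * O * R := by rw [hEE, mul_one]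
    have hZR : Commute (pauliZ w) R :=
      ((Commute.sum_right _ _ _ fun v hv =>
        pauliZ_commute_pauliX (Finset.ne_of_mem_erase hv).symm).smul_right _).exp_right
    have hZR' : Commute (pauliZ w) Rᴴ := by
      have := congrArg Matrix.conjTranspose hZR.eq
      rw [Matrix.conjTranspose_mul, Matrix.conjTranspose_mul, pauliZ_conjTranspose] at this
      exact this.symm
    rw [h]
    exact (hZR'.mul_right (hO.commute_pauliZ w hw)).mul_right hZR

omit [Fintype W] [DecidableEq W] in
theorem spinProd_congr {z z' : W → ℤˣ} {e : Sym2 W} (h : ∀ w ∈ e, z w = z' w) :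
    spinProd z e = spinProd z' e := by
  induction e with
  | _ u v => simp [h u (by simp), h v (by simp)]

omit [DecidableEq W] in
open Classical in
theorem costAngle_sub (H : ι → SimpleGraph W) (γ : ι → ℝ) (z z' : W → ℤˣ) :
    costAngle H γ z' - costAngle H γ z = ∑ j, γ j *
      ∑ e ∈ (H j).edgeFinset, (((spinProd z' e : ℤˣ) : ℝ) - ((spinProd z e : ℤˣ) : ℝ)) := by
  simp only [costAngle, ← Finset.sum_sub_distrib, ← mul_sub]

/-- Conjugation with the cost unitary only multiplies the matrix entries by phases. -/
theorem costU_conj_apply (H : ι → SimpleGraph W) (γ : ι → ℝ)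
    (O : Matrix (W → ℤˣ) (W → ℤˣ) ℂ) (z z' : W → ℤˣ) :
    ((costU H γ)ᴴ * O * costU H γ) z z' =
      O z z' * Complex.exp (Complex.I * ((costAngle H γ z' - costAngle H γ z : ℝ) : ℂ)) := by
  rw [costU_eq_diagonal, Matrix.diagonal_conjTranspose, Matrix.mul_diagonal, Matrix.diagonal_mul,
    Pi.star_apply, Complex.star_def, ← Complex.exp_conj, mul_comm _ (O z z'), mul_assoc,
    ← Complex.exp_add]
  congr 2
  simp
  ring

theorem SupportedOn.eq_of_apply_ne_zero {T : Set W} {O : Matrix (W → ℤˣ) (W → ℤˣ) ℂ}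
    (hO : SupportedOn T O) {z z' : W → ℤˣ} (h : O z z' ≠ 0) {w : W} (hw : w ∉ T) : z w = z' w :=
  (commute_pauliZ_iff w O).1 (hO.commute_pauliZ w hw) z z' h

/-- Conjugation with the cost unitary depends only on the edges that touch the support. -/
theorem SupportedOn.costU_conj_eq {T : Set W} {O : Matrix (W → ℤˣ) (W → ℤˣ) ℂ}
    (hO : SupportedOn T O) (H H' : ι → SimpleGraph W) (γ : ι → ℝ)
    (h : ∀ j u v, u ∈ T → ((H j).Adj u v ↔ (H' j).Adj u v)) :
    (costU H γ)ᴴ * O * costU H γ = (costU H' γ)ᴴ * O * costU H' γ := by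
  classical
  ext z z'
  rw [costU_conj_apply, costU_conj_apply]
  by_cases h0 : O z z' = 0
  · simp [h0]
  have hzero (e : Sym2 W) (he : ∀ w ∈ e, w ∉ T) :
      ((spinProd z' e : ℤˣ) : ℝ) - ((spinProd z e : ℤˣ) : ℝ) = 0 := by
    rw [spinProd_congr fun w hw => hO.eq_of_apply_ne_zero h0 (he w hw), sub_self]
  have hmem (j : ι) (e : Sym2 W) (w : W) (hw : w ∈ e) (hT : w ∈ T) :
      e ∈ (H j).edgeFinset ↔ e ∈ (H' j).edgeFinset := by
    obtain ⟨v, rfl⟩ := hw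
    simpa using h j w v hT
  rw [costAngle_sub, costAngle_sub]
  refine congrArg (fun t : ℝ => O z z' * Complex.exp (Complex.I * (t : ℂ))) ?_
  refine Finset.sum_congr rfl fun j _ => ?_
  congr 1
  refine Finset.sum_congr_of_eq_on_inter ?_ ?_ fun _ _ _ => rfl
  · intro e he he'
    exact hzero e fun w hw hT => he' ((hmem j e w hw hT).1 he)
  · intro e he he'
    exact hzero e fun w hw hT => he' ((hmem j e w hw hT).2 he)

/-- Conjugation with the cost unitary enlarges the support at most by the neighbours. -/
theorem SupportedOn.costU_conj {T T' : Set W} {O : Matrix (W → ℤˣ) (W → ℤˣ) ℂ}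
    (hO : SupportedOn T O) (H : ι → SimpleGraph W) (γ : ι → ℝ) (hT : T ⊆ T')
    (h : ∀ j u v, u ∈ T → (H j).Adj u v → v ∈ T') :
    SupportedOn T' ((costU H γ)ᴴ * O * costU H γ) where
  commute_pauliZ w hw := by
    rw [commute_pauliZ_iff]
    intro z z' hz
    rw [costU_conj_apply] at hz
    exact hO.eq_of_apply_ne_zero (left_ne_zero_of_mul hz) fun h => hw (hT h)
  commute_pauliX w hw := by
    classical
    rw [commute_pauliX_iff]
    intro z z'
    rw [costU_conj_apply, costU_conj_apply,
      (commute_pauliX_iff w O).1 (hO.commute_pauliX w fun h => hw (hT h))]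
    by_cases h0 : O z z' = 0
    · simp [h0]
    rw [costAngle_sub, costAngle_sub]
    refine congrArg (fun t : ℝ => O z z' * Complex.exp (Complex.I * (t : ℂ))) ?_
    refine Finset.sum_congr rfl fun j _ => ?_
    congr 1
    refine Finset.sum_congr rfl fun e he => ?_
    by_cases hwe : w ∈ e
    · -- both ends of the edge lie outside `T`, where `z` and `z'` agree
      have hout : ∀ v ∈ e, z v = z' v := by
        obtain ⟨u, rfl⟩ := hwe
        intro v hv
        refine hO.eq_of_apply_ne_zero h0 fun hvT => ?_
        rcases Sym2.mem_iff.1 hv with rfl | rfl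
        · exact hw (hT hvT)
        · exact hw (h j v w hvT (by simpa using (SimpleGraph.mem_edgeFinset.1 he).symm))
      have hflip : ∀ v ∈ e, flip w z v = flip w z' v := by
        intro v hv
        by_cases hvw : v = w
        · subst hvw; simp [flip, hout v hv]
        · simp [flip, hvw, hout v hv]
      rw [spinProd_congr hout, spinProd_congr hflip, sub_self, sub_self]
    · have hflip (y : W → ℤˣ) : spinProd (flip w y) e = spinProd y e :=
        spinProd_congr fun v hv => by
          rw [flip, Function.update_of_ne (ne_of_mem_of_not_mem hv hwe)]
      rw [hflip, hflip]

/-- Light cone: the expectation of an operator supported on `T 0` after `p` layers depends only on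
the edges that touch the sets `T 0, …, T (p - 1)`, where `T (j + 1)` contains the neighbours of
`T j`. -/
theorem expect_maState_congr (H H' : ι → SimpleGraph W) (γ : Fin p → ι → ℝ) (β : Fin p → ℝ)
    (T : ℕ → Set W) (hT : ∀ j, T j ⊆ T (j + 1))
    (hN : ∀ i < p, ∀ j u v, u ∈ T i → (H j).Adj u v → v ∈ T (i + 1))
    (hH : ∀ i < p, ∀ j u v, u ∈ T i → ((H j).Adj u v ↔ (H' j).Adj u v))
    (O : Matrix (W → ℤˣ) (W → ℤˣ) ℂ) (hO : SupportedOn (T 0) O) :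
    expect (maState H γ β) O = expect (maState H' γ β) O := by
  induction p generalizing T O with
  | zero => simp only [maState, Fin.foldl_zero]
  | succ p ih =>
    have hB := hO.mixU_conj (β (Fin.last p))
    have hC := hB.costU_conj_eq H H' (γ (Fin.last p)) fun j u v => hH 0 (by omega) j u v
    have := ih (fun i => γ i.castSucc) (fun i => β i.castSucc) (fun j => T (j + 1))
      (fun j => hT (j + 1)) (fun i hi => hN (i + 1) (by omega)) (fun i hi => hH (i + 1) (by omega))
      _ (hB.costU_conj H (γ (Fin.last p)) (hT 0) (hN 0 (by omega)))
    rw [maState, maState, Fin.foldl_succ_last, Fin.foldl_succ_last, expect_mulVec, expect_mulVec,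
      expect_mulVec, expect_mulVec, ← hC]
    exact this

end LightCone

/-! ### Transport of expectations between graphs -/

section Reindex

variable {V W : Type*} [Fintype V] [DecidableEq V] [Fintype W] [DecidableEq W] {c p : ℕ}

theorem mid_mul_self (a : Config p) : mid a * mid a = 1 := by
  rcases Int.units_eq_one_or (a ⟨p, by omega⟩) with h | h <;> simp [mid, h]

/-- The weights `f` sum up to one: this is the path sum of a single isolated qubit. -/
theorem sum_fWeight (β : Fin p → ℝ) : ∑ a : Config p, fWeight β a = 1 := by
  have h := expect_maState_eq_pathSum (W := Unit) (fun _ : Fin 0 => ⊥) (fun _ => Fin.elim0) β () ()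
  have hZ : pauliZ (W := Unit) () * pauliZ () = 1 := by
    rw [pauliZ_mul_pauliZ, ← Matrix.diagonal_one]
    congr 1
    funext z
    rcases Int.units_eq_one_or (z ()) with h | h <;> simp [h]
  rw [hZ, expect_maState_one] at h
  rw [h, pathSum, ← (Equiv.funUnique Unit (Config p)).symm.sum_comp]
  simp [mid_mul_self]

omit [Fintype V] [DecidableEq V] [Fintype W] [DecidableEq W] in
theorem sum_edgeFinset_map (G : SimpleGraph V) (π : V ↪ W) [Fintype G.edgeSet]
    [Fintype (G.map π).edgeSet] (g : Sym2 W → ℂ) :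
    ∑ e ∈ (G.map π).edgeFinset, g e = ∑ e ∈ G.edgeFinset, g (e.map π) := by
  classical
  rw [← Finset.sum_image (s := G.edgeFinset) (g := Sym2.map π) (f := g)
    (Sym2.map.injective π.injective).injOn]
  refine Finset.sum_congr ?_ fun _ _ => rfl
  ext e
  simp [SimpleGraph.edgeSet_map]

/-- Isolated qubits do not contribute to the path sum. -/
theorem pathSum_map (H : Fin c → SimpleGraph V) (π : V ↪ W) (γ : Fin p → Fin c → ℝ)
    (β : Fin p → ℝ) (x y : V) :
    pathSum (fun C => (H C).map π) γ β (π x) (π y) = pathSum H γ β x y := by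
  classical
  let e : V ⊕ {w // w ∉ Set.range π} ≃ W :=
    (Equiv.sumCongr (Equiv.ofInjective π π.injective) (Equiv.refl _)).trans
      (Equiv.sumCompl fun w => w ∈ Set.range π)
  let E : (V → Config p) × ({w // w ∉ Set.range π} → Config p) ≃ (W → Config p) :=
    (Equiv.sumArrowEquivProdArrow V _ (Config p)).symm.trans (e.arrowCongr (Equiv.refl _))
  have hE (z : V → Config p) (r : {w // w ∉ Set.range π} → Config p)
      (s : V ⊕ {w // w ∉ Set.range π}) : E (z, r) (e s) = Sum.elim z r s := by
    rcases s with s | s <;> simp [E, Equiv.arrowCongr, Equiv.sumArrowEquivProdArrow]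
  have hEπ (z : V → Config p) (r : {w // w ∉ Set.range π} → Config p) (v : V) :
      E (z, r) (π v) = z v := hE z r (Sum.inl v)
  rw [pathSum, ← E.sum_comp, Fintype.sum_prod_type, pathSum]
  refine Finset.sum_congr rfl fun z _ => ?_
  have hedge (r : {w // w ∉ Set.range π} → Config p) (C : Fin c)
      [Fintype ((H C).map π).edgeSet] [Fintype (H C).edgeSet] :
      ∑ e ∈ ((H C).map π).edgeFinset, edgeDot γ C (E (z, r)) e =
        ∑ e ∈ (H C).edgeFinset, edgeDot γ C z e := by
    rw [sum_edgeFinset_map]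
    refine Finset.sum_congr rfl fun e _ => ?_
    induction e with
    | _ u v => simp [hEπ]
  have hf (r : {w // w ∉ Set.range π} → Config p) : ∏ w, fWeight β (E (z, r) w) =
      (∏ v, fWeight β (z v)) * ∏ w, fWeight β (r w) := by
    rw [← e.prod_comp, Fintype.prod_sum_type]
    simp [hE]
  simp only [hEπ, hedge, hf]
  have hr : ∑ r : {w // w ∉ Set.range π} → Config p, ∏ w, fWeight β (r w) = 1 := by
    rw [← Fintype.prod_sum]
    simp [sum_fWeight]
  rw [← Finset.sum_mul, ← Finset.mul_sum, ← Finset.mul_sum, hr, mul_one]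

/-- The expectation `⟨Z_x Z_y⟩` of the ma-QAOA with `p` layers depends only on the
`p`-neighbourhood of `{x, y}`: it is the same on two graphs that are matched by an injective map
near `x` and `y`. The sets `T j` play the part of the `j`-neighbourhoods. -/
theorem expect_eq_of_local_iso (HV : Fin c → SimpleGraph V) (HW : Fin c → SimpleGraph W)
    (γ : Fin p → Fin c → ℝ) (β : Fin p → ℝ) (π : V → W) (hπ : Function.Injective π)
    (T : ℕ → Set V) (hT : ∀ j, T j ⊆ T (j + 1))
    (hN : ∀ i < p, ∀ C u v, u ∈ T i → (HV C).Adj u v → v ∈ T (i + 1))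
    (h₁ : ∀ i < p, ∀ C u v, u ∈ T i → (HV C).Adj u v → (HW C).Adj (π u) (π v))
    (h₂ : ∀ i < p, ∀ C u w, u ∈ T i → (HW C).Adj (π u) w → ∃ v, (HV C).Adj u v ∧ π v = w)
    {x y : V} (hx : x ∈ T 0) (hy : y ∈ T 0) :
    expect (maState HW γ β) (pauliZ (π x) * pauliZ (π y)) =
      expect (maState HV γ β) (pauliZ x * pauliZ y) := by
  rw [expect_maState_eq_pathSum HV, ← pathSum_map HV ⟨π, hπ⟩, ← expect_maState_eq_pathSum]
  symm
  refine expect_maState_congr _ _ γ β (fun j => π '' T j) (fun j => Set.image_mono (hT j)) ?_ ?_ _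
    (SupportedOn.pauliZ_mul_pauliZ (Set.mem_image_of_mem π hx) (Set.mem_image_of_mem π hy))
  · rintro i hi C _ w ⟨u, hu, rfl⟩ ⟨-, u', v, huv, hu', rfl⟩
    obtain rfl := hπ hu'
    exact ⟨v, hN i hi C _ v hu huv, rfl⟩
  · rintro i hi C _ w ⟨u, hu, rfl⟩
    constructor
    · rintro ⟨-, u', v, huv, hu', rfl⟩
      obtain rfl := hπ hu'
      exact h₁ i hi C _ v hu huv
    · intro h
      obtain ⟨v, huv, rfl⟩ := h₂ i hi C u w hu h
      exact (SimpleGraph.map_adj _ _ _ _).2 ⟨u, v, huv, rfl, rfl⟩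

end Reindex

/-! ### Equal angles for all edge types -/

section EqualAngles

variable {W : Type*} [Fintype W] {c p : ℕ}

open Classical in
theorem sum_edgeFinset_iSup {M : Type*} [AddCommMonoid M] (H : Fin c → SimpleGraph W)
    (hH : ∀ C C' u v, (H C).Adj u v → (H C').Adj u v → C = C') (g : Sym2 W → M) :
    ∑ e ∈ (⨆ C, H C).edgeFinset, g e = ∑ C, ∑ e ∈ (H C).edgeFinset, g e := by
  rw [← Finset.sum_biUnion]
  · refine Finset.sum_congr ?_ fun _ _ => rfl
    ext e
    induction e with
    | _ u v => simp
  · intro C _ C' _ hne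
    rw [Function.onFun, Finset.disjoint_left]
    intro e
    induction e with
    | _ u v =>
      intro h h'
      exact hne (hH C C' u v (by simpa using h) (by simpa using h'))

/-- With equal angles for all the edge types, the ma-QAOA is the standard QAOA. -/
theorem maState_eq_qaoaState [DecidableEq W] (H : Fin c → SimpleGraph W) (G : SimpleGraph W)
    (hG : G = ⨆ C, H C)
    (hH : ∀ C C' u v, (H C).Adj u v → (H C').Adj u v → C = C')
    (γ : Fin p → Fin c → ℝ) (γ' : Fin p → ℝ) (hγ : ∀ i C, γ i C = γ' i) (β : Fin p → ℝ) :
    maState H γ β = qaoaState G γ' β := by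
  classical
  subst hG
  have h (i : Fin p) : costU H (γ i) = costU (fun _ : Unit => ⨆ C, H C) (fun _ => γ' i) := by
    simp only [costU_eq_diagonal, costAngle, sum_edgeFinset_iSup H hH, hγ, Finset.univ_unique,
      Finset.sum_singleton, Finset.mul_sum]
  simp only [qaoaState, maState, h]

end EqualAngles

/-! ### Copies of the atoms -/

section Copies

variable {n c : ℕ} {A : Fin c → SimpleGraph (Fin n)} {v₁ : Fin n}

/-- The string of pairs `(C_i, v_{i+1})` of a vertex. -/
def str (x : PVertex A v₁) : List (Fin c × Fin n) := x.1

/-- The vertex given by an admissible string. -/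
def ofStr (l : List (Fin c × Fin n)) (h : Admissible A v₁ l) : PVertex A v₁ := ⟨l, h⟩

theorem admissible_str (x : PVertex A v₁) : Admissible A v₁ (str x) := x.2

@[simp] theorem str_ofStr (l : List (Fin c × Fin n)) (h : Admissible A v₁ l) :
    str (ofStr l h) = l := rfl

theorem str_injective {x y : PVertex A v₁} (h : str x = str y) : x = y := Subtype.ext h

theorem label_eq (x : PVertex A v₁) : label A v₁ x = lastVertex v₁ (str x) := rfl

variable (A v₁) in
/-- The vertex `v₁` of the additive product graph. -/
def root : PVertex A v₁ := ofStr [] trivial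

theorem str_induction {P : PVertex A v₁ → Prop} (h0 : P (root A v₁))
    (hs : ∀ (s : PVertex A v₁) (C : Fin c) (u : Fin n) (h : Admissible A v₁ ((C, u) :: str s)),
      P s → P (ofStr ((C, u) :: str s) h)) (x : PVertex A v₁) : P x := by
  have key : ∀ (l : List (Fin c × Fin n)) (hl : Admissible A v₁ l), P (ofStr l hl) := by
    intro l
    induction l with
    | nil => exact fun _ => h0
    | cons q l ih => exact fun hl => hs (ofStr l hl.1) q.1 q.2 hl (ih hl.1)
  exact key (str x) (admissible_str x)

/-- Remove the last step of a string if it has type `C`. -/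
def baseList (C : Fin c) : List (Fin c × Fin n) → List (Fin c × Fin n)
  | [] => []
  | q :: s => if q.1 = C then s else q :: s

theorem admissible_baseList (C : Fin c) {s : List (Fin c × Fin n)} (hs : Admissible A v₁ s) :
    Admissible A v₁ (baseList C s) := by
  cases s with
  | nil => exact hs
  | cons q s =>
    simp only [baseList]
    split_ifs
    · exact hs.1
    · exact hs

/-- The vertex at which the copy of the atom `C` through `x` is attached. -/
def base (C : Fin c) (x : PVertex A v₁) : PVertex A v₁ :=
  ofStr (baseList C (str x)) (admissible_baseList C (admissible_str x))

theorem head_baseList_ne (C : Fin c) {s : List (Fin c × Fin n)} (hs : Admissible A v₁ s) :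
    ∀ q ∈ (baseList C s).head?, q.1 ≠ C := by
  cases s with
  | nil => simp [baseList]
  | cons q s =>
    simp only [baseList]
    split_ifs with h
    · subst h; exact hs.2.1
    · simpa using h

@[simp] theorem str_base (C : Fin c) (x : PVertex A v₁) : str (base C x) = baseList C (str x) := rfl

theorem eq_base_or_eq_cons (C : Fin c) (x : PVertex A v₁) :
    x = base C x ∨ str x = (C, label A v₁ x) :: str (base C x) := by
  refine str_induction (P := fun x => x = base C x ∨ str x = (C, label A v₁ x) :: str (base C x))
    (Or.inl rfl) (fun s C' u h _ => ?_) x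
  by_cases hC : C' = C
  · right
    subst hC
    simp [baseList, label_eq, lastVertex]
  · left
    apply str_injective
    simp [baseList, hC]

theorem baseList_of_head_ne {C : Fin c} {s : List (Fin c × Fin n)} (h : ∀ q ∈ s.head?, q.1 ≠ C) :
    baseList C s = s := by
  cases s with
  | nil => rfl
  | cons q s => simp [baseList, h q (by simp)]

theorem base_base (C : Fin c) (x : PVertex A v₁) : base C (base C x) = base C x :=
  str_injective (baseList_of_head_ne (head_baseList_ne C (admissible_str x)))

/-- The vertices of a copy of an atom have different labels. -/
theorem eq_of_base_eq_of_label_eq {C : Fin c} {x y : PVertex A v₁} (h : base C x = base C y)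
    (hl : label A v₁ x = label A v₁ y) : x = y := by
  have key : ∀ x y : PVertex A v₁, base C x = base C y → label A v₁ x = label A v₁ y →
      x = base C x → str y = (C, label A v₁ y) :: str (base C y) → False := by
    intro x y h hl hx hy
    have h2 := (admissible_str y)
    rw [hy] at h2
    refine h2.2.2.2.2 ?_
    rw [← h, ← hx]
    exact hl
  rcases eq_base_or_eq_cons C x with hx | hx <;> rcases eq_base_or_eq_cons C y with hy | hy
  · rw [hx, hy, h]
  · exact (key x y h hl hx hy).elim
  · exact (key y x h.symm hl.symm hy hx).elim
  · exact str_injective (by rw [hx, hy, h, hl])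

theorem label_base_mem_support {C : Fin c} {x : PVertex A v₁}
    (h : label A v₁ x ∈ (A C).support) : label A v₁ (base C x) ∈ (A C).support := by
  rcases eq_base_or_eq_cons C x with hx | hx
  · rwa [← hx]
  · have h2 := (admissible_str x)
    rw [hx] at h2
    exact h2.2.2.1

open Classical in
/-- The vertex with label `u` in the copy of the atom `C` through `x`. (The value is irrelevant
unless the atom contains `u` and the label of `x`.) -/
def step (x : PVertex A v₁) (C : Fin c) (u : Fin n) : PVertex A v₁ :=
  if h : Admissible A v₁ ((C, u) :: baseList C (str x)) then ofStr _ h else base C x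

theorem base_step (x : PVertex A v₁) (C : Fin c) (u : Fin n) :
    base C (step x C u) = base C x := by
  unfold step
  split_ifs with h
  · exact str_injective (by simp [baseList])
  · exact base_base C x

theorem label_step {x : PVertex A v₁} {C : Fin c} {u : Fin n} (hx : label A v₁ x ∈ (A C).support)
    (hu : u ∈ (A C).support) : label A v₁ (step x C u) = u := by
  unfold step
  split_ifs with h
  · rfl
  · by_contra hne
    refine h ⟨(base C x).2, head_baseList_ne C (admissible_str x), label_base_mem_support hx,
      hu, hne⟩

theorem step_label {x : PVertex A v₁} {C : Fin c} (hx : label A v₁ x ∈ (A C).support) :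
    step x C (label A v₁ x) = x :=
  eq_of_base_eq_of_label_eq (base_step x C _) (label_step hx hx)

theorem step_of_base_eq {x y : PVertex A v₁} {C : Fin c} (hx : label A v₁ x ∈ (A C).support)
    (hy : label A v₁ y ∈ (A C).support) (h : base C x = base C y) :
    step x C (label A v₁ y) = y :=
  eq_of_base_eq_of_label_eq ((base_step x C _).trans h) (label_step hx hy)

theorem step_step {x : PVertex A v₁} {C : Fin c} {u w : Fin n}
    (hx : label A v₁ x ∈ (A C).support) (hu : u ∈ (A C).support) (hw : w ∈ (A C).support) :
    step (step x C u) C w = step x C w := by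
  have hl := label_step hx hu
  refine eq_of_base_eq_of_label_eq (C := C) ?_ ?_
  · rw [base_step, base_step, base_step]
  · rw [label_step (by rwa [hl]) hw, label_step hx hw]

theorem step_of_cons {s : PVertex A v₁} {C : Fin c} {u : Fin n}
    (h : Admissible A v₁ ((C, u) :: str s)) : step s C u = ofStr ((C, u) :: str s) h := by
  have hb : baseList C (str s) = str s := baseList_of_head_ne h.2.1
  have h' : Admissible A v₁ ((C, u) :: baseList C (str s)) := by rwa [hb]
  unfold step
  rw [dif_pos h']
  exact str_injective (by simp [hb])

theorem typeGraph_adj_def {C : Fin c} {x y : PVertex A v₁} : (typeGraph A v₁ C).Adj x y ↔ x ≠ y ∧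
    (((∃ s u v, str x = (C, u) :: s ∧ str y = (C, v) :: s ∧ (A C).Adj u v) ∨
      (∃ v, str y = (C, v) :: str x ∧ (A C).Adj (label A v₁ x) v)) ∨
    ((∃ s u v, str y = (C, u) :: s ∧ str x = (C, v) :: s ∧ (A C).Adj u v) ∨
      (∃ v, str x = (C, v) :: str y ∧ (A C).Adj (label A v₁ y) v))) := Iff.rfl

theorem label_mem_support {C : Fin c} {u : Fin n} {s : PVertex A v₁}
    (h : Admissible A v₁ ((C, u) :: str s)) : label A v₁ s ∈ (A C).support := h.2.2.1

/-- Two vertices are joined by an edge of type `C` if they lie in the same copy of the atom `C`, in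
which their labels are joined. -/
theorem typeGraph_adj_iff {C : Fin c} {x y : PVertex A v₁} :
    (typeGraph A v₁ C).Adj x y ↔
      (A C).Adj (label A v₁ x) (label A v₁ y) ∧ base C x = base C y := by
  constructor
  · rw [typeGraph_adj_def]
    have key : ∀ x y : PVertex A v₁,
        ((∃ s u v, str x = (C, u) :: s ∧ str y = (C, v) :: s ∧ (A C).Adj u v) ∨
          (∃ v, str y = (C, v) :: str x ∧ (A C).Adj (label A v₁ x) v)) →
        (A C).Adj (label A v₁ x) (label A v₁ y) ∧ base C x = base C y := by
      rintro x y (⟨s, u, v, hx, hy, h⟩ | ⟨v, hy, h⟩)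
      · refine ⟨?_, str_injective ?_⟩
        · rw [label_eq, label_eq, hx, hy]; exact h
        · simp [base, hx, hy, baseList]
      · refine ⟨?_, str_injective ?_⟩
        · rw [label_eq, label_eq, hy]; exact h
        · have h2 := (admissible_str y)
          rw [hy] at h2
          simp only [base, hy, baseList, if_pos]
          exact baseList_of_head_ne h2.2.1
    rintro ⟨-, h | h⟩
    · exact key x y h
    · exact ⟨(key y x h).1.symm, (key y x h).2.symm⟩
  · rintro ⟨h, hb⟩
    rw [typeGraph_adj_def]
    refine ⟨fun hxy => h.ne (hxy ▸ rfl), ?_⟩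
    rcases eq_base_or_eq_cons C x with hx | hx <;> rcases eq_base_or_eq_cons C y with hy | hy
    · exact (h.ne (by rw [hx, hy, hb])).elim
    · left; right
      exact ⟨label A v₁ y, by rw [hy, ← hb, ← hx], h⟩
    · right; right
      exact ⟨label A v₁ x, by rw [hx, hb, ← hy], h.symm⟩
    · left; left
      exact ⟨str (base C x), _, _, hx, by rw [hb]; exact hy, h⟩

theorem support_left {G : SimpleGraph (Fin n)} {u v : Fin n} (h : G.Adj u v) : u ∈ G.support :=
  ⟨v, h⟩

/-- The neighbours of `x` along edges of type `C` are the vertices of its copy of the atom `C` whose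
labels are adjacent to that of `x`. -/
theorem typeGraph_adj_iff_step {C : Fin c} {x y : PVertex A v₁} :
    (typeGraph A v₁ C).Adj x y ↔
      (A C).Adj (label A v₁ x) (label A v₁ y) ∧ step x C (label A v₁ y) = y := by
  rw [typeGraph_adj_iff]
  refine and_congr_right fun h => ⟨step_of_base_eq (support_left h) (support_left h.symm), ?_⟩
  intro hs
  rw [← hs, base_step]

theorem typeGraph_adj_step {C : Fin c} {x : PVertex A v₁} {u : Fin n}
    (h : (A C).Adj (label A v₁ x) u) : (typeGraph A v₁ C).Adj x (step x C u) := by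
  rw [typeGraph_adj_iff, base_step, label_step (support_left h) (support_left h.symm)]
  exact ⟨h, rfl⟩

theorem length_baseList_le (C : Fin c) (s : List (Fin c × Fin n)) :
    (baseList C s).length ≤ s.length := by
  cases s with
  | nil => rfl
  | cons q s =>
    simp only [baseList]
    split_ifs <;> simp

/-- An edge of the additive product graph has only one type. -/
theorem typeGraph_type_unique {C C' : Fin c} {x y : PVertex A v₁}
    (h : (typeGraph A v₁ C).Adj x y) (h' : (typeGraph A v₁ C').Adj x y) : C = C' := by
  have key : ∀ x y : PVertex A v₁, (typeGraph A v₁ C).Adj x y → (typeGraph A v₁ C').Adj x y →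
      x = base C x → C = C' := by
    intro x y h h' hx
    by_contra hne
    have hb := (typeGraph_adj_iff.1 h).2
    have hb' := congrArg str (typeGraph_adj_iff.1 h').2
    rcases eq_base_or_eq_cons C y with hy | hy
    · exact h.ne (by rw [hx, hy, hb])
    · have h1 : str (base C' y) = str y := by
        rw [str_base, hy]; simp only [baseList, if_neg hne]
      have h2 := length_baseList_le C' (str x)
      change baseList C' (str x) = _ at hb'
      rw [hb', h1, hy, ← hb, ← hx] at h2
      simp at h2
  rcases eq_base_or_eq_cons C x with hx | hx
  · exact key x y h h' hx
  rcases eq_base_or_eq_cons C y with hy | hy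
  · exact key y x h.symm h'.symm hy
  by_contra hne
  have hb' := (typeGraph_adj_iff.1 h').2
  refine h.ne ?_
  have h1 : base C' x = x := str_injective (by
    rw [str_base, hx]; simp only [baseList, if_neg hne])
  have h2 : base C' y = y := str_injective (by
    rw [str_base, hy]; simp only [baseList, if_neg hne])
  rw [← h1, ← h2, hb']

/-- Every vertex is reached from `v₁` by steps. -/
theorem step_induction {P : PVertex A v₁ → Prop} (h0 : P (root A v₁))
    (hs : ∀ (x : PVertex A v₁) (C : Fin c) (u : Fin n), label A v₁ x ∈ (A C).support →
      u ∈ (A C).support → P x → P (step x C u)) (x : PVertex A v₁) : P x := by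
  refine str_induction h0 (fun s C u h ih => ?_) x
  rw [← step_of_cons h]
  exact hs s C u h.2.2.1 h.2.2.2.1 ih

/-- Every vertex of `[n]` is the label of a vertex of the additive product graph. -/
theorem exists_label_eq (hsum : (⨆ C, A C).Connected) (u : Fin n) :
    ∃ x : PVertex A v₁, label A v₁ x = u := by
  have key : ∀ u v, (⨆ C, A C).Walk u v → (∃ x : PVertex A v₁, label A v₁ x = v) →
      ∃ x : PVertex A v₁, label A v₁ x = u := by
    intro u v w hv
    induction w with
    | nil => exact hv
    | cons h w ih =>
      obtain ⟨x, hx⟩ := ih hv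
      obtain ⟨C, hC⟩ := SimpleGraph.iSup_adj.1 h
      exact ⟨step x C _, label_step (hx ▸ support_left hC.symm) (support_left hC)⟩
  obtain ⟨w⟩ := hsum.preconnected u v₁
  exact key u v₁ w ⟨root A v₁, rfl⟩

end Copies

/-! ### Change of the root -/

section Reroot

variable {n c : ℕ} {A : Fin c → SimpleGraph (Fin n)} {v₁ a : Fin n}

/-- Follow the string `s` from the vertex `x`. -/
def follow (x : PVertex A v₁) : List (Fin c × Fin n) → PVertex A v₁
  | [] => x
  | (C, u) :: s => step (follow x s) C u

theorem label_follow {x : PVertex A v₁} (hx : label A v₁ x = a) {s : List (Fin c × Fin n)}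
    (hs : Admissible A a s) : label A v₁ (follow x s) = lastVertex a s := by
  induction s with
  | nil => exact hx
  | cons q s ih =>
    exact label_step ((ih hs.1).symm ▸ hs.2.2.1) hs.2.2.2.1

theorem base_follow (x : PVertex A v₁) (C : Fin c) (s : List (Fin c × Fin n)) :
    base C (follow x s) = base C (follow x (baseList C s)) := by
  cases s with
  | nil => rfl
  | cons q s =>
    simp only [baseList]
    split_ifs with h
    · obtain ⟨C', u⟩ := q
      subst h
      exact base_step _ _ _
    · rfl

theorem follow_step {x : PVertex A v₁} (hx : label A v₁ x = a) {t : PVertex A a} {C : Fin c}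
    {u : Fin n} (ht : label A a t ∈ (A C).support) (hu : u ∈ (A C).support) :
    follow x (str (step t C u)) = step (follow x (str t)) C u := by
  have hl : label A v₁ (follow x (str t)) ∈ (A C).support := by
    rw [label_follow hx (admissible_str t)]; exact ht
  refine eq_of_base_eq_of_label_eq (C := C) ?_ ?_
  · rw [base_step, base_follow, base_follow x C (str t)]
    exact congrArg (fun y : PVertex A a => base C (follow x (str y))) (base_step t C u)
  · rw [label_step hl hu, label_follow hx (admissible_str (step t C u))]
    exact label_step ht hu

theorem follow_follow {x : PVertex A v₁} (hx : label A v₁ x = a) (t : PVertex A a)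
    {s : List (Fin c × Fin n)} (hs : Admissible A (label A a t) s) :
    follow x (str (follow t s)) = follow (follow x (str t)) s := by
  induction s with
  | nil => rfl
  | cons q s ih =>
    have hl : label A a (follow t s) ∈ (A q.1).support := by
      rw [label_follow rfl hs.1]; exact hs.2.2.1
    exact (follow_step hx hl hs.2.2.2.1).trans (congrArg (fun y => step y q.1 q.2) (ih hs.1))

theorem label_root : label A v₁ (root A v₁) = v₁ := rfl

theorem follow_root (s : PVertex A v₁) : follow (root A v₁) (str s) = s := by
  refine str_induction (P := fun s => follow (root A v₁) (str s) = s) rfl (fun s C u h ih => ?_) s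
  rw [← step_of_cons h, follow_step label_root (label_mem_support h) h.2.2.2.1, ih]

theorem follow_surjective {x : PVertex A v₁} (hx : label A v₁ x = a) :
    Function.Surjective fun t : PVertex A a => follow x (str t) := by
  have hstep : ∀ (y : PVertex A v₁) (C : Fin c) (u : Fin n), label A v₁ y ∈ (A C).support →
      u ∈ (A C).support → (∃ t : PVertex A a, follow x (str t) = y) →
      ∃ t : PVertex A a, follow x (str t) = step y C u := by
    rintro y C u hy hu ⟨t, rfl⟩
    rw [label_follow hx (admissible_str t)] at hy
    exact ⟨step t C u, follow_step hx hy hu⟩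
  -- going back along the string `x`, the image contains the root
  have hroot : ∃ t : PVertex A a, follow x (str t) = root A v₁ := by
    have key : ∀ y : PVertex A v₁, (∃ t : PVertex A a, follow x (str t) = y) →
        ∃ t : PVertex A a, follow x (str t) = root A v₁ := by
      intro y
      refine str_induction (P := fun y => (∃ t : PVertex A a, follow x (str t) = y) →
        ∃ t : PVertex A a, follow x (str t) = root A v₁) id (fun s C u h ih hy => ih ?_) y
      have hl : label A v₁ (step s C u) ∈ (A C).support := by
        rw [label_step h.2.2.1 h.2.2.2.1]; exact h.2.2.2.1
      rw [← step_of_cons h] at hy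
      have := hstep _ C (label A v₁ s) hl h.2.2.1 hy
      rwa [step_step (label_mem_support h) h.2.2.2.1 (label_mem_support h),
        step_label (label_mem_support h)] at this
    exact key x ⟨root _ _, rfl⟩
  exact fun y => step_induction (P := fun y => ∃ t : PVertex A a, follow x (str t) = y) hroot
    (fun y C u hy hu h => hstep y C u hy hu h) y

theorem follow_bijective {x : PVertex A v₁} (hx : label A v₁ x = a) :
    Function.Bijective fun t : PVertex A a => follow x (str t) := by
  refine ⟨?_, follow_surjective hx⟩
  obtain ⟨t, ht⟩ := follow_surjective hx (root A v₁)
  have hlt : label A a t = v₁ := (label_follow hx (admissible_str t)).symm.trans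
    (congrArg (label A v₁) ht)
  -- following `t` is a right inverse, and it is onto as well
  have hinv (s : PVertex A v₁) : follow x (str (follow t (str s))) = s := by
    rw [follow_follow hx t (hlt.symm ▸ (admissible_str s))]
    exact (congrArg (fun y => follow y (str s)) ht).trans (follow_root s)
  intro s s' h
  obtain ⟨r, rfl⟩ := follow_surjective hlt s
  obtain ⟨r', rfl⟩ := follow_surjective hlt s'
  have : r = r' := by
    have h' : follow x (str (follow t (str r))) = follow x (str (follow t (str r'))) := h
    rwa [hinv, hinv] at h'
  rw [this]

/-- Following strings from `x` preserves the edges of each type, because adjacency is determined by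
labels and `step`, and both are compatible with `follow`. -/
theorem typeGraph_adj_follow {x : PVertex A v₁} (hx : label A v₁ x = a) (C : Fin c)
    (s t : PVertex A a) :
    (typeGraph A v₁ C).Adj (follow x (str s)) (follow x (str t)) ↔ (typeGraph A a C).Adj s t := by
  rw [typeGraph_adj_iff_step, typeGraph_adj_iff_step, label_follow hx (admissible_str s),
    label_follow hx (admissible_str t)]
  refine and_congr_right fun h => ?_
  have := follow_step (u := lastVertex a (str t)) hx (t := s) (support_left h) (support_left h.symm)
  rw [← this]
  exact (follow_bijective hx).1.eq_iff

/-- Moving the root of the additive product graph to a vertex with label `a`. -/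
def reroot (x : PVertex A v₁) (hx : label A v₁ x = a) : PVertex A a ≃ PVertex A v₁ :=
  Equiv.ofBijective _ (follow_bijective hx)

/-- The automorphisms that keep labels and edge types act transitively on the vertices with a given
label. -/
theorem exists_isTypeAut {x y : PVertex A v₁} (h : label A v₁ x = label A v₁ y) :
    ∃ φ, IsTypeAut A v₁ φ ∧ φ x = y := by
  refine ⟨(reroot x rfl).symm.trans (reroot y h.symm), ⟨?_, ?_⟩, ?_⟩
  · intro z
    obtain ⟨t, rfl⟩ := (reroot x rfl).surjective z
    rw [Equiv.trans_apply, Equiv.symm_apply_apply]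
    exact (label_follow h.symm (admissible_str t)).trans (label_follow rfl (admissible_str t)).symm
  · intro C z w
    obtain ⟨s, rfl⟩ := (reroot x rfl).surjective z
    obtain ⟨t, rfl⟩ := (reroot x rfl).surjective w
    rw [Equiv.trans_apply, Equiv.trans_apply, Equiv.symm_apply_apply, Equiv.symm_apply_apply]
    exact (typeGraph_adj_follow h.symm C s t).trans (typeGraph_adj_follow rfl C s t).symm
  · have : (reroot x rfl).symm x = root A (label A v₁ x) :=
      (Equiv.symm_apply_eq _).2 rfl
    rw [Equiv.trans_apply, this]
    rfl

end Reroot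

/-! ### Marginal sums -/

section Marginal

variable {V K : Type*} [DecidableEq V] [Fintype K]

/-- Sum a function of configurations over the values at the sites of `T`. -/
def marg (T : Finset V) (g : (V → K) → ℂ) (z : V → K) : ℂ :=
  ∑ y : T → K, g (Function.updateFinset z T y)

theorem marg_union {S T : Finset V} (h : Disjoint S T) (g : (V → K) → ℂ) (z : V → K) :
    marg (S ∪ T) g z = marg S (marg T g) z := by
  simp only [marg, Function.updateFinset_updateFinset h]
  rw [← Fintype.sum_prod_type', ← (Equiv.piFinsetUnion (fun _ => K) h).sum_comp]

theorem marg_congr {T : Finset V} {g g' : (V → K) → ℂ} (z : V → K) (h : ∀ z, g z = g' z) :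
    marg T g z = marg T g' z := by
  rw [funext h]

theorem marg_empty (g : (V → K) → ℂ) (z : V → K) : marg ∅ g z = g z := by
  simp [marg]

/-- A factor that does not depend on the sites of `T` is taken out of the sum. -/
theorem marg_mul_left {T : Finset V} {h : (V → K) → ℂ} {S : Set V} (hh : DependsOn h S)
    (hS : ∀ v ∈ S, v ∉ T) (g : (V → K) → ℂ) (z : V → K) :
    marg T (fun z => h z * g z) z = h z * marg T g z := by
  rw [marg, marg, Finset.mul_sum]
  refine Finset.sum_congr rfl fun y _ => ?_
  rw [hh (fun v hv => ?_ : ∀ v ∈ S, Function.updateFinset z T y v = z v)]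
  exact dif_neg (hS v hv)

theorem dependsOn_marg {T : Finset V} {g : (V → K) → ℂ} {S : Set V} (hg : DependsOn g S) :
    DependsOn (marg T g) (S \ T) := by
  intro z z' h
  refine Finset.sum_congr rfl fun y _ => hg fun v hv => ?_
  by_cases hT : v ∈ T
  · simp [Function.updateFinset, hT]
  · simp [Function.updateFinset, hT, h v ⟨hv, hT⟩]

omit [DecidableEq V] [Fintype K] in
theorem dependsOn_mul {S S' : Set V} {g h : (V → K) → ℂ} (hg : DependsOn g S)
    (hh : DependsOn h S') : DependsOn (fun z => g z * h z) (S ∪ S') := fun z z' hz => by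
  simp only [hg fun v hv => hz v (Or.inl hv), hh fun v hv => hz v (Or.inr hv)]

omit [DecidableEq V] [Fintype K] in
theorem dependsOn_prod {ι : Type*} {I : Finset ι} {S : Set V} {h : ι → (V → K) → ℂ}
    (hh : ∀ i ∈ I, DependsOn (h i) S) : DependsOn (fun z => ∏ i ∈ I, h i z) S :=
  fun _ _ hz => Finset.prod_congr rfl fun i hi => hh i hi hz

/-- Independent sums: sites in the disjoint sets `T i`, each met by the factor `h i` only. -/
theorem marg_biUnion_prod {ι : Type*} [DecidableEq ι] (I : Finset ι) (T : ι → Finset V)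
    (S : ι → Set V) (h : ι → (V → K) → ℂ) (hh : ∀ i ∈ I, DependsOn (h i) (S i))
    (hS : ∀ i ∈ I, ∀ j ∈ I, i ≠ j → ∀ v ∈ S i, v ∉ T j) (hTS : ∀ i ∈ I, ∀ v ∈ T i, v ∈ S i)
    (z : V → K) :
    marg (I.biUnion T) (fun z => ∏ i ∈ I, h i z) z = ∏ i ∈ I, marg (T i) (h i) z := by
  induction I using Finset.induction_on generalizing z with
  | empty => simp [marg_empty]
  | insert a I ha ih =>
    have hne {i : ι} (hi : i ∈ I) : i ≠ a := fun h => ha (h ▸ hi)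
    have hi' {i : ι} (hi : i ∈ I) : i ∈ insert a I := Finset.mem_insert_of_mem hi
    have ha' : a ∈ insert a I := Finset.mem_insert_self a I
    have hdisj : Disjoint (I.biUnion T) (T a) := by
      rw [Finset.disjoint_biUnion_left]
      intro i hi
      rw [Finset.disjoint_left]
      exact fun v hv => hS i (hi' hi) a ha' (hne hi) v (hTS i (hi' hi) v hv)
    rw [Finset.biUnion_insert, Finset.union_comm, marg_union hdisj, Finset.prod_insert ha,
      ← ih (fun i hi => hh i (hi' hi)) (fun i hi j hj => hS i (hi' hi) j (hi' hj))
        (fun i hi => hTS i (hi' hi))]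
    have h1 (z : V → K) : marg (T a) (fun z => ∏ i ∈ insert a I, h i z) z =
        marg (T a) (h a) z * ∏ i ∈ I, h i z := by
      have hd : DependsOn (fun z => ∏ i ∈ I, h i z) (⋃ i ∈ I, S i) :=
        dependsOn_prod fun i hi => (hh i (hi' hi)).mono (Set.subset_biUnion_of_mem hi)
      rw [mul_comm, ← marg_mul_left hd]
      · refine marg_congr z fun z => ?_
        rw [Finset.prod_insert ha, mul_comm]
      · intro v hv
        obtain ⟨i, hi, hvi⟩ := Set.mem_iUnion₂.1 hv
        exact hS i (hi' hi) a ha' (hne hi) v hvi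
    rw [marg_congr z h1, marg_mul_left (dependsOn_marg (hh a ha'))]
    intro v hv hv'
    obtain ⟨i, hi, hvi⟩ := Finset.mem_biUnion.1 hv'
    exact hS a ha' i (hi' hi) (hne hi).symm v hv.1 hvi

/-- Relabelling the sites that are summed over. -/
theorem marg_image {ι : Type*} [DecidableEq ι] {B : Finset ι} {f : ι → V} (hf : Set.InjOn f B)
    (g : (V → K) → ℂ) (z : V → K) (G : (B → K) → ℂ)
    (hG : ∀ (y : B → K) (Z : V → K), (∀ k (hk : k ∈ B), Z (f k) = y ⟨k, hk⟩) →
      (∀ v, v ∉ B.image f → Z v = z v) → g Z = G y) :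
    marg (B.image f) g z = ∑ y, G y := by
  let e : B ≃ B.image f := Equiv.ofBijective
    (fun k => ⟨f k, Finset.mem_image_of_mem f k.2⟩) ⟨fun k l h =>
      Subtype.ext (hf k.2 l.2 (congrArg Subtype.val h)), fun v => by
        obtain ⟨k, hk, hv⟩ := Finset.mem_image.1 v.2
        exact ⟨⟨k, hk⟩, Subtype.ext hv⟩⟩
  rw [marg, ← (e.arrowCongr (Equiv.refl K)).sum_comp]
  refine Finset.sum_congr rfl fun y _ => hG y _ (fun k hk => ?_) fun v hv => dif_neg hv
  rw [Function.updateFinset, dif_pos (Finset.mem_image_of_mem f hk)]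
  change y (e.symm (e ⟨k, hk⟩)) = _
  rw [Equiv.symm_apply_apply]

end Marginal

/-! ### Depth and level of the vertices -/

section Depth

variable {n c : ℕ} {A : Fin c → SimpleGraph (Fin n)} {a : Fin n}

theorem reachable_of_mem_support (hatom : ∀ C, ((A C).induce (A C).support).Connected) {C : Fin c}
    {u v : Fin n} (hu : u ∈ (A C).support) (hv : v ∈ (A C).support) : (A C).Reachable u v :=
  ((hatom C).preconnected ⟨u, hu⟩ ⟨v, hv⟩).map (SimpleGraph.Embedding.induce _).toHom

theorem dist_le_succ {G : SimpleGraph (Fin n)} {u v w : Fin n} (h : G.Adj u v)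
    (hr : G.Reachable u w) : G.dist v w ≤ G.dist u w + 1 := by
  obtain ⟨q, hq⟩ := hr.exists_walk_length_eq_dist
  rw [← hq]
  exact SimpleGraph.dist_le (SimpleGraph.Walk.cons h.symm q)

/-- The type of the last step of a string, where the empty string is regarded as a vertex of the
copy of the atom `C₀` through the root. -/
def headType (C₀ : Fin c) (x : PVertex A a) : Fin c := ((str x).head?.map Prod.fst).getD C₀

open Classical in
/-- The distance of a string to the edge of type `C₀` from the root to the vertex `[(C₀, b)]`: the
distances covered in the successive copies add up. -/
def depthList (A : Fin c → SimpleGraph (Fin n)) (a : Fin n) (C₀ : Fin c) (b : Fin n) :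
    List (Fin c × Fin n) → ℕ
  | [] => 0
  | q :: s => if s = [] ∧ q.1 = C₀ then min ((A q.1).dist q.2 a) ((A q.1).dist q.2 b)
      else depthList A a C₀ b s + (A q.1).dist q.2 (lastVertex a s)

open Classical in
/-- The number of copies between a string and the copy of the atom `C₀` through the root. -/
def levelList (C₀ : Fin c) : List (Fin c × Fin n) → ℕ
  | [] => 0
  | q :: s => if s = [] ∧ q.1 = C₀ then 0 else levelList C₀ s + 1

/-- The distance of a vertex to the edge of type `C₀` from the root to `[(C₀, b)]`. -/
def depth (C₀ : Fin c) (b : Fin n) (x : PVertex A a) : ℕ := depthList A a C₀ b (str x)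

/-- The number of copies between a vertex and the copy of the atom `C₀` through the root. -/
def level (C₀ : Fin c) (x : PVertex A a) : ℕ := levelList C₀ (str x)

/-- The atoms of which a copy is attached at the vertex `s`, away from the root. -/
def downAtoms (C₀ : Fin c) (s : PVertex A a) : Finset (Fin c) :=
  otherAtoms A (headType C₀ s) (label A a s)

variable {C₀ : Fin c} {b : Fin n}

theorem mem_downAtoms {s : PVertex A a} {C : Fin c} :
    C ∈ downAtoms C₀ s ↔ C ≠ headType C₀ s ∧ label A a s ∈ (A C).support := by
  simp [downAtoms, otherAtoms]

theorem head_ne_of_ne_headType {s : PVertex A a} {C : Fin c} (h : C ≠ headType C₀ s) :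
    ∀ q ∈ (str s).head?, q.1 ≠ C := by
  intro q hq hC
  rw [headType, Option.mem_def.1 hq] at h
  exact h hC.symm

theorem base_of_mem_downAtoms {s : PVertex A a} {C : Fin c} (h : C ∈ downAtoms C₀ s) :
    base C s = s :=
  str_injective (baseList_of_head_ne (head_ne_of_ne_headType (mem_downAtoms.1 h).1))

theorem admissible_of_mem_downAtoms {s : PVertex A a} {C : Fin c} {k : Fin n}
    (h : C ∈ downAtoms C₀ s) (hk : k ∈ (A C).support) (hks : k ≠ label A a s) :
    Admissible A a ((C, k) :: str s) :=
  ⟨admissible_str s, head_ne_of_ne_headType (mem_downAtoms.1 h).1, (mem_downAtoms.1 h).2, hk,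
    hks.symm⟩

theorem not_root_copy {s : PVertex A a} {C : Fin c} (h : C ∈ downAtoms C₀ s) :
    ¬(str s = [] ∧ C = C₀) := by
  rintro ⟨hs, rfl⟩
  exact (mem_downAtoms.1 h).1 (by simp [headType, hs])

theorem step_label_of_mem_downAtoms {s : PVertex A a} {C : Fin c} (h : C ∈ downAtoms C₀ s) :
    step s C (label A a s) = s :=
  step_label (mem_downAtoms.1 h).2

theorem depth_step {s : PVertex A a} {C : Fin c} {k : Fin n} (h : C ∈ downAtoms C₀ s)
    (hk : k ∈ (A C).support) :
    depth C₀ b (step s C k) = depth C₀ b s + (A C).dist k (label A a s) := by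
  by_cases hks : k = label A a s
  · rw [hks, step_label_of_mem_downAtoms h, SimpleGraph.dist_self, add_zero]
  · rw [step_of_cons (admissible_of_mem_downAtoms h hk hks), depth, str_ofStr, depthList,
      if_neg (not_root_copy h)]
    rfl

theorem level_step {s : PVertex A a} {C : Fin c} {k : Fin n} (h : C ∈ downAtoms C₀ s)
    (hk : k ∈ (A C).support) (hks : k ≠ label A a s) :
    level C₀ (step s C k) = level C₀ s + 1 := by
  rw [step_of_cons (admissible_of_mem_downAtoms h hk hks), level, str_ofStr, levelList,
    if_neg (not_root_copy h)]
  rfl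

theorem headType_step {s : PVertex A a} {C : Fin c} {k : Fin n} (h : C ∈ downAtoms C₀ s)
    (hk : k ∈ (A C).support) (hks : k ≠ label A a s) :
    headType C₀ (step s C k) = C := by
  rw [step_of_cons (admissible_of_mem_downAtoms h hk hks)]
  rfl

theorem admissible_root {k : Fin n} (ha : a ∈ (A C₀).support) (hk : k ∈ (A C₀).support)
    (hka : k ≠ a) : Admissible A a ((C₀, k) :: str (root A a)) :=
  ⟨trivial, fun _ hq => (by cases hq), ha, hk, hka.symm⟩

theorem step_root_self (ha : a ∈ (A C₀).support) : step (root A a) C₀ a = root A a :=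
  step_label (x := root A a) ha

theorem depth_step_root {k : Fin n} (ha : a ∈ (A C₀).support) (hk : k ∈ (A C₀).support) :
    depth C₀ b (step (root A a) C₀ k) = min ((A C₀).dist k a) ((A C₀).dist k b) := by
  by_cases hka : k = a
  · subst hka
    rw [step_root_self ha, SimpleGraph.dist_self, Nat.zero_min]
    rfl
  · rw [step_of_cons (admissible_root ha hk hka), depth, str_ofStr, depthList]
    exact if_pos ⟨rfl, rfl⟩

theorem level_step_root {k : Fin n} (ha : a ∈ (A C₀).support) (hk : k ∈ (A C₀).support) :
    level C₀ (step (root A a) C₀ k) = 0 := by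
  by_cases hka : k = a
  · subst hka
    rw [step_root_self ha]
    rfl
  · rw [step_of_cons (admissible_root ha hk hka), level, str_ofStr, levelList]
    exact if_pos ⟨rfl, rfl⟩

theorem headType_step_root {k : Fin n} (ha : a ∈ (A C₀).support) (hk : k ∈ (A C₀).support) :
    headType C₀ (step (root A a) C₀ k) = C₀ := by
  by_cases hka : k = a
  · subst hka
    rw [step_root_self ha]
    rfl
  · rw [step_of_cons (admissible_root ha hk hka)]
    rfl

theorem label_step_root {k : Fin n} (ha : a ∈ (A C₀).support) (hk : k ∈ (A C₀).support) :
    label A a (step (root A a) C₀ k) = k :=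
  label_step (x := root A a) ha hk

/-- A vertex lies in the copy through the root or in a copy attached at a vertex nearer to it. -/
theorem exists_eq_step (ha : a ∈ (A C₀).support) (w : PVertex A a) :
    (∃ k ∈ (A C₀).support, w = step (root A a) C₀ k) ∨
      ∃ s C k, C ∈ downAtoms C₀ s ∧ k ∈ (A C).support ∧ k ≠ label A a s ∧ w = step s C k := by
  refine str_induction (P := fun w => (∃ k ∈ (A C₀).support, w = step (root A a) C₀ k) ∨
      ∃ s C k, C ∈ downAtoms C₀ s ∧ k ∈ (A C).support ∧ k ≠ label A a s ∧ w = step s C k)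
    (Or.inl ⟨a, ha, (step_root_self ha).symm⟩) (fun s C k h _ => ?_) w
  by_cases hs : str s = [] ∧ C = C₀
  · left
    obtain ⟨hs, rfl⟩ := hs
    obtain rfl : s = root A a := str_injective hs
    exact ⟨k, h.2.2.2.1, (step_of_cons h).symm⟩
  · right
    refine ⟨s, C, k, mem_downAtoms.2 ⟨fun hC => ?_, h.2.2.1⟩, h.2.2.2.1, h.2.2.2.2.symm,
      (step_of_cons h).symm⟩
    rw [headType] at hC
    cases hl : str s with
    | nil => exact hs ⟨hl, by simpa [hl] using hC⟩
    | cons q l =>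
      rw [hl] at hC h
      exact h.2.1 q (by simp) hC.symm

/-- The copy of the atom `C` through `x` is the copy through the root, or it is attached at the
vertex `base C x`. -/
theorem root_or_mem_downAtoms {C : Fin c} {x : PVertex A a} (hx : label A a x ∈ (A C).support) :
    (base C x = root A a ∧ C = C₀) ∨ C ∈ downAtoms C₀ (base C x) := by
  by_cases h : base C x = root A a ∧ C = C₀
  · exact Or.inl h
  · right
    refine mem_downAtoms.2 ⟨fun hC => ?_, label_base_mem_support hx⟩
    rw [headType] at hC
    cases hl : str (base C x) with
    | nil => exact h ⟨str_injective hl, by simpa [hl] using hC⟩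
    | cons q l =>
      rw [hl] at hC
      refine head_baseList_ne C (admissible_str x) q ?_ hC.symm
      rw [← str_base, hl]
      simp

theorem step_base_label {C : Fin c} {x : PVertex A a} (hx : label A a x ∈ (A C).support) :
    step (base C x) C (label A a x) = x :=
  step_of_base_eq (label_base_mem_support hx) hx (base_base C x)

/-- The depth grows by at most one along an edge. -/
theorem depth_le_succ (hatom : ∀ C, ((A C).induce (A C).support).Connected)
    (hab : (A C₀).Adj a b) {C : Fin c} {x y : PVertex A a} (h : (typeGraph A a C).Adj x y) :
    depth C₀ b y ≤ depth C₀ b x + 1 := by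
  obtain ⟨hl, hbase⟩ := typeGraph_adj_iff.1 h
  have hx := support_left hl
  have hy := support_left hl.symm
  have hr {v : Fin n} (hv : v ∈ (A C).support) :=
    dist_le_succ hl (reachable_of_mem_support hatom hx hv)
  rw [← step_base_label hx, ← step_base_label hy, ← hbase]
  rcases root_or_mem_downAtoms (C₀ := C₀) hx with ⟨h0, rfl⟩ | hd
  · have ha := support_left hab
    rw [h0, depth_step_root ha hx, depth_step_root ha hy]
    have h1 := hr ha
    have h2 := hr (support_left hab.symm)
    omega
  · rw [depth_step hd hx, depth_step hd hy]
    have := hr (label_base_mem_support hx)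
    omega

/-- Every passage to a new copy costs at least one unit of depth, so that summing over `p` levels
exhausts the vertices of depth at most `p`. -/
theorem level_le_depth (hatom : ∀ C, ((A C).induce (A C).support).Connected)
    (x : PVertex A a) : level C₀ x ≤ depth C₀ b x := by
  refine str_induction (P := fun x => level C₀ x ≤ depth C₀ b x) le_rfl (fun s C k h ih => ?_) x
  rw [level, depth, str_ofStr, levelList, depthList]
  split_ifs
  · exact Nat.zero_le _
  · have := (reachable_of_mem_support hatom h.2.2.2.1 h.2.2.1).pos_dist_of_ne h.2.2.2.2.symm
    exact Nat.add_le_add ih this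

theorem length_str_le (x : PVertex A a) : (str x).length ≤ level C₀ x + 1 := by
  refine str_induction (P := fun x => (str x).length ≤ level C₀ x + 1) (Nat.zero_le _)
    (fun s C k h ih => ?_) x
  rw [level, str_ofStr, levelList]
  split_ifs with h0
  · simp [h0.1]
  · exact Nat.add_le_add_right ih 1

theorem finite_depth_le (hatom : ∀ C, ((A C).induce (A C).support).Connected) (p : ℕ) :
    {x : PVertex A a | depth C₀ b x ≤ p}.Finite := by
  refine Set.Finite.of_finite_image (f := str) ?_ fun x _ y _ h => str_injective h
  refine (List.finite_length_le (Fin c × Fin n) (p + 1)).subset ?_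
  rintro _ ⟨x, hx, rfl⟩
  exact (length_str_le (C₀ := C₀) x).trans
    (Nat.add_le_add_right ((level_le_depth hatom x).trans hx) 1)

/-- A function that grows by at most one along edges is at most `p` on the `p`-neighbourhood of two
of its zeros. -/
theorem le_of_mem_nbhd {V : Type*} {X : SimpleGraph V} {f : V → ℕ}
    (hf : ∀ u v, X.Adj u v → f v ≤ f u + 1) {x y : V} (hx : f x = 0) (hy : f y = 0) {p : ℕ} {w : V}
    (hw : w ∈ nbhd X p x y) : f w ≤ p := by
  have key : ∀ x, f x = 0 → X.edist w x ≤ p → f w ≤ p := by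
    intro x hx h
    obtain ⟨q, hq⟩ := SimpleGraph.exists_walk_of_edist_ne_top (ne_top_of_le_ne_top (by simp) h)
    rw [← hq] at h
    have hlen : q.length ≤ p := by exact_mod_cast h
    refine le_trans ?_ hlen
    clear h hq hlen hw hy
    induction q with
    | nil => exact hx.le
    | cons h q ih =>
      have := hf _ _ h.symm
      have := ih hx
      rw [SimpleGraph.Walk.length_cons]
      omega
  rcases hw with h | h
  · exact key x hx h
  · exact key y hy h

theorem nbhd_mono {V : Type*} (X : SimpleGraph V) {p q : ℕ} (h : p ≤ q) (x y : V) :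
    nbhd X p x y ⊆ nbhd X q x y := by
  have h' : (p : ℕ∞) ≤ q := by exact_mod_cast h
  exact fun w hw => hw.imp (fun h => h.trans h') fun h => h.trans h'

theorem mem_nbhd_succ {V : Type*} {X : SimpleGraph V} {p : ℕ} {x y u v : V}
    (hu : u ∈ nbhd X p x y) (h : X.Adj u v) : v ∈ nbhd X (p + 1) x y := by
  have key (w : V) (hw : X.edist u w ≤ p) : X.edist v w ≤ (p + 1 : ℕ) := by
    have h1 : X.edist v u ≤ 1 := SimpleGraph.edist_le_one_iff_adj_or_eq.2 (Or.inl h.symm)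
    calc X.edist v w ≤ X.edist v u + X.edist u w := SimpleGraph.edist_triangle
      _ ≤ 1 + p := add_le_add h1 hw
      _ = (p + 1 : ℕ) := by push_cast; ring
  exact hu.imp (key x) (key y)

end Depth

/-! ### Elementary facts on the iteration -/

section Iteration

variable {n c p : ℕ} {A : Fin c → SimpleGraph (Fin n)}

theorem phase_congr {γ : Fin p → Fin c → ℝ} {C : Fin c} {S : Finset (Fin n)}
    {z z' : Fin n → Config p} (h : ∀ k ∈ S, z k = z' k) : phase A γ C S z = phase A γ C S z' := by
  classical
  rw [phase, phase]
  congr 2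
  refine Finset.sum_congr rfl fun q hq => ?_
  have := Finset.mem_product.1 (Finset.mem_filter.1 hq).1
  rw [h _ this.1, h _ this.2]

theorem extend_of_mem {S : Finset (Fin n)} (x : Config p) (z : S → Config p) {k : Fin n}
    (h : k ∈ S) : extend S x z k = z ⟨k, h⟩ := dif_pos h

theorem extend_of_notMem {S : Finset (Fin n)} (x : Config p) (z : S → Config p) {k : Fin n}
    (h : k ∉ S) : extend S x z k = x := dif_neg h

theorem puncturedBall_zero (C : Fin c) (a : Fin n) : puncturedBall A C a 0 = ∅ := by
  classical
  rw [puncturedBall, Finset.filter_eq_empty_iff]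
  omega

theorem phase_singleton (γ : Fin p → Fin c → ℝ) (C : Fin c) (a : Fin n) (z : Fin n → Config p) :
    phase A γ C {a} z = 1 := by
  classical
  rw [phase, Finset.filter_eq_empty_iff.2]
  · simp
  · intro q hq
    rw [Finset.mem_product, Finset.mem_singleton, Finset.mem_singleton] at hq
    rw [hq.1, hq.2]
    exact fun h => lt_irrefl _ h.1

/-- The recursion for `G` also holds at radius `0`, where the sum has one term. -/
theorem iterG_eq (γ : Fin p → Fin c → ℝ) (β : Fin p → ℝ) (m : ℕ) (C : Fin c) (a : Fin n)
    (x : Config p) :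
    iterG A γ β m C a x = ∑ z : puncturedBall A C a m → Config p,
      (∏ k : puncturedBall A C a m,
        (fWeight β (z k) *
          ∏ C' ∈ otherAtoms A C k, iterG A γ β (m - (A C).dist k a) C' k (z k))) *
      phase A γ C (insert a (puncturedBall A C a m)) (extend (puncturedBall A C a m) x z) := by
  by_cases hm : m = 0
  · subst hm
    rw [iterG, if_pos rfl]
    have : IsEmpty (puncturedBall A C a 0) := by
      rw [puncturedBall_zero]
      infer_instance
    rw [Fintype.sum_unique, Fintype.prod_empty, one_mul]
    have h : insert a (puncturedBall A C a 0) = {a} := by rw [puncturedBall_zero]; rfl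
    rw [h, phase_singleton]
  · rw [iterG, if_neg hm]

end Iteration

/-! ### Summation over the copies, level by level -/

section Levels

variable {n c p : ℕ} {A : Fin c → SimpleGraph (Fin n)} {a : Fin n} {C₀ : Fin c} {b : Fin n}
  {γ : Fin p → Fin c → ℝ} {β : Fin p → ℝ}

/-- The labels of the vertices other than `s` in the copy of the atom `C` attached at `s`, up to
depth `p`. -/
def ballBelow (C₀ : Fin c) (b : Fin n) (p : ℕ) (s : PVertex A a) (C : Fin c) : Finset (Fin n) :=
  puncturedBall A C (label A a s) (p - depth C₀ b s)

/-- The vertices other than `s` in the copy of the atom `C` attached at `s`, up to depth `p`. -/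
def kids (C₀ : Fin c) (b : Fin n) (p : ℕ) (s : PVertex A a) (C : Fin c) : Finset (PVertex A a) :=
  (ballBelow C₀ b p s C).image (step s C)

/-- The phase of the edges in the copy of the atom `C` attached at `s`. -/
def copyPhase (C₀ : Fin c) (b : Fin n) (γ : Fin p → Fin c → ℝ) (s : PVertex A a) (C : Fin c)
    (z : PVertex A a → Config p) : ℂ :=
  phase A γ C (insert (label A a s) (ballBelow C₀ b p s C)) fun k => z (step s C k)

/-- The weight of a vertex together with the copies attached to it. -/
def openWeight (C₀ : Fin c) (b : Fin n) (γ : Fin p → Fin c → ℝ) (β : Fin p → ℝ) (s : PVertex A a)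
    (z : PVertex A a → Config p) : ℂ :=
  fWeight β (z s) * ∏ C ∈ downAtoms C₀ s, copyPhase C₀ b γ s C z

/-- The weight of a vertex, after all the vertices behind it have been summed over. -/
def closedWeight (C₀ : Fin c) (b : Fin n) (γ : Fin p → Fin c → ℝ) (β : Fin p → ℝ) (s : PVertex A a)
    (z : PVertex A a → Config p) : ℂ :=
  fWeight β (z s) *
    ∏ C ∈ downAtoms C₀ s, iterG A γ β (p - depth C₀ b s) C (label A a s) (z s)

theorem mem_ballBelow (hatom : ∀ C, ((A C).induce (A C).support).Connected) {s : PVertex A a}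
    {C : Fin c} (hC : C ∈ downAtoms C₀ s) {k : Fin n} :
    k ∈ ballBelow C₀ b p s C ↔ k ∈ (A C).support ∧ k ≠ label A a s ∧
      (A C).dist k (label A a s) ≤ p - depth C₀ b s := by
  simp only [ballBelow, puncturedBall, Finset.mem_filter, Finset.mem_univ, true_and]
  refine and_congr_right fun hk => and_congr_left fun _ => ⟨?_, fun h => ?_⟩
  · rintro h rfl
    simp at h
  · exact (reachable_of_mem_support hatom hk (mem_downAtoms.1 hC).2).pos_dist_of_ne h

theorem mem_kids (hatom : ∀ C, ((A C).induce (A C).support).Connected) {s w : PVertex A a}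
    {C : Fin c} (hC : C ∈ downAtoms C₀ s) : w ∈ kids C₀ b p s C ↔
      ∃ k, (k ∈ (A C).support ∧ k ≠ label A a s ∧
        (A C).dist k (label A a s) ≤ p - depth C₀ b s) ∧ step s C k = w := by
  simp only [kids, Finset.mem_image, mem_ballBelow hatom hC]

theorem level_of_mem_kids (hatom : ∀ C, ((A C).induce (A C).support).Connected) {s w : PVertex A a}
    {C : Fin c} (hC : C ∈ downAtoms C₀ s) (hw : w ∈ kids C₀ b p s C) :
    level C₀ w = level C₀ s + 1 := by
  obtain ⟨k, ⟨hk, hks, -⟩, rfl⟩ := (mem_kids hatom hC).1 hw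
  exact level_step hC hk hks

theorem base_of_mem_kids {s w : PVertex A a} {C : Fin c} (hC : C ∈ downAtoms C₀ s)
    (hw : w ∈ kids C₀ b p s C) : base C w = s := by
  obtain ⟨k, -, rfl⟩ := Finset.mem_image.1 hw
  rw [base_step, base_of_mem_downAtoms hC]

theorem headType_of_mem_kids (hatom : ∀ C, ((A C).induce (A C).support).Connected)
    {s w : PVertex A a} {C : Fin c} (hC : C ∈ downAtoms C₀ s) (hw : w ∈ kids C₀ b p s C) :
    headType C₀ w = C := by
  obtain ⟨k, ⟨hk, hks, -⟩, rfl⟩ := (mem_kids hatom hC).1 hw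
  exact headType_step hC hk hks

theorem injOn_step (s : PVertex A a) {C : Fin c} (hs : label A a s ∈ (A C).support)
    {S : Set (Fin n)} (hS : S ⊆ (A C).support) : Set.InjOn (step s C) S := by
  intro k hk l hl h
  rw [← label_step hs (hS hk), h, label_step hs (hS hl)]

/-- `G` is the sum over the vertices in one copy, where the vertices behind these have been summed
over before. -/
theorem iterG_eq_marg_kids (hatom : ∀ C, ((A C).induce (A C).support).Connected)
    {s : PVertex A a} {C : Fin c} (hC : C ∈ downAtoms C₀ s) (z : PVertex A a → Config p) :
    iterG A γ β (p - depth C₀ b s) C (label A a s) (z s) =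
      marg (kids C₀ b p s C) (fun Z => copyPhase C₀ b γ s C Z *
        ∏ w ∈ kids C₀ b p s C, closedWeight C₀ b γ β w Z) z := by
  have hs := (mem_downAtoms.1 hC).2
  have hinj : Set.InjOn (step s C) (ballBelow C₀ b p s C) :=
    injOn_step s hs fun k hk => ((mem_ballBelow hatom hC).1 hk).1
  rw [iterG_eq]
  symm
  refine marg_image hinj _ _ _ fun y Z hy hz => ?_
  have hZs : Z s = z s := hz s fun h => by
    have := level_of_mem_kids hatom hC h
    omega
  rw [mul_comm]
  congr 1
  · rw [kids, Finset.prod_image hinj]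
    refine Eq.trans (Finset.prod_attach _ _).symm (Finset.prod_congr rfl fun k _ => ?_)
    obtain ⟨hk, hks, -⟩ := (mem_ballBelow hatom hC).1 k.2
    rw [closedWeight, downAtoms, hy k k.2, headType_step hC hk hks, label_step hs hk,
      depth_step hC hk, ← Nat.sub_sub]
  · refine phase_congr fun k hk => ?_
    by_cases hkb : k ∈ ballBelow C₀ b p s C
    · exact (hy k hkb).trans (extend_of_mem _ _ hkb).symm
    · obtain rfl := (Finset.mem_insert.1 hk).resolve_right hkb
      rw [step_label hs, hZs]
      exact (extend_of_notMem _ _ hkb).symm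

theorem dependsOn_copyPhase {s : PVertex A a} {C : Fin c} (hC : C ∈ downAtoms C₀ s) :
    DependsOn (copyPhase (p := p) C₀ b γ s C) (insert s (kids C₀ b p s C : Set (PVertex A a))) := by
  intro z z' h
  refine phase_congr fun k hk => h _ ?_
  rcases Finset.mem_insert.1 hk with rfl | hk
  · left
    exact step_label_of_mem_downAtoms hC
  · right
    exact Finset.mem_image_of_mem _ hk

theorem dependsOn_fWeight (s : PVertex A a) :
    DependsOn (fun z : PVertex A a → Config p => fWeight β (z s)) {s} := by
  intro z z' h
  simp only [h s rfl]

theorem dependsOn_closedWeight (s : PVertex A a) :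
    DependsOn (closedWeight (p := p) C₀ b γ β s) {s} := by
  intro z z' h
  simp only [closedWeight, h s rfl]

/-- The path sum over the vertices up to level `L`, in which the vertices at level `L` carry the
weights that result from the summation over all the vertices behind them. -/
def levelSum (γ : Fin p → Fin c → ℝ) (β : Fin p → ℝ) (C₀ : Fin c) (b : Fin n)
    (N : Finset (PVertex A a))
    (o : (PVertex A a → Config p) → ℂ) (L : ℕ) (z : PVertex A a → Config p) : ℂ :=
  marg (N.filter fun s => level C₀ s ≤ L) (fun Z => o Z *
    (∏ s ∈ N with level C₀ s < L, openWeight C₀ b γ β s Z) *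
    ∏ s ∈ N with level C₀ s = L, closedWeight C₀ b γ β s Z) z

theorem kids_subset (hatom : ∀ C, ((A C).induce (A C).support).Connected)
    {N : Finset (PVertex A a)} (hN : ∀ x, x ∈ N ↔ depth C₀ b x ≤ p) {s : PVertex A a} (hs : s ∈ N)
    {C : Fin c} (hC : C ∈ downAtoms C₀ s) : kids C₀ b p s C ⊆ N := by
  intro w hw
  obtain ⟨k, ⟨hk, hks, hd⟩, rfl⟩ := (mem_kids hatom hC).1 hw
  have := (hN s).1 hs
  rw [hN, depth_step hC hk]
  omega

open Classical in
theorem filter_level_succ (hatom : ∀ C, ((A C).induce (A C).support).Connected)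
    (ha : a ∈ (A C₀).support)
    {N : Finset (PVertex A a)} (hN : ∀ x, x ∈ N ↔ depth C₀ b x ≤ p) (L : ℕ) :
    N.filter (fun s => level C₀ s = L + 1) =
      ((N.filter fun s => level C₀ s = L).sigma fun s => downAtoms C₀ s).biUnion
        fun i => kids C₀ b p i.1 i.2 := by
  ext w
  simp only [Finset.mem_filter, Finset.mem_biUnion, Finset.mem_sigma]
  constructor
  · rintro ⟨hw, hl⟩
    rcases exists_eq_step ha w with ⟨k, hk, rfl⟩ | ⟨s, C, k, hC, hk, hks, rfl⟩
    · rw [level_step_root ha hk] at hl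
      omega
    · rw [level_step hC hk hks] at hl
      have hd := (hN _).1 hw
      rw [depth_step hC hk] at hd
      exact ⟨⟨s, C⟩, ⟨⟨(hN s).2 (by omega), by simpa using hl⟩, hC⟩,
        (mem_kids hatom hC).2 ⟨k, ⟨hk, hks, by omega⟩, rfl⟩⟩
  · rintro ⟨⟨s, C⟩, ⟨⟨hs, hl⟩, hC⟩, hw⟩
    exact ⟨kids_subset hatom hN hs hC hw, by rw [level_of_mem_kids hatom hC hw]; simp [hl]⟩

/-- Summing over one more level does not change the path sum. -/
theorem levelSum_succ (hatom : ∀ C, ((A C).induce (A C).support).Connected)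
    (ha : a ∈ (A C₀).support) {N : Finset (PVertex A a)} (hN : ∀ x, x ∈ N ↔ depth C₀ b x ≤ p)
    {o : (PVertex A a → Config p) → ℂ} (ho : DependsOn o {s | level C₀ s = 0}) (L : ℕ)
    (z : PVertex A a → Config p) :
    levelSum γ β C₀ b N o (L + 1) z = levelSum γ β C₀ b N o L z := by
  classical
  set F := fun L => N.filter fun s => level C₀ s = L with hF
  set I := (F L).sigma fun s => downAtoms C₀ s with hI
  have hmem {i : Σ _ : PVertex A a, Fin c} (hi : i ∈ I) :
      i.1 ∈ N ∧ level C₀ i.1 = L ∧ i.2 ∈ downAtoms C₀ i.1 := by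
    have := Finset.mem_sigma.1 hi
    exact ⟨(Finset.mem_filter.1 this.1).1, (Finset.mem_filter.1 this.1).2, this.2⟩
  have hsucc : F (L + 1) = I.biUnion fun i => kids C₀ b p i.1 i.2 :=
    filter_level_succ hatom ha hN L
  have hT : (N.filter fun s => level C₀ s ≤ L + 1) =
      (N.filter fun s => level C₀ s ≤ L) ∪ F (L + 1) := by
    ext s
    simp only [hF, Finset.mem_filter, Finset.mem_union]
    constructor
    · rintro ⟨h, h'⟩
      rcases Nat.le_succ_iff.1 h' with h' | h'
      · exact Or.inl ⟨h, h'⟩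
      · exact Or.inr ⟨h, h'⟩
    · rintro (⟨h, h'⟩ | ⟨h, h'⟩) <;> exact ⟨h, by omega⟩
  have hdisj : Disjoint (N.filter fun s => level C₀ s ≤ L) (F (L + 1)) := by
    rw [Finset.disjoint_filter]
    intro s _ h
    omega
  have hlt : (N.filter fun s => level C₀ s < L + 1) =
      (N.filter fun s => level C₀ s < L) ∪ F L := by
    ext s
    simp only [hF, Finset.mem_filter, Finset.mem_union, ← and_or_left]
    exact and_congr_right fun _ => by omega
  have hltdisj : Disjoint (N.filter fun s => level C₀ s < L) (F L) := by
    rw [Finset.disjoint_filter]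
    intro s _ h
    omega
  rw [levelSum, hT, marg_union hdisj, levelSum]
  refine marg_congr z fun Z => ?_
  -- the sums over the copies attached at the level `L` are independent of each other
  have key := marg_biUnion_prod I (fun i => kids C₀ b p i.1 i.2)
    (fun i => insert i.1 (kids C₀ b p i.1 i.2 : Set (PVertex A a)))
    (fun i Z => copyPhase C₀ b γ i.1 i.2 Z *
      ∏ w ∈ kids C₀ b p i.1 i.2, closedWeight C₀ b γ β w Z)
    (fun i hi => by
      have h1 := dependsOn_copyPhase (p := p) (b := b) (γ := γ) (hmem hi).2.2
      have h2 : DependsOn (fun Z : PVertex A a → Config p =>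
          ∏ w ∈ kids C₀ b p i.1 i.2, closedWeight C₀ b γ β w Z)
          (insert i.1 (kids C₀ b p i.1 i.2 : Set (PVertex A a))) :=
        dependsOn_prod fun w hw => (dependsOn_closedWeight w).mono
          (Set.singleton_subset_iff.2 (Or.inr hw))
      simpa using dependsOn_mul h1 h2)
    (fun i hi j hj hij v hv hvj => by
      obtain ⟨-, hli, hCi⟩ := hmem hi
      obtain ⟨-, hlj, hCj⟩ := hmem hj
      rcases hv with rfl | hv
      · have := level_of_mem_kids hatom hCj hvj
        omega
      · have h2 : i.2 = j.2 := by
          rw [← headType_of_mem_kids hatom hCi hv, headType_of_mem_kids hatom hCj hvj]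
        refine hij (Sigma.ext ?_ (heq_of_eq h2))
        rw [← base_of_mem_kids hCi hv, h2, base_of_mem_kids hCj hvj])
    (fun i _ v hv => Or.inr hv) Z
  rw [← hsucc] at key
  have hkey : marg (F (L + 1)) (fun Z => ∏ i ∈ I, (copyPhase C₀ b γ i.1 i.2 Z *
      ∏ w ∈ kids C₀ b p i.1 i.2, closedWeight C₀ b γ β w Z)) Z =
      ∏ s ∈ F L, ∏ C ∈ downAtoms C₀ s,
        iterG A γ β (p - depth C₀ b s) C (label A a s) (Z s) := by
    rw [key, hI, Finset.prod_sigma]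
    refine Finset.prod_congr rfl fun s _ => Finset.prod_congr rfl fun C hC => ?_
    exact (iterG_eq_marg_kids hatom hC Z).symm
  have hsplit (Z : PVertex A a → Config p) :
      o Z * (∏ s ∈ N with level C₀ s < L + 1, openWeight C₀ b γ β s Z) *
        ∏ s ∈ N with level C₀ s = L + 1, closedWeight C₀ b γ β s Z =
      (o Z * (∏ s ∈ N with level C₀ s < L, openWeight C₀ b γ β s Z) *
        ∏ s ∈ F L, fWeight β (Z s)) *
      ∏ i ∈ I, (copyPhase C₀ b γ i.1 i.2 Z *
        ∏ w ∈ kids C₀ b p i.1 i.2, closedWeight C₀ b γ β w Z) := by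
    have h1 : ∏ s ∈ N with level C₀ s = L + 1, closedWeight C₀ b γ β s Z =
        ∏ i ∈ I, ∏ w ∈ kids C₀ b p i.1 i.2, closedWeight C₀ b γ β w Z := by
      rw [← Finset.prod_biUnion]
      · exact Finset.prod_congr hsucc fun _ _ => rfl
      · intro i hi j hj hij
        rw [Function.onFun, Finset.disjoint_left]
        intro v hv hvj
        obtain ⟨-, -, hCi⟩ := hmem hi
        obtain ⟨-, -, hCj⟩ := hmem hj
        have h2 : i.2 = j.2 := by
          rw [← headType_of_mem_kids hatom hCi hv, headType_of_mem_kids hatom hCj hvj]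
        refine hij (Sigma.ext ?_ (heq_of_eq h2))
        rw [← base_of_mem_kids hCi hv, h2, base_of_mem_kids hCj hvj]
    rw [hlt, Finset.prod_union hltdisj, h1, Finset.prod_mul_distrib]
    -- the phases of the copies attached at the level `L` are set apart
    have h3 : ∏ s ∈ F L, openWeight C₀ b γ β s Z = (∏ s ∈ F L, fWeight β (Z s)) *
        ∏ i ∈ I, copyPhase C₀ b γ i.1 i.2 Z := by
      rw [hI, Finset.prod_sigma, ← Finset.prod_mul_distrib]
      rfl
    rw [h3]
    ring
  rw [marg_congr Z hsplit]
  -- all the other factors are constant in the variables at the level `L + 1`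
  have hdep : DependsOn (fun Z : PVertex A a → Config p =>
      o Z * (∏ s ∈ N with level C₀ s < L, openWeight C₀ b γ β s Z) *
        ∏ s ∈ F L, fWeight β (Z s)) {s | level C₀ s ≤ L} := by
    have h1 : DependsOn o {s | level C₀ s ≤ L} := ho.mono fun s hs => by
      rw [Set.mem_ofPred_eq] at hs ⊢
      omega
    have h2 : DependsOn (fun Z : PVertex A a → Config p =>
        ∏ s ∈ N with level C₀ s < L, openWeight C₀ b γ β s Z) {s | level C₀ s ≤ L} := by
      refine dependsOn_prod fun s hs => ?_
      have hl := (Finset.mem_filter.1 hs).2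
      have h3 : DependsOn (fun Z : PVertex A a → Config p => fWeight β (Z s))
          {s | level C₀ s ≤ L} :=
        (dependsOn_fWeight s).mono (Set.singleton_subset_iff.2 hl.le)
      have h4 : DependsOn (fun Z : PVertex A a → Config p =>
          ∏ C ∈ downAtoms C₀ s, copyPhase C₀ b γ s C Z) {s | level C₀ s ≤ L} := by
        refine dependsOn_prod fun C hC => (dependsOn_copyPhase hC).mono ?_
        rintro v (rfl | hv)
        · exact hl.le
        · have := level_of_mem_kids hatom hC hv
          rw [Set.mem_ofPred_eq]
          omega
      exact (dependsOn_mul h3 h4).mono (Set.union_subset le_rfl le_rfl)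
    have h5 : DependsOn (fun Z : PVertex A a → Config p => ∏ s ∈ F L, fWeight β (Z s))
        {s | level C₀ s ≤ L} :=
      dependsOn_prod fun s hs => (dependsOn_fWeight s).mono
        (Set.singleton_subset_iff.2 (Finset.mem_filter.1 hs).2.le)
    simpa using dependsOn_mul (dependsOn_mul h1 h2) h5
  rw [marg_mul_left hdep]
  · rw [hkey, mul_assoc (o Z * _), ← Finset.prod_mul_distrib]
    rfl
  · intro v hv hv'
    have := (Finset.mem_filter.1 hv').2
    rw [Set.mem_ofPred_eq] at hv
    omega

/-- The observable and the phases of the edges in the copy through the root. -/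
def rootWeight (γ : Fin p → Fin c → ℝ) (C₀ : Fin c) (b : Fin n) (z : PVertex A a → Config p) : ℂ :=
  mid (z (root A a)) * mid (z (step (root A a) C₀ b)) *
    phase A γ C₀ (pairBall A C₀ a b p) fun k => z (step (root A a) C₀ k)

theorem mem_pairBall {C : Fin c} {u v k : Fin n} {m : ℕ} : k ∈ pairBall A C u v m ↔
    k ∈ (A C).support ∧ min ((A C).dist k u) ((A C).dist k v) ≤ m := by
  simp [pairBall]

theorem dependsOn_rootWeight (hab : (A C₀).Adj a b) :
    DependsOn (rootWeight (A := A) (a := a) γ C₀ b) {s | level C₀ s = 0} := by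
  intro z z' h
  have ha := support_left hab
  rw [rootWeight, rootWeight, h (root A a) rfl,
    h (step (root A a) C₀ b) (level_step_root ha (support_left hab.symm))]
  congr 1
  exact phase_congr fun k hk => h _ (level_step_root ha (mem_pairBall.1 hk).1)

theorem filter_level_zero (ha : a ∈ (A C₀).support)
    {N : Finset (PVertex A a)} (hN : ∀ x, x ∈ N ↔ depth C₀ b x ≤ p) :
    (N.filter fun s => level C₀ s = 0) = (pairBall A C₀ a b p).image (step (root A a) C₀) := by
  ext w
  simp only [Finset.mem_filter, Finset.mem_image, mem_pairBall]
  constructor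
  · rintro ⟨hw, hl⟩
    rcases exists_eq_step ha w with ⟨k, hk, rfl⟩ | ⟨s, C, k, hC, hk, hks, rfl⟩
    · refine ⟨k, ⟨hk, ?_⟩, rfl⟩
      rw [← depth_step_root (b := b) ha hk]
      exact (hN _).1 hw
    · rw [level_step hC hk hks] at hl
      omega
  · rintro ⟨k, ⟨hk, hd⟩, rfl⟩
    rw [hN, depth_step_root ha hk]
    exact ⟨hd, level_step_root ha hk⟩

/-- At level `0` the path sum is the formula for the value of an edge. -/
theorem levelSum_zero (hab : (A C₀).Adj a b)
    {N : Finset (PVertex A a)} (hN : ∀ x, x ∈ N ↔ depth C₀ b x ≤ p)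
    (z : PVertex A a → Config p) :
    levelSum γ β C₀ b N (rootWeight γ C₀ b) 0 z = -edgeValue A γ β C₀ a b := by
  have ha := support_left hab
  have hb := support_left hab.symm
  have hinj : Set.InjOn (step (root A a) C₀) (pairBall A C₀ a b p) :=
    injOn_step (root A a) ha fun k hk => (mem_pairBall.1 hk).1
  have hle : (N.filter fun s => level C₀ s ≤ 0) =
      (pairBall A C₀ a b p).image (step (root A a) C₀) := by
    simp only [nonpos_iff_eq_zero]
    exact filter_level_zero ha hN
  rw [levelSum, hle, edgeValue, neg_neg]
  refine marg_image hinj _ _ _ fun y Z hy _ => ?_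
  have hmem {k : Fin n} (hk : k ∈ pairBall A C₀ a b p) :
      Z (step (root A a) C₀ k) = extend (pairBall A C₀ a b p) 1 y k :=
    (hy k hk).trans (extend_of_mem _ _ hk).symm
  have h1 : rootWeight γ C₀ b Z = mid (extend (pairBall A C₀ a b p) 1 y a) *
      mid (extend (pairBall A C₀ a b p) 1 y b) *
      phase A γ C₀ (pairBall A C₀ a b p) (extend (pairBall A C₀ a b p) 1 y) := by
    rw [rootWeight, ← hmem (mem_pairBall.2 ⟨ha, by simp⟩), ← hmem (mem_pairBall.2 ⟨hb, by simp⟩),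
      step_root_self ha]
    congr 1
    exact phase_congr fun k hk => hmem hk
  have h2 : ∏ s ∈ N with level C₀ s < 0, openWeight C₀ b γ β s Z = 1 := by
    rw [Finset.filter_false_of_mem, Finset.prod_empty]
    intro s _
    omega
  have h3 : ∏ s ∈ N with level C₀ s = 0, closedWeight C₀ b γ β s Z =
      ∏ k : pairBall A C₀ a b p, (fWeight β (y k) *
        ∏ C' ∈ otherAtoms A C₀ k,
          iterG A γ β (p - min ((A C₀).dist k a) ((A C₀).dist k b)) C' k (y k)) := by
    rw [filter_level_zero ha hN, Finset.prod_image hinj]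
    refine Eq.trans (Finset.prod_attach _ _).symm (Finset.prod_congr rfl fun k _ => ?_)
    have hk := (mem_pairBall.1 k.2).1
    rw [closedWeight, downAtoms, hy k k.2, headType_step_root ha hk, label_step_root ha hk,
      depth_step_root ha hk]
  rw [h1, h2, h3]
  ring

/-- The path sum with the phases of all the copies. -/
theorem levelSum_last (hatom : ∀ C, ((A C).induce (A C).support).Connected)
    {N : Finset (PVertex A a)} (hN : ∀ x, x ∈ N ↔ depth C₀ b x ≤ p)
    (o : (PVertex A a → Config p) → ℂ) (z : PVertex A a → Config p) :
    levelSum γ β C₀ b N o (p + 1) z =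
      marg N (fun Z => o Z * ∏ s ∈ N, openWeight C₀ b γ β s Z) z := by
  have hl {s : PVertex A a} (hs : s ∈ N) : level C₀ s ≤ p :=
    (level_le_depth hatom s).trans ((hN s).1 hs)
  rw [levelSum, Finset.filter_true_of_mem fun s hs => (hl hs).trans (Nat.le_succ p)]
  refine marg_congr z fun Z => ?_
  rw [Finset.filter_true_of_mem fun s hs => Nat.lt_succ_of_le (hl hs),
    Finset.filter_false_of_mem, Finset.prod_empty, mul_one]
  intro s hs
  have := hl hs
  omega

/-- The iterated sums over the copies add up to the path sum over all the vertices. -/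
theorem marg_openWeight_eq (hatom : ∀ C, ((A C).induce (A C).support).Connected)
    (hab : (A C₀).Adj a b) {N : Finset (PVertex A a)} (hN : ∀ x, x ∈ N ↔ depth C₀ b x ≤ p)
    (z : PVertex A a → Config p) :
    marg N (fun Z => rootWeight γ C₀ b Z * ∏ s ∈ N, openWeight C₀ b γ β s Z) z =
      -edgeValue A γ β C₀ a b := by
  rw [← levelSum_last hatom hN, ← levelSum_zero hab hN z]
  have key (L : ℕ) : levelSum γ β C₀ b N (rootWeight γ C₀ b) L z =
      levelSum γ β C₀ b N (rootWeight γ C₀ b) 0 z := by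
    induction L with
    | zero => rfl
    | succ L ih =>
      rw [levelSum_succ hatom (support_left hab) hN (dependsOn_rootWeight hab), ih]
  exact key _

end Levels

/-! ### Sums over oriented edges -/

section EdgeSums

/-- A sum over edges, each edge being oriented towards the larger label. -/
theorem sum_edgeFinset_eq_sum_lt {V M : Type*} [Fintype V] [AddCommMonoid M] {n : ℕ}
    (G : SimpleGraph V) [Fintype G.edgeSet] (l : V → Fin n) (hl : ∀ u v, G.Adj u v → l u ≠ l v)
    [DecidablePred fun q : V × V => G.Adj q.1 q.2 ∧ l q.1 < l q.2] (g : Sym2 V → M) :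
    ∑ e ∈ G.edgeFinset, g e =
      ∑ q : V × V with G.Adj q.1 q.2 ∧ l q.1 < l q.2, g s(q.1, q.2) := by
  symm
  refine Finset.sum_bij (fun q _ => s(q.1, q.2)) ?_ ?_ ?_ fun _ _ => rfl
  · intro q hq
    exact SimpleGraph.mem_edgeFinset.2 (Finset.mem_filter.1 hq).2.1
  · intro q hq q' hq' h
    have h1 := (Finset.mem_filter.1 hq).2.2
    have h2 := (Finset.mem_filter.1 hq').2.2
    rcases Sym2.eq_iff.1 h with ⟨h3, h4⟩ | ⟨h3, h4⟩
    · exact Prod.ext h3 h4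
    · rw [h3, h4] at h1
      exact (lt_asymm h1 h2).elim
  · intro e he
    induction e with
    | _ u v =>
      have h : G.Adj u v := SimpleGraph.mem_edgeFinset.1 he
      rcases lt_or_gt_of_ne (hl u v h) with h' | h'
      · exact ⟨(u, v), Finset.mem_filter.2 ⟨Finset.mem_univ _, h, h'⟩, rfl⟩
      · exact ⟨(v, u), Finset.mem_filter.2 ⟨Finset.mem_univ _, h.symm, h'⟩, Sym2.eq_swap⟩

end EdgeSums

/-! ### The path sum of a neighbourhood -/

section TreePathSum

variable {n c p : ℕ} {A : Fin c → SimpleGraph (Fin n)} {a : Fin n} {C₀ : Fin c} {b : Fin n}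
  {γ : Fin p → Fin c → ℝ} {β : Fin p → ℝ}

open Classical in
/-- The oriented edges of type `C` with both ends in `N`. -/
def pairsIn (N : Finset (PVertex A a)) (C : Fin c) : Finset (PVertex A a × PVertex A a) :=
  (N ×ˢ N).filter fun q => (typeGraph A a C).Adj q.1 q.2 ∧ label A a q.1 < label A a q.2

open Classical in
/-- The oriented edges of the atom `C` with both ends in `S`. -/
def atomPairs (A : Fin c → SimpleGraph (Fin n)) (C : Fin c) (S : Finset (Fin n)) :
    Finset (Fin n × Fin n) :=
  (S ×ˢ S).filter fun q => q.1 < q.2 ∧ (A C).Adj q.1 q.2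

theorem phase_eq (γ : Fin p → Fin c → ℝ) (C : Fin c) (S : Finset (Fin n)) (z : Fin n → Config p) :
    phase A γ C S z =
      Complex.exp (-Complex.I * ∑ q ∈ atomPairs A C S, gamDot γ C (z q.1) (z q.2)) := rfl

/-- The edges of one copy of the atom `C` are the edges of the atom. -/
theorem sum_pairsIn_fiber {N : Finset (PVertex A a)} {C : Fin c} {s : PVertex A a}
    (hs : base C s = s) (hsupp : label A a s ∈ (A C).support) {S : Finset (Fin n)}
    (hS : ∀ k ∈ (A C).support, step s C k ∈ N ↔ k ∈ S)
    (g : PVertex A a × PVertex A a → ℂ) :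
    ∑ q ∈ pairsIn N C with base C q.1 = s, g q =
      ∑ q ∈ atomPairs A C S, g (step s C q.1, step s C q.2) := by
  classical
  have hstep {x : PVertex A a} (hx : label A a x ∈ (A C).support) (hb : base C x = s) :
      step s C (label A a x) = x := step_of_base_eq hsupp hx (hs.trans hb.symm)
  have hmem {q : PVertex A a × PVertex A a}
      (hq : q ∈ (pairsIn N C).filter fun q => base C q.1 = s) :
      (q.1 ∈ N ∧ q.2 ∈ N) ∧ (A C).Adj (label A a q.1) (label A a q.2) ∧
        label A a q.1 < label A a q.2 ∧ base C q.1 = s ∧ base C q.2 = s := by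
    obtain ⟨h1, h2⟩ := Finset.mem_filter.1 hq
    obtain ⟨h3, h4, h5⟩ := Finset.mem_filter.1 h1
    obtain ⟨h6, h7⟩ := typeGraph_adj_iff.1 h4
    exact ⟨Finset.mem_product.1 h3, h6, h5, h2, h7 ▸ h2⟩
  refine Finset.sum_bij' (fun q _ => (label A a q.1, label A a q.2))
    (fun q _ => (step s C q.1, step s C q.2)) ?_ ?_ ?_ ?_ ?_
  · intro q hq
    obtain ⟨⟨h1, h2⟩, h3, h4, h5, h6⟩ := hmem hq
    refine Finset.mem_filter.2 ⟨Finset.mem_product.2 ⟨(hS _ (support_left h3)).1 ?_,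
      (hS _ (support_left h3.symm)).1 ?_⟩, h4, h3⟩
    · rwa [hstep (support_left h3) h5]
    · rwa [hstep (support_left h3.symm) h6]
  · intro q hq
    obtain ⟨h1, h2, h3⟩ := Finset.mem_filter.1 hq
    obtain ⟨h4, h5⟩ := Finset.mem_product.1 h1
    have h6 := support_left h3
    have h7 := support_left h3.symm
    refine Finset.mem_filter.2 ⟨Finset.mem_filter.2 ⟨Finset.mem_product.2
      ⟨(hS _ h6).2 h4, (hS _ h7).2 h5⟩, ?_, ?_⟩, ?_⟩
    · rw [typeGraph_adj_iff, label_step hsupp h6, label_step hsupp h7, base_step, base_step]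
      exact ⟨h3, rfl⟩
    · rwa [label_step hsupp h6, label_step hsupp h7]
    · rw [base_step, hs]
  · intro q hq
    obtain ⟨-, h3, -, h5, h6⟩ := hmem hq
    exact Prod.ext (hstep (support_left h3) h5) (hstep (support_left h3.symm) h6)
  · intro q hq
    obtain ⟨-, -, h3⟩ := Finset.mem_filter.1 hq
    exact Prod.ext (label_step hsupp (support_left h3)) (label_step hsupp (support_left h3.symm))
  · intro q hq
    obtain ⟨-, h3, -, h5, h6⟩ := hmem hq
    rw [hstep (support_left h3) h5, hstep (support_left h3.symm) h6]

theorem depth_base_le {C : Fin c} {x : PVertex A a}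
    (hx : label A a x ∈ (A C).support) : depth C₀ b (base C x) ≤ depth C₀ b x := by
  rcases root_or_mem_downAtoms (C₀ := C₀) hx with ⟨h, -⟩ | h
  · rw [h]
    exact Nat.zero_le _
  · conv_rhs => rw [← step_base_label hx, depth_step h hx]
    exact Nat.le_add_right _ _

open Classical in
/-- The edges between the vertices of small depth, sorted by the copies in which they lie. -/
theorem sum_pairsIn (hatom : ∀ C, ((A C).induce (A C).support).Connected)
    (hab : (A C₀).Adj a b) {N : Finset (PVertex A a)} (hN : ∀ x, x ∈ N ↔ depth C₀ b x ≤ p)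
    (C : Fin c) (g : PVertex A a × PVertex A a → ℂ) :
    ∑ q ∈ pairsIn N C, g q =
      (∑ s ∈ N, if C ∈ downAtoms C₀ s then
        ∑ q ∈ atomPairs A C (insert (label A a s) (ballBelow C₀ b p s C)),
          g (step s C q.1, step s C q.2) else 0) +
      if C = C₀ then ∑ q ∈ atomPairs A C₀ (pairBall A C₀ a b p),
          g (step (root A a) C₀ q.1, step (root A a) C₀ q.2) else 0 := by
  have ha := support_left hab
  have hroot : root A a ∈ N := (hN _).2 (Nat.zero_le _)
  have hmaps : ∀ q ∈ pairsIn N C, base C q.1 ∈ N := by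
    intro q hq
    obtain ⟨h1, h2, -⟩ := Finset.mem_filter.1 hq
    rw [hN]
    exact (depth_base_le (support_left (typeGraph_adj_iff.1 h2).1)).trans
      ((hN _).1 (Finset.mem_product.1 h1).1)
  have hif : (if C = C₀ then ∑ q ∈ atomPairs A C₀ (pairBall A C₀ a b p),
      g (step (root A a) C₀ q.1, step (root A a) C₀ q.2) else 0) =
      ∑ s ∈ N, if s = root A a then (if C = C₀ then ∑ q ∈ atomPairs A C₀ (pairBall A C₀ a b p),
        g (step (root A a) C₀ q.1, step (root A a) C₀ q.2) else 0) else 0 := by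
    rw [Finset.sum_ite_eq' N (root A a), if_pos hroot]
  rw [hif, ← Finset.sum_add_distrib, ← Finset.sum_fiberwise_of_maps_to hmaps]
  refine Finset.sum_congr rfl fun s hs => ?_
  by_cases hC : C ∈ downAtoms C₀ s
  · have hno : (if s = root A a then (if C = C₀ then ∑ q ∈ atomPairs A C₀ (pairBall A C₀ a b p),
        g (step (root A a) C₀ q.1, step (root A a) C₀ q.2) else 0) else 0) = 0 := by
      rw [ite_eq_right_iff]
      intro h
      rw [ite_eq_right_iff]
      intro h'
      subst h
      exact (not_root_copy hC ⟨rfl, h'⟩).elim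
    rw [hno, add_zero, if_pos hC]
    refine sum_pairsIn_fiber (base_of_mem_downAtoms hC) (mem_downAtoms.1 hC).2 (fun k hk => ?_) g
    have hd := (hN s).1 hs
    rw [hN, depth_step hC hk, Finset.mem_insert, mem_ballBelow hatom hC]
    by_cases hks : k = label A a s
    · simp [hks, hd]
    · simp only [hks, hk, ne_eq, not_false_eq_true, true_and, false_or]
      omega
  · rw [if_neg hC, zero_add]
    by_cases hr : s = root A a ∧ C = C₀
    · obtain ⟨rfl, rfl⟩ := hr
      rw [if_pos rfl, if_pos rfl]
      refine sum_pairsIn_fiber rfl ha (fun k hk => ?_) g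
      rw [hN, depth_step_root ha hk, mem_pairBall]
      simp [hk]
    · have : (pairsIn N C).filter (fun q => base C q.1 = s) = ∅ := by
        rw [Finset.filter_eq_empty_iff]
        rintro q hq rfl
        obtain ⟨-, h2, -⟩ := Finset.mem_filter.1 hq
        rcases root_or_mem_downAtoms (C₀ := C₀) (support_left (typeGraph_adj_iff.1 h2).1) with h | h
        · exact hr h
        · exact hC h
      rw [this, Finset.sum_empty]
      split_ifs with h1 h2
      · exact (hr ⟨h1, h2⟩).elim
      · rfl
      · rfl

open Classical in
theorem sum_inducedOn_edges (N : Finset (PVertex A a)) (C : Fin c)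
    (z : PVertex A a → Config p) :
    ∑ e ∈ (inducedOn (typeGraph A a C) N).edgeFinset, edgeDot γ C (fun x : N => z x) e =
      ∑ q ∈ pairsIn N C, gamDot γ C (z q.1) (z q.2) := by
  rw [sum_edgeFinset_eq_sum_lt _ (fun x : N => label A a x.1)
    fun u v h => (typeGraph_adj_iff.1 h).1.ne]
  refine Finset.sum_bij (fun q _ => (q.1.1, q.2.1)) ?_ ?_ ?_ fun _ _ => rfl
  · intro q hq
    exact Finset.mem_filter.2 ⟨Finset.mem_product.2 ⟨q.1.2, q.2.2⟩, (Finset.mem_filter.1 hq).2⟩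
  · intro q _ q' _ h
    exact Prod.ext (Subtype.ext (Prod.ext_iff.1 h).1) (Subtype.ext (Prod.ext_iff.1 h).2)
  · intro q hq
    obtain ⟨h1, h2⟩ := Finset.mem_filter.1 hq
    obtain ⟨h3, h4⟩ := Finset.mem_product.1 h1
    exact ⟨(⟨q.1, h3⟩, ⟨q.2, h4⟩), Finset.mem_filter.2 ⟨Finset.mem_univ _, h2⟩, rfl⟩

/-- The phase of all the edges between vertices of small depth is a product over the copies: the one
through the root, and those attached at the vertices `s`. -/
theorem exp_edges_eq (hatom : ∀ C, ((A C).induce (A C).support).Connected)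
    (hab : (A C₀).Adj a b) {N : Finset (PVertex A a)} (hN : ∀ x, x ∈ N ↔ depth C₀ b x ≤ p)
    (z : PVertex A a → Config p) :
    Complex.exp (-Complex.I * ∑ C, ∑ q ∈ pairsIn N C, gamDot γ C (z q.1) (z q.2)) =
      (phase A γ C₀ (pairBall A C₀ a b p) fun k => z (step (root A a) C₀ k)) *
        ∏ s ∈ N, ∏ C ∈ downAtoms C₀ s, copyPhase C₀ b γ s C z := by
  classical
  have h (C : Fin c) := sum_pairsIn hatom hab hN C
    fun q => gamDot γ C (z q.1) (z q.2)
  simp only [h, Finset.sum_add_distrib, mul_add, Complex.exp_add]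
  rw [mul_comm]
  congr 1
  · rw [phase_eq, Finset.sum_ite_eq' Finset.univ C₀, if_pos (Finset.mem_univ _)]
  · rw [Finset.sum_comm, Finset.mul_sum, Complex.exp_sum]
    refine Finset.prod_congr rfl fun s _ => ?_
    rw [← Finset.sum_filter, Finset.filter_mem_eq_inter, Finset.univ_inter, Finset.mul_sum,
      Complex.exp_sum]
    rfl

/-- The path sum over the vertices of small depth is the value of the edge. -/
theorem pathSum_depth_le (hatom : ∀ C, ((A C).induce (A C).support).Connected)
    (hab : (A C₀).Adj a b) {N : Finset (PVertex A a)} (hN : ∀ x, x ∈ N ↔ depth C₀ b x ≤ p)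
    (hx : root A a ∈ N) (hy : step (root A a) C₀ b ∈ N) :
    pathSum (fun C => inducedOn (typeGraph A a C) N) γ β ⟨root A a, hx⟩
      ⟨step (root A a) C₀ b, hy⟩ = -edgeValue A γ β C₀ a b := by
  classical
  rw [← marg_openWeight_eq hatom hab hN fun _ => 1, pathSum, marg]
  refine Finset.sum_congr rfl fun y _ => ?_
  set Z := Function.updateFinset (fun _ => (1 : Config p)) N y with hZ
  have hy' : y = fun x : N => Z x := by
    funext x
    rw [hZ, Function.updateFinset, dif_pos x.2]
  have hedge (C : Fin c) [Fintype (inducedOn (typeGraph A a C) N).edgeSet] :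
      ∑ e ∈ (inducedOn (typeGraph A a C) N).edgeFinset, edgeDot γ C y e =
      ∑ q ∈ pairsIn N C, gamDot γ C (Z q.1) (Z q.2) := by
    rw [← sum_inducedOn_edges, ← hy']
    exact Finset.sum_congr (by ext; simp) fun _ _ => rfl
  simp only [hedge]
  rw [exp_edges_eq hatom hab hN, rootWeight]
  have h1 : ∏ s ∈ N, openWeight C₀ b γ β s Z = (∏ w, fWeight β (y w)) *
      ∏ s ∈ N, ∏ C ∈ downAtoms C₀ s, copyPhase C₀ b γ s C Z := by
    rw [hy']
    simp only [openWeight, Finset.prod_mul_distrib]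
    congr 1
    exact (Finset.prod_coe_sort N fun s => fWeight β (Z s)).symm
  rw [h1, hy']
  ring

end TreePathSum

/-! ### Expectations of the edges of the product graph -/

section LocalExpectation

variable {n c p : ℕ} {A : Fin c → SimpleGraph (Fin n)} {v₁ : Fin n} {γ : Fin p → Fin c → ℝ}
  {β : Fin p → ℝ}

theorem left_mem_nbhd {V : Type*} (X : SimpleGraph V) (p : ℕ) (x y : V) : x ∈ nbhd X p x y :=
  Or.inl (by simp)

theorem right_mem_nbhd {V : Type*} (X : SimpleGraph V) (p : ℕ) (x y : V) : y ∈ nbhd X p x y :=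
  Or.inr (by simp)

theorem productGraph_adj {x y : PVertex A v₁} :
    (productGraph A v₁).Adj x y ↔ ∃ C, (typeGraph A v₁ C).Adj x y := SimpleGraph.iSup_adj

variable (A v₁) in
/-- The `p`-neighbourhood of `{x, y}` as a finite set. -/
abbrev nbhdFinset (p : ℕ) (x y : PVertex A v₁) : Finset (PVertex A v₁) :=
  (finite_nbhd A v₁ p x y).toFinset

theorem mem_nbhdFinset {x y w : PVertex A v₁} :
    w ∈ nbhdFinset A v₁ p x y ↔ w ∈ nbhd (productGraph A v₁) p x y :=
  Set.Finite.mem_toFinset _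

/-- A finite graph that looks like the `p`-neighbourhood of `{x, y}`, up to edges between vertices
at distance `p`, has the same expectation. -/
theorem expect_eq_localZZ {W : Type*} [Fintype W] [DecidableEq W] (HW : Fin c → SimpleGraph W)
    {x y : PVertex A v₁} (π : nbhdFinset A v₁ p x y → W) (hπ : Function.Injective π)
    (h₁ : ∀ C (u v : nbhdFinset A v₁ p x y), (typeGraph A v₁ C).Adj u.1 v.1 →
      (HW C).Adj (π u) (π v))
    (h₂ : ∀ C (u : nbhdFinset A v₁ p x y) w, (HW C).Adj (π u) w →
      ∃ v, (typeGraph A v₁ C).Adj u.1 v ∧ ∀ hv : v ∈ nbhdFinset A v₁ p x y, π ⟨v, hv⟩ = w)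
    {x' y' : W} (hx' : π ⟨x, mem_nbhdFinset.2 (left_mem_nbhd _ p x y)⟩ = x')
    (hy' : π ⟨y, mem_nbhdFinset.2 (right_mem_nbhd _ p x y)⟩ = y') :
    expect (maState HW γ β) (pauliZ x' * pauliZ y') = localZZ A v₁ γ β x y := by
  subst hx' hy'
  refine expect_eq_of_local_iso (fun C => inducedOn (typeGraph A v₁ C) (nbhdFinset A v₁ p x y)) HW
    γ β π hπ (fun j => {u | u.1 ∈ nbhd (productGraph A v₁) j x y})
    (fun j u hu => nbhd_mono _ (Nat.le_succ j) x y hu)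
    (fun i _ C u v hu h => mem_nbhd_succ hu (productGraph_adj.2 ⟨C, h⟩))
    (fun i _ C u v _ h => h₁ C u v h) (fun i hi C u w hu h => ?_)
    (left_mem_nbhd _ 0 x y) (right_mem_nbhd _ 0 x y)
  obtain ⟨v, hv, hvw⟩ := h₂ C u w h
  have hmem : v ∈ nbhdFinset A v₁ p x y := mem_nbhdFinset.2
    (nbhd_mono _ hi x y (mem_nbhd_succ hu (productGraph_adj.2 ⟨C, hv⟩)))
  exact ⟨⟨v, hmem⟩, hv, hvw hmem⟩

/-- Larger induced subgraphs give the same expectation. -/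
theorem finiteZZ_eq_localZZ {x y : PVertex A v₁} {S : Finset (PVertex A v₁)} (hx : x ∈ S)
    (hy : y ∈ S) (hS : nbhd (productGraph A v₁) p x y ⊆ (S : Set (PVertex A v₁))) :
    finiteZZ A v₁ γ β S x y hx hy = localZZ A v₁ γ β x y :=
  expect_eq_localZZ _ (fun u => ⟨u.1, hS (mem_nbhdFinset.1 u.2)⟩)
    (fun _ _ h => Subtype.ext (congrArg (fun s : S => s.1) h)) (fun _ _ _ h => h)
    (fun _ _ w h => ⟨w.1, h, fun _ => rfl⟩) rfl rfl

theorem localZZ_comm (x y : PVertex A v₁) : localZZ A v₁ γ β x y = localZZ A v₁ γ β y x := by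
  have hmem (w : PVertex A v₁) : w ∈ nbhd (productGraph A v₁) p y x →
      w ∈ nbhd (productGraph A v₁) p x y := Or.symm
  rw [← finiteZZ_eq_localZZ (x := y) (y := x) (S := nbhdFinset A v₁ p x y)
    (mem_nbhdFinset.2 (right_mem_nbhd _ p x y)) (mem_nbhdFinset.2 (left_mem_nbhd _ p x y))
    fun w hw => mem_nbhdFinset.2 (hmem w hw)]
  rw [finiteZZ, pauliZ_mul_comm]
  rfl

/-- The expectation of an edge depends only on its type and labels, and is given by the iterative
formula. -/
theorem neg_localZZ_eq_edgeValue (hatom : ∀ C, ((A C).induce (A C).support).Connected) {C : Fin c}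
    {x y : PVertex A v₁} (h : (typeGraph A v₁ C).Adj x y) :
    -localZZ A v₁ γ β x y = edgeValue A γ β C (label A v₁ x) (label A v₁ y) := by
  obtain ⟨hab, hstep⟩ := typeGraph_adj_iff_step.1 h
  generalize ha : label A v₁ x = a at *
  generalize hb : label A v₁ y = b at *
  set φ := reroot x ha with hφ
  have hadj (C : Fin c) (s t : PVertex A a) :
      (typeGraph A v₁ C).Adj (φ s) (φ t) ↔ (typeGraph A a C).Adj s t :=
    typeGraph_adj_follow ha C s t
  have hroot : φ (root A a) = x := rfl
  have hy : φ (step (root A a) C b) = y :=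
    (follow_step ha (t := root A a) (support_left hab) (support_left hab.symm)).trans hstep
  set N := (finite_depth_le (A := A) (a := a) (C₀ := C) (b := b) hatom p).toFinset
  have hN (s : PVertex A a) : s ∈ N ↔ depth C b s ≤ p := Set.Finite.mem_toFinset _
  have hdy : depth C b (step (root A a) C b) = 0 := by
    rw [depth_step_root (support_left hab) (support_left hab.symm)]
    simp
  have hmem {w : PVertex A v₁} (hw : w ∈ nbhd (productGraph A v₁) p x y) : φ.symm w ∈ N := by
    rw [hN]
    refine le_of_mem_nbhd (f := fun w => depth C b (φ.symm w)) (fun u v huv => ?_) ?_ ?_ hw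
    · obtain ⟨C', h'⟩ := productGraph_adj.1 huv
      refine depth_le_succ hatom hab (C := C') ?_
      rwa [← hadj, Equiv.apply_symm_apply, Equiv.apply_symm_apply]
    · rw [← hroot, Equiv.symm_apply_apply]
      rfl
    · rw [← hy, Equiv.symm_apply_apply, hdy]
  have h0 : root A a ∈ N := (hN _).2 (Nat.zero_le _)
  have h1 : step (root A a) C b ∈ N := (hN _).2 (by omega)
  rw [← expect_eq_localZZ (fun C => inducedOn (typeGraph A a C) N)
    (fun u => ⟨φ.symm u.1, hmem (mem_nbhdFinset.1 u.2)⟩)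
    (fun u v h => Subtype.ext (φ.symm.injective (congrArg (fun s : N => s.1) h)))
    (fun C' u v h => (hadj C' _ _).1 (by
      rwa [Equiv.apply_symm_apply, Equiv.apply_symm_apply]))
    (fun C' u w h => ⟨φ w.1, by
      have := (hadj C' _ _).2 (show (typeGraph A a C').Adj (φ.symm u.1) w.1 from h)
      rwa [Equiv.apply_symm_apply] at this, fun _ => Subtype.ext (Equiv.symm_apply_apply _ _)⟩)
    (x' := ⟨root A a, h0⟩) (y' := ⟨step (root A a) C b, h1⟩)
    (Subtype.ext ((Equiv.symm_apply_eq _).2 hroot.symm))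
    (Subtype.ext ((Equiv.symm_apply_eq _).2 hy.symm)),
    expect_maState_eq_pathSum, pathSum_depth_le hatom hab hN, neg_neg]

/-- All the labels occur in the product graph, because a walk in the union of the atoms lifts to
it. -/
theorem exists_edge (hsum : (⨆ C, A C).Connected) {C : Fin c} {a b : Fin n} (h : (A C).Adj a b) :
    ∃ x y, (typeGraph A v₁ C).Adj x y ∧ label A v₁ x = a ∧ label A v₁ y = b := by
  obtain ⟨x, rfl⟩ := exists_label_eq (v₁ := v₁) hsum a
  exact ⟨x, step x C b, typeGraph_adj_step h, rfl,
    label_step (support_left h) (support_left h.symm)⟩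

/-- The symmetry of the formula follows from that of `⟨Z_x Z_y⟩`. -/
theorem edgeValue_comm (hsum : (⨆ C, A C).Connected)
    (hatom : ∀ C, ((A C).induce (A C).support).Connected) {C : Fin c} {a b : Fin n}
    (h : (A C).Adj a b) : edgeValue A γ β C a b = edgeValue A γ β C b a := by
  obtain ⟨x, y, hxy, hx, hy⟩ := exists_edge (v₁ := a) hsum h
  rw [← hx, ← hy, ← neg_localZZ_eq_edgeValue hatom hxy, ← neg_localZZ_eq_edgeValue hatom hxy.symm,
    localZZ_comm]

end LocalExpectation

/-! ### Fundamental domains of edges -/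

section EdgeDomain

variable {n c : ℕ} {A : Fin c → SimpleGraph (Fin n)} {v₁ : Fin n}

/-- Automorphisms keep the type of an edge and the labels of its ends. -/
theorem adj_of_isTypeAut {φ : PVertex A v₁ ≃ PVertex A v₁} (hφ : IsTypeAut A v₁ φ) {C : Fin c}
    {x y x' y' : PVertex A v₁} (h : (typeGraph A v₁ C).Adj x y) (he : s(φ x, φ y) = s(x', y')) :
    (typeGraph A v₁ C).Adj x' y' ∧
      s(label A v₁ x, label A v₁ y) = s(label A v₁ x', label A v₁ y') := by
  have h' := (hφ.adj_iff C x y).2 h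
  rw [← hφ.label_eq x, ← hφ.label_eq y]
  rcases Sym2.eq_iff.1 he with ⟨h1, h2⟩ | ⟨h1, h2⟩
  · rw [← h1, ← h2]
    exact ⟨h', rfl⟩
  · rw [← h1, ← h2]
    exact ⟨h'.symm, Sym2.eq_swap⟩

/-- Two edges of the same type with the same labels lie in one orbit. -/
theorem exists_isTypeAut_edge {C : Fin c} {x y x' y' : PVertex A v₁}
    (h : (typeGraph A v₁ C).Adj x y) (h' : (typeGraph A v₁ C).Adj x' y')
    (hl : s(label A v₁ x, label A v₁ y) = s(label A v₁ x', label A v₁ y')) :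
    ∃ φ, IsTypeAut A v₁ φ ∧ s(φ x, φ y) = s(x', y') := by
  have key : ∀ x' y' : PVertex A v₁, (typeGraph A v₁ C).Adj x' y' →
      label A v₁ x = label A v₁ x' → label A v₁ y = label A v₁ y' →
      ∃ φ, IsTypeAut A v₁ φ ∧ φ x = x' ∧ φ y = y' := by
    intro x' y' h' h1 h2
    obtain ⟨φ, hφ, rfl⟩ := exists_isTypeAut h1
    refine ⟨φ, hφ, rfl, ?_⟩
    rw [← (typeGraph_adj_iff_step.1 h').2, ← (typeGraph_adj_iff_step.1 ((hφ.adj_iff C x y).2 h)).2,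
      hφ.label_eq, h2]
  rcases Sym2.eq_iff.1 hl with ⟨h1, h2⟩ | ⟨h1, h2⟩
  · obtain ⟨φ, hφ, rfl, rfl⟩ := key x' y' h' h1 h2
    exact ⟨φ, hφ, rfl⟩
  · obtain ⟨φ, hφ, rfl, rfl⟩ := key y' x' h'.symm h1 h2
    exact ⟨φ, hφ, Sym2.eq_swap⟩

theorem pair_eq_of_sym2_eq {q q' : Fin n × Fin n} (h : s(q.1, q.2) = s(q'.1, q'.2))
    (hq : q.1 < q.2) (hq' : q'.1 < q'.2) : q = q' := by
  rcases Sym2.eq_iff.1 h with ⟨h1, h2⟩ | ⟨h1, h2⟩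
  · exact Prod.ext h1 h2
  · rw [h1, h2] at hq
    exact (lt_asymm hq hq').elim

variable (A) in
open Classical in
/-- The edges of the atoms, each oriented towards its larger end. -/
def atomEdges : Finset (Σ _ : Fin c, Fin n × Fin n) :=
  Finset.univ.sigma fun C => Finset.univ.filter fun q => q.1 < q.2 ∧ (A C).Adj q.1 q.2

theorem mem_atomEdges {i : Σ _ : Fin c, Fin n × Fin n} :
    i ∈ atomEdges A ↔ i.2.1 < i.2.2 ∧ (A i.1).Adj i.2.1 i.2.2 := by
  simp [atomEdges]

/-- An edge of the product graph lies over exactly one edge of the atoms. -/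
theorem exists_mem_atomEdges {C : Fin c} {x y : PVertex A v₁} (h : (typeGraph A v₁ C).Adj x y) :
    ∃ q : Fin n × Fin n, (⟨C, q⟩ : Σ _ : Fin c, Fin n × Fin n) ∈ atomEdges A ∧
      s(q.1, q.2) = s(label A v₁ x, label A v₁ y) := by
  have hl := (typeGraph_adj_iff.1 h).1
  rcases lt_or_gt_of_ne hl.ne with h' | h'
  · exact ⟨(_, _), mem_atomEdges.2 ⟨h', hl⟩, rfl⟩
  · exact ⟨(_, _), mem_atomEdges.2 ⟨h', hl.symm⟩, Sym2.eq_swap⟩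

/-- One edge above each edge of the atoms: by change of the root, the orbit of an edge is determined
by its type and its labels. -/
theorem exists_isEdgeDomain (hsum : (⨆ C, A C).Connected) : ∃ F, IsEdgeDomain A v₁ F := by
  classical
  have : Nonempty (PVertex A v₁) := ⟨root A v₁⟩
  choose! X Y hXY hX hY using fun (i : Σ _ : Fin c, Fin n × Fin n) (hi : i ∈ atomEdges A) =>
    exists_edge (v₁ := v₁) hsum (mem_atomEdges.1 hi).2
  refine ⟨(atomEdges A).image fun i => (X i, Y i), ⟨?_, ?_⟩⟩
  · intro q hq
    obtain ⟨i, hi, rfl⟩ := Finset.mem_image.1 hq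
    exact productGraph_adj.2 ⟨_, hXY i hi⟩
  · intro x y h
    obtain ⟨C, hC⟩ := productGraph_adj.1 h
    obtain ⟨q, hq, hqs⟩ := exists_mem_atomEdges hC
    refine ⟨(X ⟨C, q⟩, Y ⟨C, q⟩), ⟨Finset.mem_image_of_mem _ hq,
      exists_isTypeAut_edge hC (hXY _ hq) ?_⟩, ?_⟩
    · rw [hX _ hq, hY _ hq, hqs]
    · rintro _ ⟨hr, φ, hφ, he⟩
      obtain ⟨⟨C', q'⟩, hi, rfl⟩ := Finset.mem_image.1 hr
      obtain ⟨h1, h2⟩ := adj_of_isTypeAut hφ hC he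
      obtain rfl := typeGraph_type_unique h1 (hXY _ hi)
      rw [hX _ hi, hY _ hi, ← hqs] at h2
      obtain rfl := pair_eq_of_sym2_eq h2 (mem_atomEdges.1 hq).1 (mem_atomEdges.1 hi).1
      rfl

/-- A sum over a fundamental domain is a sum over the edges of the atoms. -/
theorem IsEdgeDomain.sum_eq (hsum : (⨆ C, A C).Connected)
    {F : Finset (PVertex A v₁ × PVertex A v₁)} (hF : IsEdgeDomain A v₁ F)
    {M : Type*} [AddCommMonoid M] (g : PVertex A v₁ × PVertex A v₁ → M)
    (G : (Σ _ : Fin c, Fin n × Fin n) → M)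
    (hg : ∀ i ∈ atomEdges A, ∀ q, (typeGraph A v₁ i.1).Adj q.1 q.2 →
      s(label A v₁ q.1, label A v₁ q.2) = s(i.2.1, i.2.2) → G i = g q) :
    ∑ q ∈ F, g q = ∑ i ∈ atomEdges A, G i := by
  classical
  have : Nonempty (PVertex A v₁) := ⟨root A v₁⟩
  choose! X Y hXY hX hY using fun (i : Σ _ : Fin c, Fin n × Fin n) (hi : i ∈ atomEdges A) =>
    exists_edge (v₁ := v₁) hsum (mem_atomEdges.1 hi).2
  choose! Q hQ hQu using fun (i : Σ _ : Fin c, Fin n × Fin n) (hi : i ∈ atomEdges A) =>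
    hF.existsUnique (X i) (Y i) (productGraph_adj.2 ⟨_, hXY i hi⟩)
  have hQadj (i) (hi : i ∈ atomEdges A) : (typeGraph A v₁ i.1).Adj (Q i).1 (Q i).2 ∧
      s(label A v₁ (Q i).1, label A v₁ (Q i).2) = s(i.2.1, i.2.2) := by
    obtain ⟨φ, hφ, he⟩ := (hQ i hi).2
    obtain ⟨h1, h2⟩ := adj_of_isTypeAut hφ (hXY i hi) he
    rw [hX i hi, hY i hi] at h2
    exact ⟨h1, h2.symm⟩
  symm
  refine Finset.sum_bij (fun i _ => Q i) (fun i hi => (hQ i hi).1) ?_ ?_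
    (fun i hi => hg i hi _ (hQadj i hi).1 (hQadj i hi).2)
  · rintro ⟨C, q⟩ hi ⟨C', q'⟩ hj h
    obtain ⟨h1, h2⟩ := hQadj _ hi
    obtain ⟨h3, h4⟩ := hQadj _ hj
    rw [h] at h1 h2
    obtain rfl := typeGraph_type_unique h1 h3
    obtain rfl := pair_eq_of_sym2_eq (h2.symm.trans h4) (mem_atomEdges.1 hi).1
      (mem_atomEdges.1 hj).1
    rfl
  · intro q hq
    obtain ⟨C, hC⟩ := productGraph_adj.1 (hF.adj q hq)
    obtain ⟨r, hr, hrs⟩ := exists_mem_atomEdges hC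
    refine ⟨⟨C, r⟩, hr, (hQu _ hr q ⟨hq, exists_isTypeAut_edge (hXY _ hr) hC ?_⟩).symm⟩
    rw [hX _ hr, hY _ hr, hrs]

open Classical in
theorem totalEdges_eq_card : totalEdges A = (atomEdges A).card := by
  rw [totalEdges, atomEdges, Finset.card_sigma]
  refine Finset.sum_congr rfl fun C _ => ?_
  rw [Set.ncard_eq_toFinset_card', Finset.card_eq_sum_ones, Finset.card_eq_sum_ones]
  refine (sum_edgeFinset_eq_sum_lt (A C) (id : Fin n → Fin n) (fun _ _ h => h.ne) _).trans ?_
  refine Finset.sum_congr ?_ fun _ _ => rfl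
  ext q
  simp [and_comm]

theorem totalEdges_ne_zero (hc : 0 < c) (hatom : ∀ C, ((A C).induce (A C).support).Connected) :
    totalEdges A ≠ 0 := by
  obtain ⟨⟨u, v, huv⟩⟩ := (hatom ⟨0, hc⟩).nonempty
  rw [totalEdges_eq_card, ← Nat.pos_iff_ne_zero, Finset.card_pos]
  rcases lt_or_gt_of_ne huv.ne with h | h
  · exact ⟨⟨⟨0, hc⟩, (u, v)⟩, mem_atomEdges.2 ⟨h, huv⟩⟩
  · exact ⟨⟨⟨0, hc⟩, (v, u)⟩, mem_atomEdges.2 ⟨h, huv.symm⟩⟩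

open Classical in
/-- The formula for the cut fraction as an average over the edges of the atoms. -/
theorem cutFormula_eq {p : ℕ} (hc : 0 < c) (hatom : ∀ C, ((A C).induce (A C).support).Connected)
    (γ : Fin p → Fin c → ℝ) (β : Fin p → ℝ) :
    cutFormula A γ β =
      (∑ i ∈ atomEdges A, (1 + edgeValue A γ β i.1 i.2.1 i.2.2) / 2) / (totalEdges A : ℂ) := by
  have h0 : (totalEdges A : ℂ) ≠ 0 := Nat.cast_ne_zero.2 (totalEdges_ne_zero hc hatom)
  have h1 : ∑ C, ∑ q ∈ (Finset.univ : Finset (Fin n × Fin n)).filter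
      (fun q => q.1 < q.2 ∧ (A C).Adj q.1 q.2), edgeValue A γ β C q.1 q.2 =
      ∑ i ∈ atomEdges A, edgeValue A γ β i.1 i.2.1 i.2.2 := by
    rw [atomEdges, Finset.sum_sigma]
  rw [cutFormula, h1, ← Finset.sum_div, Finset.sum_add_distrib, Finset.sum_const,
    ← totalEdges_eq_card, nsmul_eq_mul, mul_one]
  field_simp

end EdgeDomain

/-! ### Covered graphs -/

section Covering

variable {n c p : ℕ} {A : Fin c → SimpleGraph (Fin n)} {v₁ : Fin n} {γ : Fin p → Fin c → ℝ}
  {β : Fin p → ℝ} {W : Type*} {H : Fin c → SimpleGraph W} {π : PVertex A v₁ → W}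

theorem IsTypeCovering.exists_lift (hπ : IsTypeCovering A v₁ H π) {C : Fin c} {x : PVertex A v₁}
    {w : W} (h : (H C).Adj (π x) w) : ∃ y, (typeGraph A v₁ C).Adj x y ∧ π y = w :=
  (hπ.bijOn_type C x).surjOn h

theorem IsTypeCovering.map_adj (hπ : IsTypeCovering A v₁ H π) {C : Fin c} {x y : PVertex A v₁}
    (h : (typeGraph A v₁ C).Adj x y) : (H C).Adj (π x) (π y) :=
  (hπ.bijOn_type C x).mapsTo h

/-- The edges of a graph that is covered by the product graph have only one type. -/
theorem IsTypeCovering.type_unique (hπ : IsTypeCovering A v₁ H π) (C C' : Fin c) (u v : W)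
    (h : (H C).Adj u v) (h' : (H C').Adj u v) : C = C' := by
  obtain ⟨x, rfl⟩ := hπ.surjective u
  obtain ⟨y, hy, rfl⟩ := hπ.exists_lift h
  obtain ⟨y', hy', he⟩ := hπ.exists_lift h'
  obtain rfl : y' = y := (hπ.bijOn x).injOn (productGraph_adj.2 ⟨_, hy'⟩)
    (productGraph_adj.2 ⟨_, hy⟩) he
  exact typeGraph_type_unique hy hy'

/-- The label of a vertex of a graph that is covered by the product graph. -/
def coverLabel (hπ : IsTypeCovering A v₁ H π) (w : W) : Fin n :=
  label A v₁ (Function.surjInv hπ.surjective w)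

theorem coverLabel_apply (hπ : IsTypeCovering A v₁ H π) (x : PVertex A v₁) :
    coverLabel hπ (π x) = label A v₁ x :=
  hπ.label_eq _ _ (Function.surjInv_eq hπ.surjective (π x))

theorem coverLabel_adj (hπ : IsTypeCovering A v₁ H π) {C : Fin c} {u v : W} (h : (H C).Adj u v) :
    (A C).Adj (coverLabel hπ u) (coverLabel hπ v) := by
  obtain ⟨x, rfl⟩ := hπ.surjective u
  obtain ⟨y, hy, rfl⟩ := hπ.exists_lift h
  rw [coverLabel_apply, coverLabel_apply]
  exact (typeGraph_adj_iff.1 hy).1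

theorem exists_adj_coverLabel (hπ : IsTypeCovering A v₁ H π) {C : Fin c} {u : W} {k : Fin n}
    (h : (A C).Adj (coverLabel hπ u) k) : ∃ v, (H C).Adj u v ∧ coverLabel hπ v = k := by
  obtain ⟨x, rfl⟩ := hπ.surjective u
  rw [coverLabel_apply] at h
  refine ⟨π (step x C k), hπ.map_adj (typeGraph_adj_step h), ?_⟩
  rw [coverLabel_apply, label_step (support_left h) (support_left h.symm)]

theorem adj_coverLabel_unique (hπ : IsTypeCovering A v₁ H π) {C : Fin c} {u v v' : W}
    (h : (H C).Adj u v) (h' : (H C).Adj u v') (hl : coverLabel hπ v = coverLabel hπ v') :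
    v = v' := by
  obtain ⟨x, rfl⟩ := hπ.surjective u
  obtain ⟨y, hy, rfl⟩ := hπ.exists_lift h
  obtain ⟨y', hy', rfl⟩ := hπ.exists_lift h'
  rw [coverLabel_apply, coverLabel_apply] at hl
  rw [← (typeGraph_adj_iff_step.1 hy).2, ← (typeGraph_adj_iff_step.1 hy').2, hl]

section Counting

variable [Fintype W]

open Classical in
/-- The number of edges of type `C` with given labels is the number of vertices with one of these
labels. -/
theorem card_edges_over (hπ : IsTypeCovering A v₁ H π) {C : Fin c} {k l : Fin n}
    (h : (A C).Adj k l) :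
    (Finset.univ.filter fun q : W × W =>
      (H C).Adj q.1 q.2 ∧ coverLabel hπ q.1 = k ∧ coverLabel hπ q.2 = l).card =
    (Finset.univ.filter fun w : W => coverLabel hπ w = k).card := by
  refine Finset.card_bij (fun q _ => q.1) ?_ ?_ ?_
  · intro q hq
    simp only [Finset.mem_filter, Finset.mem_univ, true_and] at hq ⊢
    exact hq.2.1
  · rintro ⟨u, v⟩ hq ⟨u', v'⟩ hq' (rfl : u = u')
    simp only [Finset.mem_filter, Finset.mem_univ, true_and] at hq hq'
    rw [adj_coverLabel_unique hπ hq.1 hq'.1 (hq.2.2.trans hq'.2.2.symm)]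
  · intro u hu
    simp only [Finset.mem_filter, Finset.mem_univ, true_and] at hu
    subst hu
    obtain ⟨v, huv, hv⟩ := exists_adj_coverLabel hπ h
    exact ⟨(u, v), by simp [huv, hv], rfl⟩

open Classical in
theorem card_label_eq_of_adj (hπ : IsTypeCovering A v₁ H π) {C : Fin c} {k l : Fin n}
    (h : (A C).Adj k l) :
    (Finset.univ.filter fun w : W => coverLabel hπ w = k).card =
      (Finset.univ.filter fun w : W => coverLabel hπ w = l).card := by
  rw [← card_edges_over hπ h, ← card_edges_over hπ h.symm]
  refine Finset.card_bij (fun q _ => q.swap) ?_ (fun _ _ _ _ h => Prod.swap_injective h) ?_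
  · intro q hq
    simp only [Finset.mem_filter, Finset.mem_univ, true_and] at hq ⊢
    exact ⟨hq.1.symm, hq.2.2, hq.2.1⟩
  · intro q hq
    simp only [Finset.mem_filter, Finset.mem_univ, true_and] at hq
    exact ⟨q.swap, by simpa using ⟨hq.1.symm, hq.2.2, hq.2.1⟩, rfl⟩

open Classical in
/-- All the labels occur equally often. -/
theorem card_label_eq (hsum : (⨆ C, A C).Connected) (hπ : IsTypeCovering A v₁ H π) (k : Fin n) :
    (Finset.univ.filter fun w : W => coverLabel hπ w = k).card =
      (Finset.univ.filter fun w : W => coverLabel hπ w = v₁).card := by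
  have key (k l : Fin n) (q : (⨆ C, A C).Walk k l) :
      (Finset.univ.filter fun w : W => coverLabel hπ w = k).card =
        (Finset.univ.filter fun w : W => coverLabel hπ w = l).card := by
    induction q with
    | nil => rfl
    | cons h q ih =>
      obtain ⟨C, hC⟩ := SimpleGraph.iSup_adj.1 h
      exact (card_label_eq_of_adj hπ hC).trans ih
  obtain ⟨q⟩ := hsum.preconnected k v₁
  exact key k v₁ q

open Classical in
/-- A sum over the edges of a covered graph, of a function of the types and labels. -/
theorem sum_cover_edges (hsum : (⨆ C, A C).Connected) (hπ : IsTypeCovering A v₁ H π)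
    (g : Sym2 W → ℂ) (G : (Σ _ : Fin c, Fin n × Fin n) → ℂ)
    (hg : ∀ C u v, (H C).Adj u v → g s(u, v) = G ⟨C, (coverLabel hπ u, coverLabel hπ v)⟩) :
    ∑ e ∈ (⨆ C, H C).edgeFinset, g e =
      ((Finset.univ.filter fun w : W => coverLabel hπ w = v₁).card : ℂ) *
        ∑ i ∈ atomEdges A, G i := by
  rw [sum_edgeFinset_iSup H hπ.type_unique, atomEdges, Finset.sum_sigma, Finset.mul_sum]
  refine Finset.sum_congr rfl fun C _ => ?_
  rw [sum_edgeFinset_eq_sum_lt (H C) (coverLabel hπ) fun u v h => (coverLabel_adj hπ h).ne,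
    Finset.mul_sum, ← Finset.sum_fiberwise_of_maps_to
      (g := fun q : W × W => (coverLabel hπ q.1, coverLabel hπ q.2))
      (t := Finset.univ.filter fun q : Fin n × Fin n => q.1 < q.2 ∧ (A C).Adj q.1 q.2)]
  · refine Finset.sum_congr rfl fun r hr => ?_
    obtain ⟨-, hlt, hadj⟩ := Finset.mem_filter.1 hr
    rw [← card_label_eq hsum hπ r.1, ← card_edges_over hπ hadj, ← nsmul_eq_mul]
    refine Eq.trans ?_ (Finset.sum_const (G ⟨C, r⟩))
    rw [Finset.filter_filter]
    refine Finset.sum_congr ?_ fun q hq => ?_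
    · ext q
      simp only [Finset.mem_filter, Finset.mem_univ, true_and, Prod.ext_iff]
      constructor
      · rintro ⟨⟨h1, -⟩, h2, h3⟩
        exact ⟨h1, h2, h3⟩
      · rintro ⟨h1, h2, h3⟩
        exact ⟨⟨h1, by rwa [h2, h3]⟩, h2, h3⟩
    · simp only [Finset.mem_filter, Finset.mem_univ, true_and] at hq
      rw [hg C q.1 q.2 hq.1, hq.2.1, hq.2.2]
  · intro q hq
    obtain ⟨-, h1, h2⟩ := Finset.mem_filter.1 hq
    exact Finset.mem_filter.2 ⟨Finset.mem_univ _, h2, coverLabel_adj hπ h1⟩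

end Counting

variable [Fintype W] [DecidableEq W]

open Classical in
theorem expect_maxCutOp (G : SimpleGraph W) {ψ : (W → ℤˣ) → ℂ} (hψ : expect ψ 1 = 1) :
    expect ψ (maxCutOp G) = ∑ e ∈ G.edgeFinset, (1 - expect ψ (pauliZZ e)) / 2 := by
  have hsmul (a : ℂ) (M : Matrix (W → ℤˣ) (W → ℤˣ) ℂ) : expect ψ (a • M) = a * expect ψ M := by
    simp only [expect, Matrix.smul_mulVec, dotProduct_smul, smul_eq_mul]
  have hadd (M N : Matrix (W → ℤˣ) (W → ℤˣ) ℂ) : expect ψ (M + N) = expect ψ M + expect ψ N := by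
    simp only [expect, Matrix.add_mulVec, dotProduct_add]
  have hneg (M : Matrix (W → ℤˣ) (W → ℤˣ) ℂ) : expect ψ (-M) = -expect ψ M := by
    simp only [expect, Matrix.neg_mulVec, dotProduct_neg]
  have hsum (s : Finset (Sym2 W)) (T : Sym2 W → Matrix (W → ℤˣ) (W → ℤˣ) ℂ) :
      expect ψ (∑ e ∈ s, T e) = ∑ e ∈ s, expect ψ (T e) := by
    induction s using Finset.induction_on with
    | empty => simp [expect]
    | insert e s he ih => rw [Finset.sum_insert he, Finset.sum_insert he, hadd, ih]
  rw [maxCutOp, edgeSum, hsum]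
  refine Finset.sum_congr rfl fun e _ => ?_
  rw [hsmul, hadd, hneg, hψ]
  ring

/-- The expectation of an edge of a covered graph is that of an edge of the product graph above
it. -/
theorem IsTypeCovering.expect_eq_localZZ (hπ : IsTypeCovering A v₁ H π) {x y : PVertex A v₁}
    (hinj : Set.InjOn π (nbhd (productGraph A v₁) p x y)) :
    expect (maState H γ β) (pauliZ (π x) * pauliZ (π y)) = localZZ A v₁ γ β x y :=
  MaQAOA.expect_eq_localZZ H (fun u => π u.1)
    (fun u v h => Subtype.ext (hinj (mem_nbhdFinset.1 u.2) (mem_nbhdFinset.1 v.2) h))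
    (fun _ _ _ h => hπ.map_adj h)
    (fun _ _ _ h => (hπ.exists_lift h).imp fun _ hv => ⟨hv.1, fun _ => hv.2⟩) rfl rfl

/-- Each edge of an atom has equally many edges of the covered graph above it, so that the cut
fraction is the average of the values of the edges of the atoms. -/
theorem IsTypeCovering.cutFraction_eq (hc : 0 < c) (hsum : (⨆ C, A C).Connected)
    (hatom : ∀ C, ((A C).induce (A C).support).Connected) (hπ : IsTypeCovering A v₁ H π)
    (hinj : ∀ x y, (productGraph A v₁).Adj x y →
      Set.InjOn π (nbhd (productGraph A v₁) p x y)) :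
    cutFraction (⨆ C, H C) (maState H γ β) = cutFormula A γ β := by
  classical
  have hcard : ((⨆ C, H C).edgeSet.ncard : ℂ) =
      ((Finset.univ.filter fun w : W => coverLabel hπ w = v₁).card : ℂ) * (totalEdges A : ℂ) := by
    have h := sum_cover_edges hsum hπ (fun _ => 1) (fun _ => 1) fun _ _ _ _ => rfl
    rw [Set.ncard_eq_toFinset_card', totalEdges_eq_card]
    simp only [Finset.sum_const, nsmul_eq_mul, mul_one] at h
    rw [← h]
    congr!
  have hN : ((Finset.univ.filter fun w : W => coverLabel hπ w = v₁).card : ℂ) ≠ 0 := by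
    rw [Nat.cast_ne_zero, ← Nat.pos_iff_ne_zero, Finset.card_pos]
    exact ⟨π (root A v₁), Finset.mem_filter.2 ⟨Finset.mem_univ _, coverLabel_apply hπ _⟩⟩
  have hnum : expect (maState H γ β) (maxCutOp (⨆ C, H C)) =
      ((Finset.univ.filter fun w : W => coverLabel hπ w = v₁).card : ℂ) *
        ∑ i ∈ atomEdges A, (1 + edgeValue A γ β i.1 i.2.1 i.2.2) / 2 := by
    rw [expect_maxCutOp _ (expect_maState_one H γ β)]
    refine sum_cover_edges hsum hπ _
      (fun i => (1 + edgeValue A γ β i.1 i.2.1 i.2.2) / 2) fun C u v h => ?_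
    obtain ⟨x, rfl⟩ := hπ.surjective u
    obtain ⟨y, hy, rfl⟩ := hπ.exists_lift h
    have hZ : expect (maState H γ β) (pauliZZ s(π x, π y)) = localZZ A v₁ γ β x y :=
      hπ.expect_eq_localZZ (hinj x y (productGraph_adj.2 ⟨C, hy⟩))
    simp only [coverLabel_apply]
    rw [hZ, ← neg_localZZ_eq_edgeValue hatom hy, sub_eq_add_neg]
  rw [cutFraction, hnum, hcard, cutFormula_eq hc hatom, mul_div_mul_left _ _ hN]

end Covering

/-! ### The cut fraction of a fundamental domain -/

section FundamentalDomain

variable {n c p : ℕ} {A : Fin c → SimpleGraph (Fin n)} {v₁ : Fin n}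

theorem IsEdgeDomain.card_eq (hsum : (⨆ C, A C).Connected)
    {F : Finset (PVertex A v₁ × PVertex A v₁)} (hF : IsEdgeDomain A v₁ F) :
    F.card = totalEdges A := by
  rw [totalEdges_eq_card, Finset.card_eq_sum_ones, Finset.card_eq_sum_ones]
  exact hF.sum_eq hsum _ _ fun _ _ _ _ _ => rfl

theorem IsEdgeDomain.domainCutFraction_eq (hc : 0 < c) (hsum : (⨆ C, A C).Connected)
    (hatom : ∀ C, ((A C).induce (A C).support).Connected)
    {F : Finset (PVertex A v₁ × PVertex A v₁)} (hF : IsEdgeDomain A v₁ F)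
    (γ : Fin p → Fin c → ℝ) (β : Fin p → ℝ) :
    domainCutFraction A v₁ γ β F = cutFormula A γ β := by
  rw [domainCutFraction, cutFormula_eq hc hatom, hF.card_eq hsum]
  congr 1
  refine hF.sum_eq hsum _ _ fun i hi q hq hl => ?_
  have h := (mem_atomEdges.1 hi).2
  have hv : edgeValue A γ β i.1 i.2.1 i.2.2 =
      edgeValue A γ β i.1 (label A v₁ q.1) (label A v₁ q.2) := by
    rcases Sym2.eq_iff.1 hl with ⟨h1, h2⟩ | ⟨h1, h2⟩
    · rw [h1, h2]
    · rw [h1, h2, edgeValue_comm hsum hatom h]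
  rw [hv, ← neg_localZZ_eq_edgeValue hatom hq, sub_eq_add_neg]

end FundamentalDomain

end MaQAOA

theorem mainTheorem1 {n c p : ℕ} (hc : 0 < c) (A : Fin c → SimpleGraph (Fin n))
    (hsum : (⨆ C, A C).Connected)
    (hatom : ∀ C, ((A C).induce (A C).support).Connected)
    (v₁ : Fin n) (γ : Fin p → Fin c → ℝ) (β : Fin p → ℝ) :
    -- the expectation of each edge of the additive product graph
    (∀ C a b, (A C).Adj a b →
      (∃ x y, (MaQAOA.typeGraph A v₁ C).Adj x y ∧
        MaQAOA.label A v₁ x = a ∧ MaQAOA.label A v₁ y = b) ∧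
      ∀ x y, (MaQAOA.typeGraph A v₁ C).Adj x y →
        MaQAOA.label A v₁ x = a → MaQAOA.label A v₁ y = b →
        -MaQAOA.localZZ A v₁ γ β x y = MaQAOA.edgeValue A γ β C a b ∧
        ∀ (S : Finset (MaQAOA.PVertex A v₁)) (hx : x ∈ S) (hy : y ∈ S),
          MaQAOA.nbhd (MaQAOA.productGraph A v₁) p x y ⊆ (S : Set (MaQAOA.PVertex A v₁)) →
          -MaQAOA.finiteZZ A v₁ γ β S x y hx hy = MaQAOA.edgeValue A γ β C a b) ∧
    -- the expected cut fraction of the additive product graph, per fundamental domain of edges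
    ((∃ F, MaQAOA.IsEdgeDomain A v₁ F) ∧
      ∀ F, MaQAOA.IsEdgeDomain A v₁ F →
        F.card = MaQAOA.totalEdges A ∧
        MaQAOA.domainCutFraction A v₁ γ β F = MaQAOA.cutFormula A γ β) ∧
    -- the expected cut fraction of the finite graphs that look like it up to distance `p`
    (∀ (W : Type*) [Fintype W] [DecidableEq W] (H : Fin c → SimpleGraph W)
      (π : MaQAOA.PVertex A v₁ → W),
      MaQAOA.IsTypeCovering A v₁ H π →
      (∀ x y, (MaQAOA.productGraph A v₁).Adj x y →
        Set.InjOn π (MaQAOA.nbhd (MaQAOA.productGraph A v₁) p x y)) →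
      MaQAOA.cutFraction (⨆ C, H C) (MaQAOA.maState H γ β) = MaQAOA.cutFormula A γ β) ∧
    -- with equal angles for all edge types, the states are those of the standard QAOA
    (∀ γ' : Fin p → ℝ, (∀ i C, γ i C = γ' i) →
      (∀ S : Finset (MaQAOA.PVertex A v₁),
        MaQAOA.maState (fun C => MaQAOA.inducedOn (MaQAOA.typeGraph A v₁ C) S) γ β =
          MaQAOA.qaoaState (MaQAOA.inducedOn (MaQAOA.productGraph A v₁) S) γ' β) ∧
      ∀ (W : Type*) [Fintype W] [DecidableEq W] (H : Fin c → SimpleGraph W)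
      (π : MaQAOA.PVertex A v₁ → W),
        MaQAOA.IsTypeCovering A v₁ H π →
        MaQAOA.maState H γ β = MaQAOA.qaoaState (⨆ C, H C) γ' β) := by
  refine ⟨fun C a b hab => ⟨MaQAOA.exists_edge hsum hab, ?_⟩,
    ⟨MaQAOA.exists_isEdgeDomain hsum, fun F hF => ⟨hF.card_eq hsum,
      hF.domainCutFraction_eq hc hsum hatom γ β⟩⟩,
    fun W _ _ H π hπ hinj => hπ.cutFraction_eq hc hsum hatom hinj,
    fun γ' hγ => ⟨fun S => ?_, fun W _ _ H π hπ => ?_⟩⟩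
  · rintro x y hxy rfl rfl
    have h := MaQAOA.neg_localZZ_eq_edgeValue (γ := γ) (β := β) hatom hxy
    refine ⟨h, fun S hx hy hS => ?_⟩
    rw [MaQAOA.finiteZZ_eq_localZZ hx hy hS, h]
  · refine MaQAOA.maState_eq_qaoaState (W := S)
      (fun C => MaQAOA.inducedOn (MaQAOA.typeGraph A v₁ C) S)
      (MaQAOA.inducedOn (MaQAOA.productGraph A v₁) S) ?_
      (fun C C' u v (h : (MaQAOA.typeGraph A v₁ C).Adj u.1 v.1)
        (h' : (MaQAOA.typeGraph A v₁ C').Adj u.1 v.1) => MaQAOA.typeGraph_type_unique h h')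
      γ γ' hγ β
    ext u v
    rw [SimpleGraph.iSup_adj]
    exact MaQAOA.productGraph_adj
  · exact MaQAOA.maState_eq_qaoaState H _ rfl hπ.type_unique γ γ' hγ β
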